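/- **Setting.** Let $\ell,\ell_1>0$ and let $f\in C^1([0,1);[0,\infty))$ be nondecreasing with $f^{-1}(0)=\{0\}$. Put $f_1(t):=t\,f(1-t)$ for $t\in(0,1]$, and assume that $f_1$ is strictly decreasing, that $t\mapsto f_1(\sqrt t)$ is convex, and that $f_1(t)=\ell-\ell_1t+o(t)$ as $t\to0^+$. For $s\ge 0$ and $\alpha,\beta\in H^1_{\rm loc}(\mathbb R)$ (identified with their continuous representatives), $0\le\beta\le1$, let $$\mathcal G_s(\alpha,\beta):=\int_{\mathbb R}\Big(s^2f^2(\beta)|\alpha'|^2+\frac{(1-\beta)^2}{4}+|\beta'|^2\Big)\,dt\in[0,\infty],$$ with the conventions $f(1)=\infty$ and $0\cdot\infty=0$. Let $\mathcal U_1$ be the set of all $(\alpha,\beta)\in H^1_{\rm loc}(\mathbb R)^2$ with $\alpha'\in L^1(\mathbb R)$, $\big|\int_{\mathbb R}\alpha'\,dt\big|=1$, $0\le\beta\le1$ and $\lim_{|t|\to\infty}\beta(t)=1$, and let $g_0(s):=\inf_{\mathcal U_1}\mathcal G_s$. An *optimal profile* for $g_0(s)$ is a function $\beta$ such that $(\alpha,\beta)\in\mathcal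 U_1$ and $\mathcal G_s(\alpha,\beta)=g_0(s)$ for some $\alpha$, if $g_0(s)<1$; if $g_0(s)\ge 1$, it is the function $\beta(t)=1-e^{-|t|/2}$. Let $m_s$ be the minimum value of an optimal profile for $g_0(s)$, and for $s,s'\ge0$ let $$g(s,s'):=\inf\big\{\mathcal G_s(\alpha,\beta):(\alpha,\beta)\in\mathcal U_1,\ \inf\beta\le m_{s'}\big\}.$$ **Theorem 7.1.** The function $g$ is well defined with values in $[0,\infty)$: for every $s\ge0$ an optimal profile for $g_0(s)$ exists, it attains its minimum, and the minimum value $m_s$ is the same for all optimal profiles for $g_0(s)$; and $g(s,s')<\infty$ for all $s,s'\ge0$. Moreover: 1. $g$ is continuous on $[0,\infty)\times[0,\infty)$ and nondecreasing in each variable, and $g(s,s')=g(s,0)$ whenever $s\ge s'$; 2. $g(s,s')\le1$ for all $s,s'\ge0$, and $\lim_{s\to\infty}g(s,s')=1$ for every $s'\ge0$; 3. there is $\tilde\ell>0$ such that $g(s,0)=\ell s-\tilde\ell s^{5/3}+o(s^{5/3})$ as $s\to0^+$; 4. $g(s_1+s_2,s')\le g(s_1,0)+g(s_2,s')$ for all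 $s_1,s_2,s'\ge0$, with strict inequality if $s_1>0$ and $\max\{s_2,s'\}>0$. -/

import Mathlib

open MeasureTheory Filter Topology Asymptotics
open scoped NNReal ENNReal

namespace Cohesive

/-- `f₁(t) = t f(1 - t)` for `0 < t ≤ 1`. (Its continuous extension to `t = 0` is `ℓ`, see
`Potential.expansion`.) -/
noncomputable def f₁ (f : ℝ → ℝ) (t : ℝ) : ℝ := t * f (1 - t)

/-- The assumptions on the degradation function `f : [0,1) → [0,∞)`. Only the restriction of `f`
to `[0,1)` is relevant: the expansion forces `f(b) → ∞` as `b ↑ 1`. At the endpoint `0` the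
condition `C¹` is one-sided. -/
structure Potential (f : ℝ → ℝ) (ℓ ℓ₁ : ℝ) : Prop where
  contDiffOn : ContDiffOn ℝ 1 f (Set.Ico 0 1)
  nonneg : ∀ x ∈ Set.Ico (0 : ℝ) 1, 0 ≤ f x
  monotoneOn : MonotoneOn f (Set.Ico 0 1)
  zero_iff : ∀ x ∈ Set.Ico (0 : ℝ) 1, f x = 0 ↔ x = 0
  strictAntiOn : StrictAntiOn (f₁ f) (Set.Ioc 0 1)
  convexOn : ConvexOn ℝ (Set.Ioc 0 1) (fun t => f₁ f (√t))
  ell_pos : 0 < ℓ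
  ell₁_pos : 0 < ℓ₁
  expansion : (fun t => f₁ f t - (ℓ - ℓ₁ * t)) =o[𝓝[>] (0 : ℝ)] (fun t => t)

/-- `f` as a function on `[0,1]` with values in `[0,∞]`, with `f(1) = ∞`. -/
noncomputable def fExt (f : ℝ → ℝ) (b : ℝ) : ℝ≥0∞ :=
  if b < 1 then ENNReal.ofReal (f b) else ∞

/-- `u ∈ H¹_loc(ℝ)`, where `u` is the continuous representative: `u` is locally absolutely
continuous and its (almost everywhere defined) derivative is in `L²_loc(ℝ)`. -/
def H1Loc (u : ℝ → ℝ) : Prop :=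
  (∀ a b : ℝ, AbsolutelyContinuousOnInterval u a b) ∧
    LocallyIntegrable (fun t => (deriv u t) ^ 2) volume

/-- The class `U₁` of admissible profiles `(α, β)`. -/
structure Admissible (α β : ℝ → ℝ) : Prop where
  h1_left : H1Loc α
  h1_right : H1Loc β
  integrable_deriv : Integrable (deriv α) volume
  abs_integral_deriv : |∫ t, deriv α t| = 1
  mem_Icc : ∀ t, β t ∈ Set.Icc (0 : ℝ) 1
  tendsto_atTop : Tendsto β atTop (𝓝 1)
  tendsto_atBot : Tendsto β atBot (𝓝 1)

/-- The energy `G_s(α, β) = ∫ s² f²(β) |α'|² + (1 - β)² / 4 + |β'|²`, with values in `[0,∞]`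
and the conventions `f(1) = ∞`, `0 · ∞ = 0`. -/
noncomputable def energy (f : ℝ → ℝ) (s : ℝ≥0) (α β : ℝ → ℝ) : ℝ≥0∞ :=
  ∫⁻ t, ((s : ℝ≥0∞) ^ 2 * fExt f (β t) ^ 2 * ENNReal.ofReal (|deriv α t| ^ 2)
    + ENNReal.ofReal ((1 - β t) ^ 2 / 4 + |deriv β t| ^ 2))

/-- The cohesive energy `g₀(s)` of the pristine material. -/
noncomputable def g₀ (f : ℝ → ℝ) (s : ℝ≥0) : ℝ≥0∞ :=
  ⨅ (α : ℝ → ℝ) (β : ℝ → ℝ) (_ : Admissible α β), energy f s α β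

/-- `β` is an optimal profile for `g₀(s)`: if `g₀(s) < 1` it is the second component of a minimizing
pair; otherwise (complete fracture, no minimizing pair exists) it is the limit profile
`1 - exp(-|t| / 2)`. -/
def IsOptimalProfile (f : ℝ → ℝ) (s : ℝ≥0) (β : ℝ → ℝ) : Prop :=
  (g₀ f s < 1 ∧ ∃ α, Admissible α β ∧ energy f s α β = g₀ f s) ∨
    (1 ≤ g₀ f s ∧ β = fun t => 1 - Real.exp (-|t| / 2))

/-- `m` is the minimum value of an optimal profile for `g₀(s)`. -/
def IsProfileMin (f : ℝ → ℝ) (s : ℝ≥0) (m : ℝ) : Prop :=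
  ∃ β, IsOptimalProfile f s β ∧ IsLeast (Set.range β) m

/-- The number `m_s`, the minimum value of an optimal profile for `g₀(s)`. It is the only element
of the set on the right. -/
noncomputable def profileMin (f : ℝ → ℝ) (s : ℝ≥0) : ℝ := sInf {m | IsProfileMin f s m}

/-- The infimum of `G_s` over the profiles `(α, β) ∈ U₁` with `inf β ≤ m_{s'}`,
as an element of `[0,∞]`. -/
noncomputable def gInf (f : ℝ → ℝ) (s s' : ℝ≥0) : ℝ≥0∞ :=
  ⨅ (α : ℝ → ℝ) (β : ℝ → ℝ) (_ : Admissible α β) (_ : ⨅ t, β t ≤ profileMin f s'),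
    energy f s α β

/-- The cohesive energy `g(s, s') ∈ [0,∞)` of the pre-fractured material. -/
noncomputable def g (f : ℝ → ℝ) (s s' : ℝ≥0) : ℝ≥0 := (gInf f s s').toNNReal

/-- The assumptions (i)-(iv) on a cohesive energy density `G : [0,∞) × [0,∞) → [0,∞)`, with the
parameters `ℓ`, `ℓ'`, `p` of the expansion at the origin. -/
structure IsCohesiveDensity (G : ℝ≥0 → ℝ≥0 → ℝ≥0) (ℓ ℓ' p : ℝ) : Prop where
  continuous : Continuous (fun x : ℝ≥0 × ℝ≥0 => G x.1 x.2)
  mono_left : ∀ s', Monotone (fun s => G s s')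
  mono_right : ∀ s, Monotone (fun s' => G s s')
  eq_of_le : ∀ s s', s' ≤ s → G s s' = G s 0
  le_one : ∀ s s', G s s' ≤ 1
  tendsto_one : ∀ s', Tendsto (fun s => G s s') atTop (𝓝 1)
  ell_pos : 0 < ℓ
  ell'_pos : 0 < ℓ'
  one_lt_p : 1 < p
  p_lt_two : p < 2
  expansion : (fun s : ℝ≥0 => (G s 0 : ℝ) - (ℓ * s - ℓ' * (s : ℝ) ^ p))
    =o[𝓝[>] (0 : ℝ≥0)] (fun s : ℝ≥0 => (s : ℝ) ^ p)
  subadd : ∀ s₁ s₂ s', G (s₁ + s₂) s' ≤ G s₁ 0 + G s₂ s'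
  strict_subadd : ∀ s₁ s₂ s', 0 < s₁ → 0 < max s₂ s' → G (s₁ + s₂) s' < G s₁ 0 + G s₂ s'

end Cohesive

/-!
Write `γ = 1 - β` and `φ(x) = f₁(√x)`, with `φ(0) = ℓ`. The stress law `φ` is continuous, convex and
strictly decreasing from `ℓ` to `0` on `[0, 1]`; let `ψ` be its inverse, extended by `0` beyond `ℓ`.
The whole theorem reduces to the one-dimensional function
`F(κ) = ∫₀¹ ψ(κ / √(1 - v²)) dv = ∫₀¹ √(1 - κ² / φ(x)²)₊ dx` on `[0, ℓ]` (`dmg`; the second form is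
`dmg_eq_integral_sqrt`), which is continuous, antitone and strictly convex, from `F(0) = 1` to
`F(ℓ) = 0`.

*Lower bound* (`Admissible.le_energy`). Let `X` be the maximum of `γ²` along an admissible pair and
`κ = φ(X)`. Since `f(β) γ = φ(γ²)`, two applications of the inequality between the arithmetic and the
geometric mean bound the integrand of `G_s` from below by
`s κ |α'| + |γ γ'| √(1 - κ² / φ(γ²)²)`. As `γ²` rises from `0` to `X` and returns, the integral is at
least `s κ + F(κ)`. Hence `g₀(s) ≥ r(s) := min (s κ + F(κ))` over `κ ∈ [0, ℓ]`. By strict convexity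
the minimizer `κ_s` is unique (`peak_unique`); it depends continuously and monotonically on `s`.

*Optimal profiles* (`Potential.exists_optimal_profile`). For `s > 0` and `κ_s > 0` equality is
attained. The profile is parametrized by its relative slope `v = -x' / x`, where `x = γ²`: the
equality case prescribes `x = ψ(κ / √(1 - v²))`, and then the position and the opening are primitives
in `v`. The total opening is `-F'(κ) = s` because `κ_s` is a critical point. If `κ_s = 0`, then
`r(s) = 1`, the cost of complete fracture. Thus `g₀ = r`, and equality in the lower bound with the
uniqueness of `κ_s` gives `m_s = 1 - √ψ(κ_s)`.

*Insertion* (`Admissible.exists_insert`, `Potential.gInf_add_le`). At the point of minimal `β` one can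
insert linear ramps that increase the damage, and between them a plateau on which an additional
opening `s₁` is realized. The cost is a multiple of the increment of the damage plus `s₁` times the
stress on the plateau. Insertion into the profile of complete fracture gives `g ≤ 1`; insertion into
almost optimal profiles gives the continuity of `g` in both variables.

*Subadditivity* (`Potential.strict_subadd`). If `s₁ + s₂ ≥ s'`, then `g(s₁ + s₂, s') = r(s₁ + s₂)`, and
`r` is strictly subadditive because the value of `F` at the minimizer is positive for a positive
opening. If `s₁ + s₂ < s'`, insertion gives
`g(s₁ + s₂, s') ≤ g(s₂, s') + s₁ κ_{s'}`, and `s₁ κ_{s'} ≤ s₁ κ_{s₁} < r(s₁)`.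

*Expansion* (`IsStress.exists_isLittleO_minEnergy`). From `φ(x) = ℓ - ℓ₁ √x + o(√x)`, scaling and
dominated convergence give `F(ℓ - δ) ~ C δ^{5/2}`, and minimizing `C δ^{5/2} - s δ` over `δ` gives
`r(s) = ℓ s - K s^{5/3} + o(s^{5/3})` with `K > 0`.
-/

/-! ### The stress law -/

namespace Cohesive

/-- The stress law `φ(x) = f₁(√x)`, extended by its limit `ℓ` to `x ≤ 0`. The variable `x` stands
for the squared damage `(1 - β)²`. -/
noncomputable def stress (f : ℝ → ℝ) (ℓ x : ℝ) : ℝ := if x ≤ 0 then ℓ else f₁ f √x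

/-- The properties of `φ = stress f ℓ` on `[0, 1]` that the minimization problem depends on. -/
structure IsStress (φ : ℝ → ℝ) (ℓ : ℝ) : Prop where
  ell_pos : 0 < ℓ
  zero : φ 0 = ℓ
  one : φ 1 = 0
  continuousOn : ContinuousOn φ (Set.Icc 0 1)
  strictAntiOn : StrictAntiOn φ (Set.Icc 0 1)
  convexOn : ConvexOn ℝ (Set.Icc 0 1) φ
  contDiffOn : ContDiffOn ℝ 1 φ (Set.Ioo 0 1)

variable {f φ : ℝ → ℝ} {ℓ ℓ₁ : ℝ}

theorem stress_of_pos {x : ℝ} (hx : 0 < x) : stress f ℓ x = √x * f (1 - √x) := by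
  simp [stress, f₁, not_le.2 hx]

theorem stress_sq {t : ℝ} (ht : 0 < t) : stress f ℓ (t ^ 2) = t * f (1 - t) := by
  rw [stress_of_pos (by positivity), Real.sqrt_sq ht.le]

theorem stress_zero : stress f ℓ 0 = ℓ := by simp [stress]

theorem Potential.f_zero (hf : Potential f ℓ ℓ₁) : f 0 = 0 :=
  (hf.zero_iff 0 (by simp)).2 rfl

theorem Potential.stress_expansion (hf : Potential f ℓ ℓ₁) :
    (fun x => stress f ℓ x - (ℓ - ℓ₁ * √x)) =o[𝓝[>] (0 : ℝ)] (fun x => √x) := by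
  have h : Tendsto (fun x : ℝ => √x) (𝓝[>] 0) (𝓝[>] 0) := by
    refine tendsto_nhdsWithin_iff.2 ⟨?_, ?_⟩
    · have := (Real.continuous_sqrt.tendsto 0).mono_left (nhdsWithin_le_nhds (s := Set.Ioi 0))
      simpa using this
    · filter_upwards [self_mem_nhdsWithin] with x hx using Real.sqrt_pos.2 hx
  refine (hf.expansion.comp_tendsto h).congr' ?_ (EventuallyEq.refl _ _)
  filter_upwards [self_mem_nhdsWithin] with x hx
  have hx' : 0 < x := hx
  simp [stress, f₁, not_le.2 hx']

theorem Potential.tendsto_stress (hf : Potential f ℓ ℓ₁) :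
    Tendsto (stress f ℓ) (𝓝[>] 0) (𝓝 ℓ) := by
  have hs : Tendsto (fun x : ℝ => √x) (𝓝[>] 0) (𝓝 0) := by
    simpa using (Real.continuous_sqrt.tendsto 0).mono_left (nhdsWithin_le_nhds (s := Set.Ioi 0))
  have h1 := hf.stress_expansion.trans_tendsto hs
  have h2 := h1.add (tendsto_const_nhds (x := ℓ) |>.sub (hs.const_mul ℓ₁))
  simpa using h2

theorem Potential.strictAntiOn_stress (hf : Potential f ℓ ℓ₁) :
    StrictAntiOn (stress f ℓ) (Set.Icc 0 1) := by
  have h1 : StrictAntiOn (stress f ℓ) (Set.Ioc 0 1) := by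
    intro x hx y hy hxy
    have := hf.strictAntiOn (a := √x) (b := √y) ⟨Real.sqrt_pos.2 hx.1, by simpa using hx.2⟩
      ⟨Real.sqrt_pos.2 hy.1, by simpa using hy.2⟩ (Real.sqrt_lt_sqrt hx.1.le hxy)
    simpa [stress, not_le.2 hx.1, not_le.2 hy.1] using this
  intro x hx y hy hxy
  rcases hx.1.eq_or_lt with rfl | h0
  · -- compare with the value at `y / 2`, which lies strictly between
    have hy0 : 0 < y := hxy
    have h2 : stress f ℓ y < stress f ℓ (y / 2) :=
      h1 ⟨by linarith, by linarith [hy.2]⟩ ⟨hy0, hy.2⟩ (by linarith)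
    have h3 : stress f ℓ (y / 2) ≤ ℓ := by
      refine ge_of_tendsto hf.tendsto_stress ?_
      filter_upwards [Ioo_mem_nhdsGT (show (0 : ℝ) < y / 2 by linarith)] with z hz
      exact (h1 ⟨hz.1, by linarith [hz.2, hy.2]⟩ ⟨by linarith, by linarith [hy.2]⟩ hz.2).le
    rw [stress_zero]; linarith
  · exact h1 ⟨h0, hx.2⟩ ⟨h0.trans hxy, hy.2⟩ hxy

theorem Potential.continuousOn_stress (hf : Potential f ℓ ℓ₁) :
    ContinuousOn (stress f ℓ) (Set.Icc 0 1) := by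
  intro x hx
  rcases hx.1.eq_or_lt with rfl | h0
  · have : ContinuousWithinAt (stress f ℓ) (Set.Ioi 0) 0 := by
      rw [ContinuousWithinAt, stress_zero]; exact hf.tendsto_stress
    refine (continuousWithinAt_Ioi_iff_Ici.1 this).mono fun y hy => hy.1
  · have h1 : ContinuousWithinAt (fun x : ℝ => √x * f (1 - √x)) (Set.Icc 0 1) x := by
      refine Real.continuous_sqrt.continuousWithinAt.mul ?_
      have h2 : ContinuousWithinAt f (Set.Ico 0 1) (1 - √x) := by
        refine hf.contDiffOn.continuousOn _ ⟨?_, ?_⟩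
        · have : √x ≤ 1 := by simpa using hx.2
          linarith
        · have := Real.sqrt_pos.2 h0; linarith
      have h3 : ContinuousWithinAt (fun x : ℝ => 1 - √x) (Set.Ioc 0 1) x :=
        (continuous_const.sub Real.continuous_sqrt).continuousWithinAt
      have h4 : ContinuousWithinAt (fun x => f (1 - √x)) (Set.Ioc 0 1) x := by
        refine ContinuousWithinAt.comp (f := fun x : ℝ => 1 - √x) h2 h3 fun y hy => ⟨?_, ?_⟩
        · have : √y ≤ 1 := by simpa using hy.2
          linarith
        · have := Real.sqrt_pos.2 hy.1; linarith
      refine h4.mono_of_mem_nhdsWithin ?_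
      filter_upwards [self_mem_nhdsWithin, mem_nhdsWithin_of_mem_nhds (Ioi_mem_nhds h0)]
        with y hy hy' using ⟨hy', hy.2⟩
    refine h1.congr_of_eventuallyEq ?_ (stress_of_pos h0)
    filter_upwards [mem_nhdsWithin_of_mem_nhds (Ioi_mem_nhds h0)] with y hy using stress_of_pos hy

theorem Potential.isStress (hf : Potential f ℓ ℓ₁) : IsStress (stress f ℓ) ℓ where
  ell_pos := hf.ell_pos
  zero := stress_zero
  one := by simp [stress, f₁, hf.f_zero]
  continuousOn := hf.continuousOn_stress
  strictAntiOn := hf.strictAntiOn_stress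
  contDiffOn := by
    have h : ContDiffOn ℝ 1 (fun x : ℝ => √x * f (1 - √x)) (Set.Ioo 0 1) := by
      have h1 : ContDiffOn ℝ 1 (fun x : ℝ => √x) (Set.Ioo 0 1) := fun x hx =>
        (Real.contDiffAt_sqrt hx.1.ne').contDiffWithinAt
      refine h1.mul (hf.contDiffOn.comp (contDiffOn_const.sub h1) fun x hx => ⟨?_, ?_⟩)
      · have : √x ≤ 1 := by simpa using hx.2.le
        linarith
      · have := Real.sqrt_pos.2 hx.1; linarith
    exact h.congr fun x hx => stress_of_pos hx.1
  convexOn := by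
    have h1 : ConvexOn ℝ (Set.Ioc 0 1) (stress f ℓ) := by
      refine hf.convexOn.congr fun x hx => ?_
      simp [stress, not_le.2 hx.1]
    refine ⟨convex_Icc 0 1, fun x hx y hy a b ha hb hab => ?_⟩
    -- apply convexity on `(0, 1]` to `max x ε`, `max y ε` and let `ε` tend to `0`
    have hc : ∀ z ∈ Set.Icc (0 : ℝ) 1,
        Tendsto (fun e : ℝ => z + e * (1 - z)) (𝓝[>] 0) (𝓝[Set.Icc 0 1] z) := by
      intro z hz
      refine tendsto_nhdsWithin_iff.2 ⟨?_, ?_⟩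
      · have : Continuous fun e : ℝ => z + e * (1 - z) := by fun_prop
        simpa using (this.tendsto 0).mono_left (nhdsWithin_le_nhds (s := Set.Ioi 0))
      · filter_upwards [Ioo_mem_nhdsGT (zero_lt_one' ℝ)] with e he
        constructor <;> nlinarith [he.1, he.2, hz.1, hz.2]
    have hcv : a • x + b • y ∈ Set.Icc (0 : ℝ) 1 := convex_Icc 0 1 hx hy ha hb hab
    have hT : ∀ z ∈ Set.Icc (0 : ℝ) 1, Tendsto (fun e : ℝ => stress f ℓ (z + e * (1 - z)))
        (𝓝[>] 0) (𝓝 (stress f ℓ z)) := fun z hz =>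
      Tendsto.comp (hf.continuousOn_stress z hz) (hc z hz)
    refine le_of_tendsto_of_tendsto (hT _ hcv)
      (((hT x hx).const_smul a).add ((hT y hy).const_smul b)) ?_
    filter_upwards [Ioo_mem_nhdsGT (zero_lt_one' ℝ)] with e he
    have hm : ∀ z ∈ Set.Icc (0 : ℝ) 1, z + e * (1 - z) ∈ Set.Ioc (0 : ℝ) 1 := fun z hz => by
      constructor <;> nlinarith [he.1, he.2, hz.1, hz.2]
    have := h1.2 (hm x hx) (hm y hy) ha hb hab
    convert this using 2
    simp only [smul_eq_mul]
    linear_combination (-e) * hab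

end Cohesive

/-! ### The inverse of the stress law -/

namespace Cohesive

/-- The inverse `ψ` of the stress law. The supremum makes it equal to `0` for `y ≥ ℓ` (also where
the set is empty) and to `1` for `y ≤ 0`, so that it is convex on all of `[0, ∞)`. -/
noncomputable def stressInv (φ : ℝ → ℝ) (y : ℝ) : ℝ := sSup {x ∈ Set.Icc (0 : ℝ) 1 | y ≤ φ x}

namespace IsStress

variable {φ : ℝ → ℝ} {ℓ : ℝ}

theorem le_ell (h : IsStress φ ℓ) {x : ℝ} (hx : x ∈ Set.Icc (0 : ℝ) 1) : φ x ≤ ℓ :=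
  h.zero ▸ h.strictAntiOn.antitoneOn (by simp) hx hx.1

theorem nonneg (h : IsStress φ ℓ) {x : ℝ} (hx : x ∈ Set.Icc (0 : ℝ) 1) : 0 ≤ φ x :=
  h.one ▸ h.strictAntiOn.antitoneOn hx (by simp) hx.2

theorem pos (h : IsStress φ ℓ) {x : ℝ} (hx : x ∈ Set.Ico (0 : ℝ) 1) : 0 < φ x :=
  h.one ▸ h.strictAntiOn ⟨hx.1, hx.2.le⟩ (by simp) hx.2

theorem lt_ell (h : IsStress φ ℓ) {x : ℝ} (hx : x ∈ Set.Ioc (0 : ℝ) 1) : φ x < ℓ :=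
  h.zero ▸ h.strictAntiOn (by simp) ⟨hx.1.le, hx.2⟩ hx.1

theorem inv_stress (h : IsStress φ ℓ) {x : ℝ} (hx : x ∈ Set.Icc (0 : ℝ) 1) :
    stressInv φ (φ x) = x := by
  have : {z ∈ Set.Icc (0 : ℝ) 1 | φ x ≤ φ z} = Set.Icc 0 x := by
    ext z
    refine ⟨fun hz => ⟨hz.1.1, (h.strictAntiOn.le_iff_ge hx hz.1).1 hz.2⟩,
      fun hz => ⟨⟨hz.1, hz.2.trans hx.2⟩, ?_⟩⟩
    exact h.strictAntiOn.antitoneOn ⟨hz.1, hz.2.trans hx.2⟩ hx hz.2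
  rw [stressInv, this, csSup_Icc hx.1]

theorem inv_ell (h : IsStress φ ℓ) : stressInv φ ℓ = 0 := by
  have := h.inv_stress (x := 0) (by simp)
  rwa [h.zero] at this

theorem inv_of_ge (h : IsStress φ ℓ) {y : ℝ} (hy : ℓ ≤ y) : stressInv φ y = 0 := by
  rcases hy.eq_or_lt with rfl | hy
  · exact h.inv_ell
  · have : {z ∈ Set.Icc (0 : ℝ) 1 | y ≤ φ z} = ∅ := by
      ext z
      simp only [Set.mem_ofPred_eq, Set.mem_empty_iff_false, iff_false, not_and, not_le]
      exact fun hz => (h.le_ell hz).trans_lt hy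
    rw [stressInv, this, Real.sSup_empty]

theorem inv_of_nonpos (h : IsStress φ ℓ) {y : ℝ} (hy : y ≤ 0) : stressInv φ y = 1 := by
  have : {z ∈ Set.Icc (0 : ℝ) 1 | y ≤ φ z} = Set.Icc 0 1 := by
    ext z
    exact ⟨fun hz => hz.1, fun hz => ⟨hz, hy.trans (h.nonneg hz)⟩⟩
  rw [stressInv, this, csSup_Icc zero_le_one]

theorem exists_stress_eq (h : IsStress φ ℓ) {y : ℝ} (hy : y ∈ Set.Icc 0 ℓ) :
    ∃ x ∈ Set.Icc (0 : ℝ) 1, φ x = y := by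
  have := intermediate_value_Icc' zero_le_one h.continuousOn
  rw [h.zero, h.one] at this
  exact this hy

theorem inv_mem (h : IsStress φ ℓ) (y : ℝ) : stressInv φ y ∈ Set.Icc (0 : ℝ) 1 := by
  rcases le_total y 0 with hy | hy
  · simp [h.inv_of_nonpos hy]
  rcases le_total ℓ y with hy' | hy'
  · simp [h.inv_of_ge hy']
  obtain ⟨x, hx, rfl⟩ := h.exists_stress_eq ⟨hy, hy'⟩
  rwa [h.inv_stress hx]

theorem stress_inv (h : IsStress φ ℓ) {y : ℝ} (hy : y ∈ Set.Icc 0 ℓ) :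
    φ (stressInv φ y) = y := by
  obtain ⟨x, hx, rfl⟩ := h.exists_stress_eq hy
  rw [h.inv_stress hx]

theorem stress_inv_le (h : IsStress φ ℓ) {y : ℝ} (hy : 0 ≤ y) : φ (stressInv φ y) ≤ y := by
  rcases le_total ℓ y with hy' | hy'
  · rwa [h.inv_of_ge hy', h.zero]
  · exact (h.stress_inv ⟨hy, hy'⟩).le

theorem lt_stress_of_lt_inv (h : IsStress φ ℓ) {x y : ℝ} (hx : 0 ≤ x)
    (hxy : x < stressInv φ y) : y < φ x := by
  have hm := h.inv_mem y
  have h1 := h.strictAntiOn ⟨hx, hxy.le.trans hm.2⟩ hm hxy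
  refine lt_of_le_of_lt ?_ h1
  rcases le_total y 0 with hy | hy
  · exact hy.trans (h.nonneg hm)
  rcases le_total ℓ y with hy' | hy'
  · rw [h.inv_of_ge hy'] at hxy; linarith
  · exact (h.stress_inv ⟨hy, hy'⟩).ge

theorem lt_inv_of_lt_stress (h : IsStress φ ℓ) {x y : ℝ} (hx : x ∈ Set.Ico (0 : ℝ) 1)
    (hxy : y < φ x) : x < stressInv φ y := by
  rcases le_or_gt y 0 with hy | hy
  · rw [h.inv_of_nonpos hy]; exact hx.2
  have hx' : x ∈ Set.Icc (0 : ℝ) 1 := ⟨hx.1, hx.2.le⟩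
  have hy' : y ∈ Set.Icc 0 ℓ := ⟨hy.le, hxy.le.trans (h.le_ell hx')⟩
  rw [← h.strictAntiOn.lt_iff_gt (h.inv_mem y) hx', h.stress_inv hy']
  exact hxy

theorem inv_pos (h : IsStress φ ℓ) {y : ℝ} (hy : y < ℓ) : 0 < stressInv φ y :=
  h.lt_inv_of_lt_stress (by simp) (by rwa [h.zero])

theorem inv_lt_one (h : IsStress φ ℓ) {y : ℝ} (hy : 0 < y) : stressInv φ y < 1 := by
  refine lt_of_le_of_ne (h.inv_mem y).2 fun h1 => ?_
  have := h.stress_inv_le hy.le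
  have h2 : 0 < y := hy
  rcases le_total ℓ y with hy' | hy'
  · rw [h.inv_of_ge hy'] at h1; norm_num at h1
  · have := h.stress_inv ⟨hy.le, hy'⟩
    rw [h1, h.one] at this; linarith

theorem antitone_inv (h : IsStress φ ℓ) : Antitone (stressInv φ) := by
  intro y z hyz
  by_contra! hlt
  have h1 := h.lt_stress_of_lt_inv (h.inv_mem y).1 hlt |>.not_ge
  have h2 := h.inv_mem z
  have := h.lt_stress_of_lt_inv (x := stressInv φ y) (y := z) (h.inv_mem y).1 hlt
  rcases le_total y 0 with hy | hy
  · rw [h.inv_of_nonpos hy] at hlt; linarith [h2.2]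
  · linarith [h.stress_inv_le hy]

theorem continuous_inv (h : IsStress φ ℓ) : Continuous (stressInv φ) := by
  have h1 : Antitone fun y => (⟨stressInv φ y, h.inv_mem y⟩ : Set.Icc (0 : ℝ) 1) :=
    fun y z hyz => h.antitone_inv hyz
  have h2 : Function.Surjective fun y => (⟨stressInv φ y, h.inv_mem y⟩ : Set.Icc (0 : ℝ) 1) :=
    fun x => ⟨φ x, Subtype.ext (h.inv_stress x.2)⟩
  have h3 : Continuous fun y => (⟨stressInv φ y, h.inv_mem y⟩ : Set.Icc (0 : ℝ) 1) :=
    Monotone.continuous_of_surjective (β := (Set.Icc (0 : ℝ) 1)ᵒᵈ) h1 h2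
  exact continuous_subtype_val.comp h3

theorem convexOn_inv (h : IsStress φ ℓ) : ConvexOn ℝ (Set.Ici 0) (stressInv φ) := by
  refine ⟨convex_Ici 0, fun y hy z hz a b ha hb hab => ?_⟩
  by_contra! hlt
  have hm := convex_Icc (0 : ℝ) 1 (h.inv_mem y) (h.inv_mem z) ha hb hab
  have h1 := h.lt_stress_of_lt_inv hm.1 hlt
  have h2 := h.convexOn.2 (h.inv_mem y) (h.inv_mem z) ha hb hab
  have h3 := mul_le_mul_of_nonneg_left (h.stress_inv_le hy) ha
  have h4 := mul_le_mul_of_nonneg_left (h.stress_inv_le hz) hb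
  simp only [smul_eq_mul] at *
  linarith

/-- On `[r, ∞)` the slopes of `ψ` are at least `-1 / r`, the slope of a chord from `(0, 1)`. -/
theorem inv_sub_le (h : IsStress φ ℓ) {r y z : ℝ} (hr : 0 < r) (hy : r ≤ y) (hyz : y ≤ z) :
    stressInv φ y - stressInv φ z ≤ (z - y) / r := by
  rcases hyz.eq_or_lt with rfl | hyz
  · simp
  have hy0 : 0 < y := hr.trans_le hy
  have h1 := h.convexOn_inv.slope_mono_adjacent (x := 0) (y := y) (z := z) (by simp)
    (hy0.trans hyz).le hy0 hyz
  rw [h.inv_of_nonpos le_rfl, sub_zero, div_le_div_iff₀ hy0 (by linarith)] at h1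
  have h2 := (h.inv_mem y).1
  rw [le_div_iff₀ hr]
  have h3 := h.antitone_inv hyz.le
  nlinarith [mul_nonneg (sub_nonneg.2 h3) (sub_nonneg.2 hy), mul_nonneg h2 (sub_nonneg.2 hyz.le)]

theorem lipschitz_inv (h : IsStress φ ℓ) {r y z : ℝ} (hr : 0 < r) (hy : r ≤ y) (hz : r ≤ z) :
    |stressInv φ y - stressInv φ z| ≤ |y - z| / r := by
  rcases le_total y z with hyz | hyz
  · rw [abs_of_nonneg (sub_nonneg.2 (h.antitone_inv hyz)), abs_of_nonpos (by linarith), neg_sub]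
    exact h.inv_sub_le hr hy hyz
  · rw [abs_sub_comm, abs_of_nonneg (sub_nonneg.2 (h.antitone_inv hyz)), abs_of_nonneg (by linarith)]
    exact h.inv_sub_le hr hz hyz

theorem differentiableAt (h : IsStress φ ℓ) {x : ℝ} (hx : x ∈ Set.Ioo (0 : ℝ) 1) :
    DifferentiableAt ℝ φ x :=
  (h.contDiffOn.contDiffAt (isOpen_Ioo.mem_nhds hx)).differentiableAt (by simp)

theorem deriv_neg (h : IsStress φ ℓ) {x : ℝ} (hx : x ∈ Set.Ioo (0 : ℝ) 1) : deriv φ x < 0 := by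
  have h1 := h.convexOn.deriv_le_slope ⟨hx.1.le, hx.2.le⟩ (y := 1) (by simp) hx.2
    (h.differentiableAt hx)
  refine h1.trans_lt ?_
  rw [slope_def_field, h.one]
  exact div_neg_of_neg_of_pos (by linarith [h.pos ⟨hx.1.le, hx.2⟩]) (by linarith [hx.2])

theorem inv_mem_Ioo (h : IsStress φ ℓ) {y : ℝ} (hy : y ∈ Set.Ioo 0 ℓ) :
    stressInv φ y ∈ Set.Ioo (0 : ℝ) 1 := ⟨h.inv_pos hy.2, h.inv_lt_one hy.1⟩

theorem hasDerivAt_inv (h : IsStress φ ℓ) {y : ℝ} (hy : y ∈ Set.Ioo 0 ℓ) :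
    HasDerivAt (stressInv φ) (deriv φ (stressInv φ y))⁻¹ y := by
  refine HasDerivAt.of_local_left_inverse h.continuous_inv.continuousAt
    (h.differentiableAt (h.inv_mem_Ioo hy)).hasDerivAt (h.deriv_neg (h.inv_mem_Ioo hy)).ne ?_
  filter_upwards [isOpen_Ioo.mem_nhds hy] with z hz using h.stress_inv ⟨hz.1.le, hz.2.le⟩

theorem deriv_inv_neg (h : IsStress φ ℓ) {y : ℝ} (hy : y ∈ Set.Ioo 0 ℓ) :
    deriv (stressInv φ) y < 0 := by
  rw [(h.hasDerivAt_inv hy).deriv]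
  exact inv_lt_zero.2 (h.deriv_neg (h.inv_mem_Ioo hy))

theorem continuousOn_deriv_inv (h : IsStress φ ℓ) :
    ContinuousOn (deriv (stressInv φ)) (Set.Ioo 0 ℓ) := by
  have h1 : ContinuousOn (fun y => (deriv φ (stressInv φ y))⁻¹) (Set.Ioo 0 ℓ) := by
    refine ContinuousOn.inv₀ ?_ fun y hy => (h.deriv_neg (h.inv_mem_Ioo hy)).ne
    exact (h.contDiffOn.continuousOn_deriv_of_isOpen isOpen_Ioo le_rfl).comp
      h.continuous_inv.continuousOn fun y hy => h.inv_mem_Ioo hy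
  exact h1.congr fun y hy => (h.hasDerivAt_inv hy).deriv

/-- Beyond `ℓ` the inverse is constant, so that it is differentiable on `(0, ∞)` except at `ℓ`. -/
theorem differentiableAt_inv (h : IsStress φ ℓ) {y : ℝ} (hy : 0 < y) (hne : y ≠ ℓ) :
    DifferentiableAt ℝ (stressInv φ) y := by
  rcases lt_or_gt_of_ne hne with hlt | hgt
  · exact (h.hasDerivAt_inv ⟨hy, hlt⟩).differentiableAt
  · have : stressInv φ =ᶠ[𝓝 y] fun _ => 0 := by
      filter_upwards [Ioi_mem_nhds hgt] with z hz using h.inv_of_ge (le_of_lt hz)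
    exact (differentiableAt_const (0 : ℝ)).congr_of_eventuallyEq this

theorem deriv_inv_of_gt (h : IsStress φ ℓ) {y : ℝ} (hy : ℓ < y) : deriv (stressInv φ) y = 0 := by
  have : stressInv φ =ᶠ[𝓝 y] fun _ => 0 := by
    filter_upwards [Ioi_mem_nhds hy] with z hz using h.inv_of_ge (le_of_lt hz)
  rw [this.deriv_eq]; simp

end IsStress

end Cohesive

/-! ### The damage energy of a peak stress -/

namespace Cohesive

/-- The amplification factor `Z(v) = 1 / √(1 - v²)`. Along an optimal profile the stress is
`κ Z(v)`, where `v` is the relative slope of the damage variable. -/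
noncomputable def amp (v : ℝ) : ℝ := (√(1 - v ^ 2))⁻¹

/-- The damage energy `F(κ) = ∫₀¹ ψ(κ Z(v)) dv` of the profile with peak stress `κ`. -/
noncomputable def dmg (φ : ℝ → ℝ) (κ : ℝ) : ℝ := ∫ v in (0 : ℝ)..1, stressInv φ (κ * amp v)

theorem amp_nonneg (v : ℝ) : 0 ≤ amp v := by unfold amp; positivity

theorem amp_pos {v : ℝ} (hv : v ∈ Set.Ioo (-1 : ℝ) 1) : 0 < amp v := by
  have : 0 < 1 - v ^ 2 := by nlinarith [hv.1, hv.2]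
  unfold amp; positivity

theorem one_le_amp {v : ℝ} (hv : v ∈ Set.Ioo (-1 : ℝ) 1) : 1 ≤ amp v := by
  have : 0 < 1 - v ^ 2 := by nlinarith [hv.1, hv.2]
  refine (one_le_inv₀ (Real.sqrt_pos.2 this)).2 ?_
  rw [Real.sqrt_le_one]
  nlinarith [sq_nonneg v]

theorem measurable_amp : Measurable amp := by
  unfold amp; fun_prop

theorem continuousOn_amp : ContinuousOn amp (Set.Ioo (-1) 1) := by
  unfold amp
  refine ContinuousOn.inv₀ (by fun_prop) fun v hv => ?_
  have : 0 < 1 - v ^ 2 := by nlinarith [hv.1, hv.2]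
  positivity

theorem intervalIntegrable_amp : IntervalIntegrable amp volume 0 1 := by
  refine intervalIntegral.intervalIntegrable_deriv_of_nonneg (g := Real.arcsin)
    Real.continuous_arcsin.continuousOn (fun v hv => ?_) fun v _ => amp_nonneg v
  rw [min_eq_left zero_le_one, max_eq_right zero_le_one] at hv
  have := Real.hasDerivAt_arcsin (x := v) (by linarith [hv.1]) (by linarith [hv.2])
  rwa [one_div] at this

theorem mul_amp_lt_iff {κ v y : ℝ} (hκ : 0 ≤ κ) (hy : 0 < y) (hv : v ∈ Set.Ico (0 : ℝ) 1) :
    κ * amp v < y ↔ v < √(1 - (κ / y) ^ 2) := by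
  have h1 : 0 < 1 - v ^ 2 := by nlinarith [hv.1, hv.2]
  rw [amp, ← div_eq_mul_inv, div_lt_iff₀ (Real.sqrt_pos.2 h1), Real.lt_sqrt hv.1, div_pow,
    ← div_lt_iff₀' hy, Real.lt_sqrt (by positivity), div_pow]
  constructor <;> intro h <;> linarith

namespace IsStress

variable {φ : ℝ → ℝ} {ℓ : ℝ}

theorem measurable_inv_amp (h : IsStress φ ℓ) (κ : ℝ) :
    Measurable fun v => stressInv φ (κ * amp v) :=
  h.continuous_inv.measurable.comp (measurable_amp.const_mul κ)

theorem intervalIntegrable_inv_amp (h : IsStress φ ℓ) (κ a b : ℝ) :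
    IntervalIntegrable (fun v => stressInv φ (κ * amp v)) volume a b := by
  refine (intervalIntegrable_const (c := (1 : ℝ))).mono_fun
    (h.measurable_inv_amp κ).aestronglyMeasurable (Eventually.of_forall fun v => ?_)
  have := h.inv_mem (κ * amp v)
  simp only [Real.norm_eq_abs, abs_one]
  rw [abs_of_nonneg this.1]; exact this.2

theorem continuous_dmg (h : IsStress φ ℓ) : Continuous (dmg φ) := by
  refine intervalIntegral.continuous_of_dominated_interval (bound := fun _ => 1)
    (fun κ => (h.measurable_inv_amp κ).aestronglyMeasurable) (fun κ => ?_)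
    intervalIntegrable_const (Eventually.of_forall fun v _ => ?_)
  · refine Eventually.of_forall fun v _ => ?_
    have := h.inv_mem (κ * amp v)
    rw [Real.norm_eq_abs, abs_of_nonneg this.1]; exact this.2
  · exact h.continuous_inv.comp (continuous_id.mul continuous_const)

theorem antitone_dmg (h : IsStress φ ℓ) : Antitone (dmg φ) := fun _ _ hκ =>
  intervalIntegral.integral_mono_on zero_le_one (h.intervalIntegrable_inv_amp _ _ _)
    (h.intervalIntegrable_inv_amp _ _ _) fun v _ =>
      h.antitone_inv (mul_le_mul_of_nonneg_right hκ (amp_nonneg v))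

theorem dmg_zero (h : IsStress φ ℓ) : dmg φ 0 = 1 := by
  simp [dmg, h.inv_of_nonpos le_rfl]

theorem dmg_ell (h : IsStress φ ℓ) : dmg φ ℓ = 0 := by
  rw [dmg, intervalIntegral.integral_congr_ae (g := fun _ => 0)]
  · simp
  · filter_upwards [(Set.countable_singleton (1 : ℝ)).ae_notMem volume] with v hv hv'
    rw [Set.uIoc_of_le zero_le_one] at hv'
    refine h.inv_of_ge ?_
    have := one_le_amp (v := v) ⟨by linarith [hv'.1], lt_of_le_of_ne hv'.2 hv⟩
    nlinarith [h.ell_pos]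

/-- A function of the slope that is nonnegative on `(0, 1)` and positive on a subinterval has a
positive integral. -/
theorem _root_.Cohesive.integral_pos_of_pos_on_subinterval {u : ℝ → ℝ} {a b : ℝ}
    (hu : ∀ c d, IntervalIntegrable u volume c d)
    (h0 : ∀ v ∈ Set.Ioo (0 : ℝ) 1, 0 ≤ u v) (ha : 0 ≤ a) (hab : a < b) (hb : b ≤ 1)
    (hp : ∀ v ∈ Set.Ioo a b, 0 < u v) : 0 < ∫ v in (0 : ℝ)..1, u v := by
  refine (intervalIntegral.intervalIntegral_pos_of_pos_on (hu a b) hp hab).trans_le ?_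
  refine intervalIntegral.integral_mono_interval ha hab.le hb ?_ (hu 0 1)
  rw [← Measure.restrict_congr_set Ioo_ae_eq_Ioc]
  filter_upwards [self_mem_ae_restrict measurableSet_Ioo] with v hv using h0 v hv

theorem sqrt_lt_sqrt_of_lt (h : IsStress φ ℓ) {κ κ' : ℝ} (hκ : 0 ≤ κ) (hκκ' : κ < κ')
    (hκ' : κ' ≤ ℓ) : √(1 - (κ' / ℓ) ^ 2) < √(1 - (κ / ℓ) ^ 2) := by
  have hℓ := h.ell_pos
  have h1 : κ / ℓ < κ' / ℓ := by gcongr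
  have h2 : κ' / ℓ ≤ 1 := (div_le_one hℓ).2 hκ'
  have h3 : 0 ≤ κ / ℓ := by positivity
  refine Real.sqrt_lt_sqrt ?_ ?_ <;> nlinarith

theorem sqrt_le_one (κ y : ℝ) : √(1 - (κ / y) ^ 2) ≤ 1 := by
  rw [Real.sqrt_le_one]; nlinarith [sq_nonneg (κ / y)]

theorem dmg_pos (h : IsStress φ ℓ) {κ : ℝ} (hκ : 0 ≤ κ) (hκℓ : κ < ℓ) : 0 < dmg φ κ := by
  refine integral_pos_of_pos_on_subinterval (a := 0) (b := √(1 - (κ / ℓ) ^ 2))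
    (h.intervalIntegrable_inv_amp κ) (fun v _ => (h.inv_mem _).1) le_rfl ?_ (sqrt_le_one _ _) ?_
  · have := h.sqrt_lt_sqrt_of_lt hκ hκℓ le_rfl
    exact (Real.sqrt_nonneg _).trans_lt this
  · intro v hv
    exact h.inv_pos ((mul_amp_lt_iff hκ h.ell_pos
      ⟨hv.1.le, hv.2.trans_le (sqrt_le_one _ _)⟩).2 hv.2)

/-- Midpoint strict convexity of `F`. It comes from the slopes `v` for which the stress `κ Z(v)`
is beyond `ℓ` at the midpoint, but not at `κ`. -/
theorem dmg_midpoint_lt (h : IsStress φ ℓ) {κ κ' : ℝ} (hκ : 0 ≤ κ) (hκκ' : κ < κ')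
    (hκ' : κ' ≤ ℓ) : dmg φ ((κ + κ') / 2) < (dmg φ κ + dmg φ κ') / 2 := by
  set m := (κ + κ') / 2 with hm
  have hI := fun κ => h.intervalIntegrable_inv_amp κ
  have hsum : ∀ c d, IntervalIntegrable (fun v => (1 / 2) * (stressInv φ (κ * amp v)
      + stressInv φ (κ' * amp v)) - stressInv φ (m * amp v)) volume c d := fun c d =>
    (((hI κ c d).add (hI κ' c d)).const_mul _).sub (hI m c d)
  have hpos : 0 < ∫ v in (0 : ℝ)..1, ((1 / 2) * (stressInv φ (κ * amp v)
      + stressInv φ (κ' * amp v)) - stressInv φ (m * amp v)) := by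
    refine integral_pos_of_pos_on_subinterval (a := √(1 - (m / ℓ) ^ 2))
      (b := √(1 - (κ / ℓ) ^ 2)) hsum (fun v hv => ?_) (Real.sqrt_nonneg _)
      (h.sqrt_lt_sqrt_of_lt hκ (by linarith) (by linarith)) (sqrt_le_one _ _) fun v hv => ?_
    · have ha := amp_nonneg v
      have := h.convexOn_inv.2 (mul_nonneg hκ ha : 0 ≤ κ * amp v)
        (mul_nonneg (hκ.trans hκκ'.le) ha : 0 ≤ κ' * amp v) (by norm_num : (0 : ℝ) ≤ 1 / 2)
        (by norm_num : (0 : ℝ) ≤ 1 / 2) (by norm_num)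
      simp only [smul_eq_mul] at this
      have e : 1 / 2 * (κ * amp v) + 1 / 2 * (κ' * amp v) = m * amp v := by rw [hm]; ring
      rw [e] at this
      linarith
    · have hv' : v ∈ Set.Ico (0 : ℝ) 1 :=
        ⟨(Real.sqrt_nonneg _).trans hv.1.le, hv.2.trans_le (sqrt_le_one _ _)⟩
      have h1 : ℓ ≤ m * amp v := by
        by_contra! hc
        exact absurd ((mul_amp_lt_iff (by linarith) h.ell_pos hv').1 hc) (not_lt.2 hv.1.le)
      have h2 := h.inv_pos ((mul_amp_lt_iff hκ h.ell_pos hv').2 hv.2)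
      rw [h.inv_of_ge h1]
      linarith [(h.inv_mem (κ' * amp v)).1]
  rw [intervalIntegral.integral_sub (((hI κ 0 1).add (hI κ' 0 1)).const_mul _) (hI m 0 1),
    intervalIntegral.integral_const_mul, intervalIntegral.integral_add (hI κ 0 1) (hI κ' 0 1)]
    at hpos
  unfold dmg
  linarith

/-- `F` is differentiable on `(0, ℓ)`, with the derivative under the integral. The stress `κ Z(v)`
equals `ℓ`, where `ψ` need not be differentiable, only for one `v`. -/
theorem hasDerivAt_dmg (h : IsStress φ ℓ) {κ : ℝ} (hκ : 0 < κ) :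
    IntervalIntegrable (fun v => deriv (stressInv φ) (κ * amp v) * amp v) volume 0 1 ∧
    HasDerivAt (dmg φ) (∫ v in (0 : ℝ)..1, deriv (stressInv φ) (κ * amp v) * amp v) κ := by
  have hIoo : ∀ᵐ v : ℝ, v ∈ Set.uIoc (0 : ℝ) 1 → v ∈ Set.Ioo (0 : ℝ) 1 := by
    filter_upwards [(Set.countable_singleton (1 : ℝ)).ae_notMem volume] with v hv hv'
    rw [Set.uIoc_of_le zero_le_one] at hv'
    exact ⟨hv'.1, lt_of_le_of_ne hv'.2 hv⟩
  refine intervalIntegral.hasDerivAt_integral_of_dominated_loc_of_lip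
    (F := fun κ v => stressInv φ (κ * amp v)) (s := Set.Ioi (κ / 2))
    (bound := fun v => amp v * (2 / κ)) (Ioi_mem_nhds (by linarith))
    (Eventually.of_forall fun κ => (h.measurable_inv_amp κ).aestronglyMeasurable)
    (h.intervalIntegrable_inv_amp κ 0 1) ?_ ?_ (intervalIntegrable_amp.mul_const _) ?_
  · exact (((measurable_deriv _).comp (measurable_amp.const_mul κ)).mul
      measurable_amp).aestronglyMeasurable
  · filter_upwards [hIoo] with v hv hv'
    have hv1 := one_le_amp (v := v) ⟨by linarith [(hv hv').1], (hv hv').2⟩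
    refine LipschitzOnWith.of_dist_le_mul fun a ha b hb => ?_
    have ha' : κ / 2 < a := ha
    have hb' : κ / 2 < b := hb
    have := h.lipschitz_inv (r := κ / 2) (y := a * amp v) (z := b * amp v) (by linarith)
      (by nlinarith) (by nlinarith)
    rw [Real.dist_eq, Real.dist_eq, Real.coe_nnabs,
      abs_of_nonneg (mul_nonneg (amp_nonneg v) (by positivity : 0 ≤ 2 / κ))]
    refine this.trans (le_of_eq ?_)
    rw [← sub_mul, abs_mul, abs_of_nonneg (by linarith : 0 ≤ amp v)]
    field_simp
  · filter_upwards [hIoo,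
      (Set.countable_singleton (√(1 - (κ / ℓ) ^ 2))).ae_notMem volume] with v hv hne hv'
    have hv'' := hv hv'
    have hv1 := one_le_amp (v := v) ⟨by linarith [hv''.1], hv''.2⟩
    have hne' : κ * amp v ≠ ℓ := by
      intro he
      refine hne ?_
      have h1 : 0 < 1 - v ^ 2 := by nlinarith [hv''.1, hv''.2]
      have h2 : κ / ℓ = √(1 - v ^ 2) := by
        rw [← he, amp]; field_simp
      rw [Set.mem_singleton_iff, h2, Real.sq_sqrt h1.le, sub_sub_cancel, Real.sqrt_sq hv''.1.le]
    have h1 := (h.differentiableAt_inv (y := κ * amp v) (by positivity) hne').hasDerivAt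
    have h2 : HasDerivAt (fun k => k * amp v) (amp v) κ := by
      simpa using (hasDerivAt_id κ).mul_const (amp v)
    exact HasDerivAt.comp κ h1 h2

/-- `F(κ)` as an integral over the damage variable. Both formulas give the area of the region
`{(x, v) : κ Z(v) < φ(x)}` in the unit square. -/
theorem dmg_eq_integral_sqrt (h : IsStress φ ℓ) {κ : ℝ} (hκ : 0 ≤ κ) :
    dmg φ κ = ∫ x in (0 : ℝ)..1, √(1 - (κ / φ x) ^ 2) := by
  set S : Set (ℝ × ℝ) := {p | (p.1 ∈ Set.Ioo (0 : ℝ) 1 ∧ p.2 ∈ Set.Ioo (0 : ℝ) 1) ∧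
    p.1 < stressInv φ (κ * amp p.2)} with hS
  have hSm : MeasurableSet S := by
    refine MeasurableSet.inter ((measurable_fst measurableSet_Ioo).inter
      (measurable_snd measurableSet_Ioo)) ?_
    exact measurableSet_lt measurable_fst ((h.measurable_inv_amp κ).comp measurable_snd)
  have h1 : (volume.prod volume) S
      = ∫⁻ v in Set.Ioo (0 : ℝ) 1, ENNReal.ofReal (stressInv φ (κ * amp v)) := by
    rw [Measure.prod_apply_symm hSm, ← lintegral_indicator measurableSet_Ioo]
    refine lintegral_congr fun v => ?_
    by_cases hv : v ∈ Set.Ioo (0 : ℝ) 1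
    · rw [Set.indicator_of_mem hv]
      have : (fun x => (x, v)) ⁻¹' S = Set.Ioo 0 (stressInv φ (κ * amp v)) := by
        ext x
        simp only [hS, Set.mem_preimage, Set.mem_ofPred_eq, Set.mem_Ioo]
        have := (h.inv_mem (κ * amp v)).2
        exact ⟨fun hx => ⟨hx.1.1.1, hx.2⟩,
          fun hx => ⟨⟨⟨hx.1, hx.2.trans_le this⟩, hv⟩, hx.2⟩⟩
      rw [this, Real.volume_Ioo, sub_zero]
    · rw [Set.indicator_of_notMem hv]
      have : (fun x => (x, v)) ⁻¹' S = ∅ := by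
        ext x
        simp only [hS, Set.mem_preimage, Set.mem_ofPred_eq, Set.mem_empty_iff_false, iff_false]
        exact fun hx => hv hx.1.2
      rw [this, measure_empty]
  have h2 : (volume.prod volume) S
      = ∫⁻ x in Set.Ioo (0 : ℝ) 1, ENNReal.ofReal √(1 - (κ / φ x) ^ 2) := by
    rw [Measure.prod_apply hSm, ← lintegral_indicator measurableSet_Ioo]
    refine lintegral_congr fun x => ?_
    by_cases hx : x ∈ Set.Ioo (0 : ℝ) 1
    · rw [Set.indicator_of_mem hx]
      have : Prod.mk x ⁻¹' S = Set.Ioo 0 √(1 - (κ / φ x) ^ 2) := by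
        ext v
        simp only [hS, Set.mem_preimage, Set.mem_ofPred_eq]
        have hφ := h.pos ⟨hx.1.le, hx.2⟩
        constructor
        · intro hv
          refine ⟨hv.1.2.1, (mul_amp_lt_iff hκ hφ ⟨hv.1.2.1.le, hv.1.2.2⟩).1 ?_⟩
          exact h.lt_stress_of_lt_inv hx.1.le hv.2
        · intro hv
          have hv1 : v < 1 := hv.2.trans_le (sqrt_le_one _ _)
          exact ⟨⟨hx, hv.1, hv1⟩, h.lt_inv_of_lt_stress ⟨hx.1.le, hx.2⟩
            ((mul_amp_lt_iff hκ hφ ⟨hv.1.le, hv1⟩).2 hv.2)⟩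
      rw [this, Real.volume_Ioo, sub_zero]
    · rw [Set.indicator_of_notMem hx]
      have : Prod.mk x ⁻¹' S = ∅ := by
        ext v
        simp only [hS, Set.mem_preimage, Set.mem_ofPred_eq, Set.mem_empty_iff_false, iff_false]
        exact fun hv => hx hv.1.1
      rw [this, measure_empty]
  rw [dmg, intervalIntegral.integral_of_le zero_le_one, intervalIntegral.integral_of_le zero_le_one,
    ← Measure.restrict_congr_set Ioo_ae_eq_Ioc, integral_eq_lintegral_of_nonneg_ae
      (Eventually.of_forall fun v => (h.inv_mem _).1)
      (h.measurable_inv_amp κ).aestronglyMeasurable, ← h1, h2,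
    integral_eq_lintegral_of_nonneg_ae (Eventually.of_forall fun v => Real.sqrt_nonneg _)]
  refine ContinuousOn.aestronglyMeasurable ?_ measurableSet_Ioo
  refine Real.continuous_sqrt.comp_continuousOn (continuousOn_const.sub (ContinuousOn.pow ?_ 2))
  exact continuousOn_const.div (h.continuousOn.mono Set.Ioo_subset_Icc_self)
    fun x hx => (h.pos ⟨hx.1.le, hx.2⟩).ne'

end IsStress

end Cohesive

/-! ### The reduced energy and its minimizer -/

namespace Cohesive

/-- `κ` minimizes the reduced energy `s κ + F(κ)` over the possible peak stresses `κ ∈ [0, ℓ]`. -/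
def IsPeak (φ : ℝ → ℝ) (ℓ s κ : ℝ) : Prop :=
  κ ∈ Set.Icc 0 ℓ ∧ ∀ κ' ∈ Set.Icc 0 ℓ, s * κ + dmg φ κ ≤ s * κ' + dmg φ κ'

/-- The peak stress `κ_s` of the optimal profiles at the opening `s`. -/
noncomputable def peak (φ : ℝ → ℝ) (ℓ s : ℝ) : ℝ := Classical.epsilon (IsPeak φ ℓ s)

/-- The minimum of the reduced energy `s κ + F(κ)`; it is the value of `g₀(s)`. -/
noncomputable def minEnergy (φ : ℝ → ℝ) (ℓ s : ℝ) : ℝ := s * peak φ ℓ s + dmg φ (peak φ ℓ s)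

namespace IsStress

variable {φ : ℝ → ℝ} {ℓ : ℝ}

theorem isPeak (h : IsStress φ ℓ) (s : ℝ) : IsPeak φ ℓ s (peak φ ℓ s) := by
  have : ∃ κ, IsPeak φ ℓ s κ := by
    have hc : Continuous fun κ => s * κ + dmg φ κ :=
      (continuous_const.mul continuous_id).add h.continuous_dmg
    obtain ⟨κ, hκ, hmin⟩ := isCompact_Icc.exists_isMinOn (Set.nonempty_Icc.2 h.ell_pos.le)
      hc.continuousOn
    exact ⟨κ, hκ, fun κ' hκ' => hmin hκ'⟩
  exact Classical.epsilon_spec this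

theorem minEnergy_le (h : IsStress φ ℓ) (s : ℝ) {κ : ℝ} (hκ : κ ∈ Set.Icc 0 ℓ) :
    minEnergy φ ℓ s ≤ s * κ + dmg φ κ := (h.isPeak s).2 κ hκ

theorem peak_unique (h : IsStress φ ℓ) {s κ : ℝ} (hκ : κ ∈ Set.Icc 0 ℓ)
    (hle : s * κ + dmg φ κ ≤ minEnergy φ ℓ s) : κ = peak φ ℓ s := by
  have hp := (h.isPeak s).1
  -- two distinct minimizers would have a midpoint with a smaller value
  have key : ∀ a b, a ∈ Set.Icc 0 ℓ → b ∈ Set.Icc 0 ℓ → a < b →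
      s * a + dmg φ a ≤ minEnergy φ ℓ s → s * b + dmg φ b ≤ minEnergy φ ℓ s → False := by
    intro a b ha hb hab h1 h2
    have h3 := h.dmg_midpoint_lt ha.1 hab hb.2
    have h4 := h.minEnergy_le s (κ := (a + b) / 2)
      ⟨by linarith [ha.1, hb.1], by linarith [ha.2, hb.2]⟩
    linarith
  rcases lt_trichotomy κ (peak φ ℓ s) with hlt | heq | hgt
  · exact (key _ _ hκ hp hlt hle le_rfl).elim
  · exact heq
  · exact (key _ _ hp hκ hgt le_rfl hle).elim

theorem peak_zero (h : IsStress φ ℓ) : peak φ ℓ 0 = ℓ := by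
  refine (h.peak_unique ⟨h.ell_pos.le, le_rfl⟩ ?_).symm
  have : 0 ≤ dmg φ (peak φ ℓ 0) := by
    exact h.dmg_ell.symm.trans_le (h.antitone_dmg (h.isPeak 0).1.2)
  simpa [minEnergy, h.dmg_ell] using this

theorem dmg_nonneg (h : IsStress φ ℓ) (κ : ℝ) : 0 ≤ dmg φ κ :=
  intervalIntegral.integral_nonneg zero_le_one fun _ _ => (h.inv_mem _).1

theorem minEnergy_zero (h : IsStress φ ℓ) : minEnergy φ ℓ 0 = 0 := by
  simp [minEnergy, h.peak_zero, h.dmg_ell]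

theorem minEnergy_nonneg (h : IsStress φ ℓ) {s : ℝ} (hs : 0 ≤ s) : 0 ≤ minEnergy φ ℓ s :=
  add_nonneg (mul_nonneg hs (h.isPeak s).1.1) (h.dmg_nonneg _)

theorem minEnergy_le_one (h : IsStress φ ℓ) (s : ℝ) : minEnergy φ ℓ s ≤ 1 := by
  simpa [h.dmg_zero] using h.minEnergy_le s (κ := 0) ⟨le_rfl, h.ell_pos.le⟩

theorem minEnergy_lt_one_iff (h : IsStress φ ℓ) (s : ℝ) :
    minEnergy φ ℓ s < 1 ↔ 0 < peak φ ℓ s := by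
  constructor
  · intro hlt
    refine (h.isPeak s).1.1.lt_of_ne fun h0 => ?_
    rw [minEnergy, ← h0, h.dmg_zero] at hlt
    simp at hlt
  · intro hpos
    by_contra! hge
    exact hpos.ne (h.peak_unique ⟨le_rfl, h.ell_pos.le⟩ (by simpa [h.dmg_zero] using hge))

theorem antitone_peak (h : IsStress φ ℓ) : Antitone (peak φ ℓ) := by
  intro s s' hs
  rcases hs.eq_or_lt with rfl | hs
  · exact le_rfl
  have h1 := h.minEnergy_le s (h.isPeak s').1
  have h2 := h.minEnergy_le s' (h.isPeak s).1
  simp only [minEnergy] at h1 h2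
  nlinarith

theorem continuous_peak (h : IsStress φ ℓ) : Continuous (peak φ ℓ) := by
  refine continuous_iff_continuousAt.2 fun s => ?_
  refine isCompact_Icc.tendsto_nhds_of_unique_mapClusterPt
    (Eventually.of_forall fun s' => (h.isPeak s').1) fun κ hκ hcl => ?_
  obtain ⟨U, hU, hT⟩ := mapClusterPt_iff_ultrafilter.1 hcl
  refine h.peak_unique hκ ?_
  have hs : Tendsto (fun s' : ℝ => s') U (𝓝 s) := hU
  refine le_of_tendsto_of_tendsto ((hs.mul hT).add ((h.continuous_dmg.tendsto κ).comp hT))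
    ((hs.mul_const (peak φ ℓ s)).add_const (dmg φ (peak φ ℓ s)))
    (Eventually.of_forall fun s' => h.minEnergy_le s' (h.isPeak s).1)

/-- Near `κ = ℓ` the damage energy is of higher order than `ℓ - κ`. -/
theorem dmg_le (h : IsStress φ ℓ) {κ : ℝ} (hκ : 0 < κ) :
    dmg φ κ ≤ √(1 - (κ / ℓ) ^ 2) * stressInv φ κ := by
  set b := √(1 - (κ / ℓ) ^ 2) with hb
  have hb1 : b ≤ 1 := sqrt_le_one _ _
  have hI := h.intervalIntegrable_inv_amp κ
  have h0 : ∫ v in b..1, stressInv φ (κ * amp v) = 0 := by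
    rw [intervalIntegral.integral_congr_ae (g := fun _ => 0)]
    · simp
    · filter_upwards [(Set.countable_singleton (1 : ℝ)).ae_notMem volume] with v hv hv'
      rw [Set.uIoc_of_le hb1] at hv'
      refine h.inv_of_ge ?_
      by_contra! hc
      have := (mul_amp_lt_iff hκ.le h.ell_pos
        ⟨(Real.sqrt_nonneg _).trans hv'.1.le, lt_of_le_of_ne hv'.2 hv⟩).1 hc
      exact absurd hv'.1 (not_lt.2 this.le)
  have h1 : dmg φ κ = ∫ v in (0 : ℝ)..b, stressInv φ (κ * amp v) := by
    rw [dmg, ← intervalIntegral.integral_add_adjacent_intervals (hI 0 b) (hI b 1), h0, add_zero]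
  have h2 : ∫ v in (0 : ℝ)..b, stressInv φ (κ * amp v)
      ≤ ∫ _ in (0 : ℝ)..b, stressInv φ κ := by
    refine intervalIntegral.integral_mono_on_of_le_Ioo (Real.sqrt_nonneg _) (hI 0 b)
      intervalIntegrable_const fun v hv => ?_
    have := one_le_amp (v := v) ⟨by linarith [hv.1], hv.2.trans_le hb1⟩
    exact h.antitone_inv (by nlinarith)
  rw [h1]
  simpa using h2

theorem peak_lt_ell (h : IsStress φ ℓ) {s : ℝ} (hs : 0 < s) : peak φ ℓ s < ℓ := by
  have hℓ := h.ell_pos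
  refine (h.isPeak s).1.2.lt_of_ne fun heq => ?_
  have hT : Tendsto (fun κ : ℝ => √(1 - (κ / ℓ) ^ 2) / κ) (𝓝[<] ℓ) (𝓝 0) := by
    have : ContinuousAt (fun κ : ℝ => √(1 - (κ / ℓ) ^ 2) / κ) ℓ := by
      refine ContinuousAt.div ?_ continuousAt_id hℓ.ne'
      exact Continuous.continuousAt (by fun_prop)
    have h2 := this.tendsto.mono_left (nhdsWithin_le_nhds (s := Set.Iio ℓ))
    simpa [div_self hℓ.ne'] using h2
  obtain ⟨κ, hκs, hκ⟩ := ((hT.eventually_lt_const hs).and (Ioo_mem_nhdsLT hℓ)).exists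
  have h1 := h.minEnergy_le s (κ := κ) ⟨hκ.1.le, hκ.2.le⟩
  have h2 := h.dmg_le hκ.1
  have h3 := h.inv_sub_le hκ.1 le_rfl hκ.2.le
  rw [h.inv_ell, sub_zero] at h3
  rw [minEnergy, heq, h.dmg_ell, add_zero] at h1
  have h4 := mul_le_mul_of_nonneg_left h3 (Real.sqrt_nonneg (1 - (κ / ℓ) ^ 2))
  have h5 : √(1 - (κ / ℓ) ^ 2) * ((ℓ - κ) / κ) < s * (ℓ - κ) := by
    rw [mul_div_left_comm, mul_comm s]
    exact mul_lt_mul_of_pos_left hκs (by linarith [hκ.2])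
  nlinarith

theorem minEnergy_le_ell_mul (h : IsStress φ ℓ) (s : ℝ) : minEnergy φ ℓ s ≤ ℓ * s := by
  simpa [h.dmg_ell, mul_comm] using h.minEnergy_le s (κ := ℓ) ⟨h.ell_pos.le, le_rfl⟩

/-- Stationarity of the reduced energy at an interior minimizer. -/
theorem integral_deriv_eq_neg (h : IsStress φ ℓ) {s : ℝ} (hs : 0 < s) (hp : 0 < peak φ ℓ s) :
    ∫ v in (0 : ℝ)..1, deriv (stressInv φ) (peak φ ℓ s * amp v) * amp v = -s := by
  have h1 : IsLocalMin (fun κ => s * κ + dmg φ κ) (peak φ ℓ s) := by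
    filter_upwards [Ioo_mem_nhds hp (h.peak_lt_ell hs)] with κ hκ
    exact h.minEnergy_le s ⟨hκ.1.le, hκ.2.le⟩
  have h2 := ((hasDerivAt_id (peak φ ℓ s)).const_mul s).add (h.hasDerivAt_dmg hp).2
  have h3 := h1.hasDerivAt_eq_zero h2
  linarith

theorem mul_peak_lt_minEnergy (h : IsStress φ ℓ) {s : ℝ} (hs : 0 < s) :
    s * peak φ ℓ s < minEnergy φ ℓ s := by
  have := h.dmg_pos (h.isPeak s).1.1 (h.peak_lt_ell hs)
  rw [minEnergy]; linarith

theorem minEnergy_add_lt (h : IsStress φ ℓ) {s t : ℝ} (hs : 0 < s) (ht : 0 < t) :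
    minEnergy φ ℓ (s + t) < minEnergy φ ℓ s + minEnergy φ ℓ t := by
  have key : ∀ s t, 0 < s → s ≤ t →
      minEnergy φ ℓ (s + t) < minEnergy φ ℓ s + minEnergy φ ℓ t := by
    intro s t hs hst
    have h1 := h.minEnergy_le (s + t) (h.isPeak t).1
    have h2 := h.mul_peak_lt_minEnergy hs
    have h3 := mul_le_mul_of_nonneg_left (h.antitone_peak hst) hs.le
    have h4 : minEnergy φ ℓ t = t * peak φ ℓ t + dmg φ (peak φ ℓ t) := rfl
    linarith
  rcases le_total s t with hst | hst
  · exact key s t hs hst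
  · rw [add_comm s, add_comm (minEnergy φ ℓ s)]
    exact key t s ht hst

theorem tendsto_minEnergy (h : IsStress φ ℓ) : Tendsto (minEnergy φ ℓ) atTop (𝓝 1) := by
  have h1 : Tendsto (fun s : ℝ => dmg φ s⁻¹) atTop (𝓝 1) := by
    have := (h.continuous_dmg.tendsto 0).comp tendsto_inv_atTop_zero
    rwa [h.dmg_zero] at this
  refine tendsto_of_tendsto_of_tendsto_of_le_of_le' h1 tendsto_const_nhds ?_
    (Eventually.of_forall fun s => h.minEnergy_le_one s)
  filter_upwards [eventually_gt_atTop 0] with s hs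
  have h2 := h.minEnergy_le_one s
  have h3 := h.dmg_nonneg (peak φ ℓ s)
  have h4 : peak φ ℓ s ≤ s⁻¹ := by
    rw [← one_div, le_div_iff₀ hs]
    rw [minEnergy] at h2; linarith
  have h5 := h.antitone_dmg h4
  have h6 := mul_nonneg hs.le (h.isPeak s).1.1
  rw [minEnergy]; linarith

end IsStress

end Cohesive

/-! ### Expansion of the minimal energy at small openings -/

namespace Cohesive

namespace IsStress

variable {φ : ℝ → ℝ} {ℓ ℓ₁ : ℝ}

theorem exists_mul_sqrt_le (h : IsStress φ ℓ) (hℓ₁ : 0 < ℓ₁)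
    (hexp : (fun x => φ x - (ℓ - ℓ₁ * √x)) =o[𝓝[>] (0 : ℝ)] (fun x => √x)) :
    ∃ c > 0, ∀ x ∈ Set.Ioc (0 : ℝ) 1, c * √x ≤ ℓ - φ x := by
  have h1 := hexp.def (c := ℓ₁ / 2) (by positivity)
  obtain ⟨b, hb, hsub⟩ := mem_nhdsGT_iff_exists_Ioo_subset.1 h1
  have hb0 : 0 < b := hb
  set x₀ := min (b / 2) 1 with hx₀
  have hx₀pos : 0 < x₀ := by positivity
  have hx₀m : x₀ ∈ Set.Ioc (0 : ℝ) 1 := ⟨hx₀pos, min_le_right _ _⟩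
  have hφ0 := h.lt_ell hx₀m
  refine ⟨min (ℓ₁ / 2) (ℓ - φ x₀), lt_min (by positivity) (by linarith), fun x hx => ?_⟩
  rcases le_total x x₀ with hxx | hxx
  · have : x ∈ Set.Ioo 0 b := ⟨hx.1, by linarith [min_le_left (b / 2) 1]⟩
    have h2 := hsub this
    simp only [Set.mem_ofPred_eq, Real.norm_eq_abs, abs_of_nonneg (Real.sqrt_nonneg x)] at h2
    have h3 := (abs_le.1 h2).2
    have h4 := mul_le_mul_of_nonneg_right (min_le_left (ℓ₁ / 2) (ℓ - φ x₀)) (Real.sqrt_nonneg x)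
    linarith
  · have h2 := h.strictAntiOn.antitoneOn ⟨hx₀m.1.le, hx₀m.2⟩ ⟨hx.1.le, hx.2⟩ hxx
    have h3 : √x ≤ 1 := by simpa using hx.2
    have h4 := mul_le_mul_of_nonneg_right (min_le_right (ℓ₁ / 2) (ℓ - φ x₀)) (Real.sqrt_nonneg x)
    nlinarith [Real.sqrt_nonneg x]

/-- The asymptotics of the damage energy near the peak stress `ℓ`, where `r² = ℓ - κ`. The integral
over the damage variable `x` is rescaled by `x = r⁴ u`. -/
theorem exists_tendsto_dmg_div (h : IsStress φ ℓ) (hℓ₁ : 0 < ℓ₁)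
    (hexp : (fun x => φ x - (ℓ - ℓ₁ * √x)) =o[𝓝[>] (0 : ℝ)] (fun x => √x)) :
    ∃ C > 0, Tendsto (fun r => dmg φ (ℓ - r ^ 2) / r ^ 5) (𝓝[>] 0) (𝓝 C) := by
  have hℓ := h.ell_pos
  obtain ⟨c, hc, hcle⟩ := h.exists_mul_sqrt_le hℓ₁ hexp
  set w : ℝ → ℝ := fun u => √(2 / ℓ * (1 - ℓ₁ * √u)) with hw
  have hwc : Continuous w := by rw [hw]; fun_prop
  refine ⟨∫ u in (0 : ℝ)..(1 / ℓ₁ ^ 2), w u, ?_, ?_⟩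
  · refine intervalIntegral.intervalIntegral_pos_of_pos_on (hwc.intervalIntegrable _ _)
      (fun u hu => Real.sqrt_pos.2 ?_) (by positivity)
    have : √u < 1 / ℓ₁ := by
      rw [Real.sqrt_lt' (by positivity), div_pow, one_pow]; exact hu.2
    rw [lt_div_iff₀ hℓ₁] at this
    have h2 : 0 < 1 - ℓ₁ * √u := by linarith
    positivity
  -- the rescaled integrand
  set q : ℝ → ℝ → ℝ := fun r => (Set.Ioo (0 : ℝ) 1).indicator
    fun x => √(1 - ((ℓ - r ^ 2) / φ x) ^ 2) with hq
  have hqm : ∀ r, Measurable (q r) := by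
    intro r
    have : ContinuousOn (fun x => √(1 - ((ℓ - r ^ 2) / φ x) ^ 2)) (Set.Ioo (0 : ℝ) 1) := by
      refine Real.continuous_sqrt.comp_continuousOn (continuousOn_const.sub (ContinuousOn.pow ?_ 2))
      exact continuousOn_const.div (h.continuousOn.mono Set.Ioo_subset_Icc_self)
        fun x hx => (h.pos ⟨hx.1.le, hx.2⟩).ne'
    have h2 := this.measurable_piecewise (continuousOn_const (c := (0 : ℝ))) measurableSet_Ioo
    rwa [show (fun _ => (0 : ℝ)) = (0 : ℝ → ℝ) from rfl, Set.piecewise_eq_indicator] at h2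
  have hint : ∀ᶠ r in 𝓝[>] (0 : ℝ), dmg φ (ℓ - r ^ 2) / r ^ 5
      = ∫ u in Set.Ioi (0 : ℝ), q r (r ^ 4 * u) / r := by
    have hs : Tendsto (fun r : ℝ => r ^ 2) (𝓝[>] 0) (𝓝 0) := by
      have : Continuous fun r : ℝ => r ^ 2 := by fun_prop
      simpa using (this.tendsto 0).mono_left (nhdsWithin_le_nhds (s := Set.Ioi 0))
    filter_upwards [self_mem_nhdsWithin, hs.eventually_lt_const hℓ] with r hr hr2
    have hr : 0 < r := hr
    rw [integral_div, integral_comp_mul_left_Ioi (q r) 0 (by positivity : 0 < r ^ 4), mul_zero,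
      h.dmg_eq_integral_sqrt (by linarith), intervalIntegral.integral_of_le zero_le_one,
      ← Measure.restrict_congr_set Ioo_ae_eq_Ioc, hq]
    simp only
    rw [setIntegral_indicator measurableSet_Ioo, Set.inter_eq_right.2 Set.Ioo_subset_Ioi_self,
      smul_eq_mul]
    field_simp
  refine Tendsto.congr' (EventuallyEq.symm hint) ?_
  have hlim : ∫ u in (0 : ℝ)..(1 / ℓ₁ ^ 2), w u = ∫ u in Set.Ioi (0 : ℝ), w u := by
    rw [intervalIntegral.integral_of_le (by positivity)]
    refine (setIntegral_eq_of_subset_of_forall_sdiff_eq_zero measurableSet_Ioi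
      Set.Ioc_subset_Ioi_self fun u hu => ?_).symm
    have h1 : 1 / ℓ₁ ^ 2 < u := by
      by_contra! hle
      exact hu.2 ⟨hu.1, hle⟩
    have h2 : 1 / ℓ₁ < √u := by
      rw [Real.lt_sqrt (by positivity), div_pow, one_pow]; exact h1
    rw [div_lt_iff₀ hℓ₁] at h2
    refine Real.sqrt_eq_zero_of_nonpos (mul_nonpos_of_nonneg_of_nonpos (by positivity) ?_)
    linarith
  rw [hlim]
  have hr4 : ∀ u : ℝ, 0 < u → Tendsto (fun r : ℝ => r ^ 4 * u) (𝓝[>] 0) (𝓝[>] 0) := by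
    intro u hu
    refine tendsto_nhdsWithin_iff.2 ⟨?_, ?_⟩
    · have : Continuous fun r : ℝ => r ^ 4 * u := by fun_prop
      simpa using (this.tendsto 0).mono_left (nhdsWithin_le_nhds (s := Set.Ioi 0))
    · filter_upwards [self_mem_nhdsWithin] with r hr
      have : (0 : ℝ) < r := hr
      exact (by positivity : 0 < r ^ 4 * u)
  refine tendsto_integral_filter_of_dominated_convergence
    ((Set.Ioc 0 (1 / c ^ 2)).indicator fun _ => √(4 / ℓ)) ?_ ?_ ?_ ?_
  · exact Eventually.of_forall fun r =>
      (((hqm r).comp (measurable_const_mul _)).div_const _).aestronglyMeasurable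
  · have hs : Tendsto (fun r : ℝ => r ^ 2) (𝓝[>] 0) (𝓝 0) := by
      have : Continuous fun r : ℝ => r ^ 2 := by fun_prop
      simpa using (this.tendsto 0).mono_left (nhdsWithin_le_nhds (s := Set.Ioi 0))
    filter_upwards [self_mem_nhdsWithin, hs.eventually_lt_const (half_pos hℓ)] with r hr hr2
    have hr : 0 < r := hr
    filter_upwards [self_mem_ae_restrict measurableSet_Ioi] with u hu
    have hu : 0 < u := hu
    have hnn : 0 ≤ (Set.Ioc 0 (1 / c ^ 2)).indicator (fun _ => √(4 / ℓ)) u :=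
      Set.indicator_nonneg (fun _ _ => Real.sqrt_nonneg _) _
    simp only [hq]
    by_cases hx : r ^ 4 * u ∈ Set.Ioo (0 : ℝ) 1
    swap
    · rw [Set.indicator_of_notMem hx]; simpa using hnn
    rw [Set.indicator_of_mem hx]
    have hφ := h.pos ⟨hx.1.le, hx.2⟩
    rcases le_or_gt (φ (r ^ 4 * u)) (ℓ - r ^ 2) with hle | hgt
    · rw [Real.sqrt_eq_zero_of_nonpos]
      · simpa using hnn
      · have : 1 ≤ (ℓ - r ^ 2) / φ (r ^ 4 * u) := (one_le_div hφ).2 hle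
        nlinarith
    · have hcx := hcle _ ⟨hx.1, hx.2.le⟩
      have hsq : √(r ^ 4 * u) = r ^ 2 * √u := by
        rw [Real.sqrt_mul (by positivity), show r ^ 4 = (r ^ 2) ^ 2 by ring,
          Real.sqrt_sq (by positivity)]
      have hu2 : u ≤ 1 / c ^ 2 := by
        have : c * √u ≤ 1 := by
          rw [hsq] at hcx
          have : r ^ 2 * (c * √u) ≤ r ^ 2 * 1 := by nlinarith
          exact le_of_mul_le_mul_left this (by positivity)
        rw [le_div_iff₀ (by positivity)]
        have h5 := Real.sq_sqrt hu.le
        have h6 : 0 ≤ c * √u := by positivity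
        nlinarith
      rw [Set.indicator_of_mem (show u ∈ Set.Ioc 0 (1 / c ^ 2) from ⟨hu, hu2⟩), Real.norm_eq_abs, abs_of_nonneg (by positivity),
        div_le_iff₀ hr]
      have : √(4 / ℓ) * r = √(4 / ℓ * r ^ 2) := by
        rw [Real.sqrt_mul (by positivity), Real.sqrt_sq hr.le]
      rw [this]
      refine Real.sqrt_le_sqrt ?_
      set y := φ (r ^ 4 * u)
      have hyℓ : y ≤ ℓ := h.le_ell ⟨hx.1.le, hx.2.le⟩
      have e1 : 1 - ((ℓ - r ^ 2) / y) ^ 2 = (y - (ℓ - r ^ 2)) * (y + (ℓ - r ^ 2)) / y ^ 2 := by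
        field_simp
        ring
      rw [e1, div_le_iff₀ (by positivity)]
      have e2 : 4 / ℓ * r ^ 2 * y ^ 2 = (4 * r ^ 2 * y ^ 2) / ℓ := by ring
      rw [e2, le_div_iff₀ hℓ]
      have e3 : (y - (ℓ - r ^ 2)) * (y + (ℓ - r ^ 2)) ≤ r ^ 2 * (2 * y) := by
        refine mul_le_mul ?_ ?_ ?_ ?_ <;> nlinarith [sq_nonneg r]
      have e4 : r ^ 2 * (2 * y) * ℓ ≤ r ^ 2 * (2 * y) * (2 * y) := by
        refine mul_le_mul_of_nonneg_left ?_ (by positivity)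
        linarith
      nlinarith
  · refine IntegrableOn.integrable ?_
    refine (Integrable.mono_measure ?_ Measure.restrict_le_self)
    rw [integrable_indicator_iff measurableSet_Ioc]
    exact integrableOn_const (by simp)
  · filter_upwards [self_mem_ae_restrict measurableSet_Ioi] with u hu
    have hu : 0 < u := hu
    have ht := hr4 u hu
    have hmem : ∀ᶠ r in 𝓝[>] (0 : ℝ), r ^ 4 * u ∈ Set.Ioo (0 : ℝ) 1 :=
      ht.eventually (Ioo_mem_nhdsGT zero_lt_one)
    have hφlim : Tendsto (fun r : ℝ => φ (r ^ 4 * u)) (𝓝[>] 0) (𝓝 ℓ) := by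
      have h1 := h.continuousOn 0 (by simp)
      rw [ContinuousWithinAt, h.zero] at h1
      refine h1.comp (tendsto_nhdsWithin_iff.2 ⟨ht.mono_right nhdsWithin_le_nhds, ?_⟩)
      filter_upwards [hmem] with r hr using ⟨hr.1.le, hr.2.le⟩
    have hsq : ∀ r : ℝ, √(r ^ 4 * u) = r ^ 2 * √u := fun r => by
      rw [Real.sqrt_mul (by positivity), show r ^ 4 = (r ^ 2) ^ 2 by ring,
        Real.sqrt_sq (by positivity)]
    have hdiff : Tendsto (fun r : ℝ => (φ (r ^ 4 * u) - (ℓ - r ^ 2)) / r ^ 2) (𝓝[>] 0)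
        (𝓝 (1 - ℓ₁ * √u)) := by
      have h1 := (hexp.comp_tendsto ht).tendsto_div_nhds_zero
      have h2 := (h1.mul_const √u).add_const (1 - ℓ₁ * √u)
      rw [zero_mul, zero_add] at h2
      refine h2.congr' ?_
      filter_upwards [self_mem_nhdsWithin] with r hr
      have hr : 0 < r := hr
      have hu' := Real.sqrt_pos.2 hu
      simp only [Function.comp, hsq]
      field_simp
      ring
    have hs : Tendsto (fun r : ℝ => ℓ - r ^ 2) (𝓝[>] 0) (𝓝 ℓ) := by
      have : Continuous fun r : ℝ => ℓ - r ^ 2 := by fun_prop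
      simpa using (this.tendsto 0).mono_left (nhdsWithin_le_nhds (s := Set.Ioi 0))
    have hprod := hdiff.mul ((hφlim.add hs).div (hφlim.pow 2) (by positivity))
    have e : (1 - ℓ₁ * √u) * ((ℓ + ℓ) / ℓ ^ 2) = 2 / ℓ * (1 - ℓ₁ * √u) := by
      field_simp; ring
    rw [e] at hprod
    have := (Real.continuous_sqrt.tendsto _).comp hprod
    refine this.congr' ?_
    filter_upwards [hmem, self_mem_nhdsWithin] with r hr hr0
    have hr0 : 0 < r := hr0
    have hφ := h.pos ⟨hr.1.le, hr.2⟩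
    simp only [hq, Set.indicator_of_mem hr, Function.comp, Pi.div_apply]
    conv_rhs => rw [← Real.sqrt_sq hr0.le, ← Real.sqrt_div' _ (by positivity)]
    congr 1
    simp only [Real.sqrt_sq hr0.le]
    field_simp
    ring

theorem exists_mul_pow_le_dmg (h : IsStress φ ℓ) {C : ℝ} (hC : 0 < C)
    (hlim : Tendsto (fun r => dmg φ (ℓ - r ^ 2) / r ^ 5) (𝓝[>] 0) (𝓝 C)) :
    ∃ c > 0, ∀ r, 0 ≤ r → r ^ 2 ≤ ℓ → c * r ^ 5 ≤ dmg φ (ℓ - r ^ 2) := by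
  have hℓ := h.ell_pos
  obtain ⟨b, hb, hsub⟩ := mem_nhdsGT_iff_exists_Ioo_subset.1
    (hlim.eventually_const_lt (half_lt_self hC))
  have hb0 : 0 < b := hb
  set r₀ := min (b / 2) √ℓ with hr₀
  have hr₀pos : 0 < r₀ := lt_min (by linarith) (Real.sqrt_pos.2 hℓ)
  have hr₀b : r₀ < b := (min_le_left _ _).trans_lt (by linarith)
  have hr₀ℓ : r₀ ^ 2 ≤ ℓ := by
    rw [← Real.le_sqrt hr₀pos.le hℓ.le]; exact min_le_right _ _
  have hF := h.dmg_pos (κ := ℓ - r₀ ^ 2) (by linarith) (by nlinarith)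
  have hsℓ := Real.sqrt_pos.2 hℓ
  refine ⟨min (C / 2) (dmg φ (ℓ - r₀ ^ 2) / √ℓ ^ 5), by positivity, fun r hr hrℓ => ?_⟩
  rcases hr.eq_or_lt with rfl | hr
  · simpa using h.dmg_nonneg ℓ
  rcases lt_or_ge r b with hrb | hrb
  · have h1 : C / 2 < dmg φ (ℓ - r ^ 2) / r ^ 5 := hsub ⟨hr, hrb⟩
    rw [lt_div_iff₀ (by positivity)] at h1
    have h2 := mul_le_mul_of_nonneg_right (min_le_left (C / 2) (dmg φ (ℓ - r₀ ^ 2) / √ℓ ^ 5))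
      (by positivity : 0 ≤ r ^ 5)
    linarith
  · have h1 : dmg φ (ℓ - r₀ ^ 2) ≤ dmg φ (ℓ - r ^ 2) :=
      h.antitone_dmg (by nlinarith)
    have h2 := mul_le_mul_of_nonneg_right (min_le_right (C / 2) (dmg φ (ℓ - r₀ ^ 2) / √ℓ ^ 5))
      (by positivity : 0 ≤ r ^ 5)
    have h3 : r ^ 5 ≤ √ℓ ^ 5 := pow_le_pow_left₀ hr.le (Real.le_sqrt_of_sq_le hrℓ) 5
    have h4 : dmg φ (ℓ - r₀ ^ 2) / √ℓ ^ 5 * r ^ 5 ≤ dmg φ (ℓ - r₀ ^ 2) := by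
      rw [div_mul_eq_mul_div, div_le_iff₀ (by positivity)]
      exact mul_le_mul_of_nonneg_left h3 hF.le
    linarith

/-- The expansion of the minimal energy, in the variable `σ = s^(1/3)`. With `κ = ℓ - r²` the
reduced energy is `ℓ σ³ - σ³ r² + C r⁵` up to terms of higher order, and the minimum over `r` is at
`r = e σ` with `5 C e³ = 2`. -/
theorem exists_tendsto_minEnergy (h : IsStress φ ℓ) {C : ℝ} (hC : 0 < C)
    (hlim : Tendsto (fun r => dmg φ (ℓ - r ^ 2) / r ^ 5) (𝓝[>] 0) (𝓝 C)) :
    ∃ K > 0, Tendsto (fun σ => (minEnergy φ ℓ (σ ^ 3) - ℓ * σ ^ 3) / σ ^ 5) (𝓝[>] 0)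
      (𝓝 (-K)) := by
  have hℓ := h.ell_pos
  obtain ⟨c, hc, hcle⟩ := h.exists_mul_pow_le_dmg hC hlim
  set e : ℝ := (2 / (5 * C)) ^ (1 / 3 : ℝ) with he
  have he0 : 0 < e := by positivity
  have he3 : C * e ^ 3 = 2 / 5 := by
    have : e ^ 3 = 2 / (5 * C) := by
      rw [he, ← Real.rpow_natCast, ← Real.rpow_mul (by positivity)]; norm_num
    rw [this]; field_simp
  have hK : ∀ x : ℝ, 0 ≤ x → -(3 / 5 * e ^ 2) ≤ C * x ^ 5 - x ^ 2 := by
    intro x hx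
    have h1 : 0 ≤ (x - e) ^ 2 * (2 * x ^ 3 + 4 * x ^ 2 * e + 6 * x * e ^ 2 + 3 * e ^ 3) := by
      positivity
    have h2 : 5 * e ^ 3 * (C * x ^ 5 - x ^ 2 + 3 / 5 * e ^ 2)
        = (x - e) ^ 2 * (2 * x ^ 3 + 4 * x ^ 2 * e + 6 * x * e ^ 2 + 3 * e ^ 3) := by
      linear_combination (5 * x ^ 5) * he3
    rw [← h2] at h1
    have := nonneg_of_mul_nonneg_right h1 (by positivity)
    linarith
  refine ⟨3 / 5 * e ^ 2, by positivity, tendsto_order.2 ⟨fun b hb => ?_, fun b hb => ?_⟩⟩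
  · set a : ℝ := (1 / c) ^ (1 / 3 : ℝ) with ha
    have ha0 : 0 < a := by positivity
    have ha3 : a ^ 3 = 1 / c := by
      rw [ha, ← Real.rpow_natCast, ← Real.rpow_mul (by positivity)]; norm_num
    set ε := (-(3 / 5 * e ^ 2) - b) / (2 * a ^ 5) with hε
    have hε0 : 0 < ε := div_pos (by linarith) (by positivity)
    obtain ⟨r₁, hr₁, hsub⟩ := mem_nhdsGT_iff_exists_Ioo_subset.1
      (hlim.eventually_const_lt (show C - ε < C by linarith))
    have hr₁0 : 0 < r₁ := hr₁
    filter_upwards [Ioo_mem_nhdsGT (div_pos hr₁0 ha0)] with σ hσ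
    have hσ0 : 0 < σ := hσ.1
    have hp := (h.isPeak (σ ^ 3)).1
    set r := √(ℓ - peak φ ℓ (σ ^ 3)) with hr
    have hr0 : 0 ≤ r := Real.sqrt_nonneg _
    have hr2 : r ^ 2 = ℓ - peak φ ℓ (σ ^ 3) := Real.sq_sqrt (by linarith [hp.2])
    have hpk : peak φ ℓ (σ ^ 3) = ℓ - r ^ 2 := by linarith
    have hE : minEnergy φ ℓ (σ ^ 3) - ℓ * σ ^ 3 = dmg φ (ℓ - r ^ 2) - σ ^ 3 * r ^ 2 := by
      rw [minEnergy, hpk]; ring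
    have h1 := hcle r hr0 (by rw [hr2]; linarith [hp.1])
    have h2 := h.minEnergy_le_ell_mul (σ ^ 3)
    have hra : r ≤ a * σ := by
      rcases hr0.eq_or_lt with h0 | hrpos
      · rw [← h0]; positivity
      refine le_of_pow_le_pow_left₀ (n := 3) (by norm_num) (by positivity) ?_
      rw [mul_pow, ha3, one_div, inv_mul_eq_div, le_div_iff₀ hc]
      have : r ^ 2 * (r ^ 3 * c) ≤ r ^ 2 * σ ^ 3 := by nlinarith
      exact le_of_mul_le_mul_left this (by positivity)
    have hlow : (C - ε) * r ^ 5 ≤ dmg φ (ℓ - r ^ 2) := by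
      rcases hr0.eq_or_lt with h0 | hrpos
      · rw [← h0]; simpa using h.dmg_nonneg ℓ
      have hrr : r < r₁ := hra.trans_lt (by
        have := hσ.2; rw [lt_div_iff₀ ha0] at this; linarith)
      have := hsub ⟨hrpos, hrr⟩
      have h3 : C - ε < dmg φ (ℓ - r ^ 2) / r ^ 5 := this
      rw [lt_div_iff₀ (by positivity)] at h3
      exact h3.le
    rw [hE, lt_div_iff₀ (by positivity)]
    have h4 := hK (r / σ) (by positivity)
    have h5 : σ ^ 5 * (C * (r / σ) ^ 5 - (r / σ) ^ 2) = C * r ^ 5 - σ ^ 3 * r ^ 2 := by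
      field_simp
    have h6 := mul_le_mul_of_nonneg_left h4 (by positivity : 0 ≤ σ ^ 5)
    rw [h5] at h6
    have h7 : r ^ 5 ≤ (a * σ) ^ 5 := pow_le_pow_left₀ hr0 hra 5
    have h8 : ε * r ^ 5 ≤ (-(3 / 5 * e ^ 2) - b) / 2 * σ ^ 5 := by
      calc ε * r ^ 5 ≤ ε * (a * σ) ^ 5 := mul_le_mul_of_nonneg_left h7 hε0.le
        _ = _ := by rw [hε]; field_simp
    have h9 : 0 < (-(3 / 5 * e ^ 2) - b) / 2 * σ ^ 5 :=
      mul_pos (by linarith) (by positivity)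
    linarith
  · have hT : Tendsto (fun σ : ℝ => e * σ) (𝓝[>] 0) (𝓝[>] 0) := by
      refine tendsto_nhdsWithin_iff.2 ⟨?_, ?_⟩
      · have : Continuous fun σ : ℝ => e * σ := by fun_prop
        simpa using (this.tendsto 0).mono_left (nhdsWithin_le_nhds (s := Set.Ioi 0))
      · filter_upwards [self_mem_nhdsWithin] with σ hσ
        exact mul_pos he0 hσ
    have h1 := ((hlim.comp hT).mul_const (e ^ 5)).sub_const (e ^ 2)
    have h2 : C * e ^ 5 - e ^ 2 = -(3 / 5 * e ^ 2) := by linear_combination e ^ 2 * he3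
    rw [h2] at h1
    have hs : Tendsto (fun σ : ℝ => (e * σ) ^ 2) (𝓝[>] 0) (𝓝 0) := by
      have : Continuous fun σ : ℝ => (e * σ) ^ 2 := by fun_prop
      simpa using (this.tendsto 0).mono_left (nhdsWithin_le_nhds (s := Set.Ioi 0))
    filter_upwards [h1.eventually_lt_const hb, self_mem_nhdsWithin, hs.eventually_lt_const hℓ]
      with σ hσ hσ0 hσℓ
    have hσ0 : 0 < σ := hσ0
    refine lt_of_le_of_lt ?_ hσ
    have h3 := h.minEnergy_le (σ ^ 3) (κ := ℓ - (e * σ) ^ 2)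
      ⟨by linarith, by nlinarith [sq_nonneg (e * σ)]⟩
    rw [div_le_iff₀ (by positivity)]
    have h4 : (dmg φ (ℓ - (e * σ) ^ 2) / (e * σ) ^ 5 * e ^ 5 - e ^ 2) * σ ^ 5
        = dmg φ (ℓ - (e * σ) ^ 2) - σ ^ 3 * (e * σ) ^ 2 := by
      field_simp
    simp only [Function.comp]
    rw [h4]
    linarith

theorem exists_isLittleO_minEnergy (h : IsStress φ ℓ) (hℓ₁ : 0 < ℓ₁)
    (hexp : (fun x => φ x - (ℓ - ℓ₁ * √x)) =o[𝓝[>] (0 : ℝ)] (fun x => √x)) :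
    ∃ K > 0, (fun s => minEnergy φ ℓ s - (ℓ * s - K * s ^ (5 / 3 : ℝ)))
      =o[𝓝[>] (0 : ℝ)] fun s => s ^ (5 / 3 : ℝ) := by
  obtain ⟨C, hC, hlim⟩ := h.exists_tendsto_dmg_div hℓ₁ hexp
  obtain ⟨K, hK, hT⟩ := h.exists_tendsto_minEnergy hC hlim
  refine ⟨K, hK, ?_⟩
  have hcube : Tendsto (fun s : ℝ => s ^ (1 / 3 : ℝ)) (𝓝[>] 0) (𝓝[>] 0) := by
    refine tendsto_nhdsWithin_iff.2 ⟨?_, ?_⟩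
    · have := (Real.continuousAt_rpow_const 0 (1 / 3 : ℝ) (Or.inr (by norm_num))).tendsto
      rw [Real.zero_rpow (by norm_num)] at this
      exact this.mono_left nhdsWithin_le_nhds
    · filter_upwards [self_mem_nhdsWithin] with s hs using Real.rpow_pos_of_pos hs _
  refine isLittleO_of_tendsto' ?_ ?_
  · filter_upwards [self_mem_nhdsWithin] with s hs h0
    exact absurd h0 (Real.rpow_pos_of_pos hs _).ne'
  · have h1 := (hT.comp hcube).add_const K
    rw [neg_add_cancel] at h1
    refine h1.congr' ?_
    filter_upwards [self_mem_nhdsWithin] with s hs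
    have hs : 0 < s := hs
    have e3 : (s ^ (1 / 3 : ℝ)) ^ 3 = s := by
      rw [← Real.rpow_natCast, ← Real.rpow_mul hs.le]; norm_num
    have e5 : (s ^ (1 / 3 : ℝ)) ^ 5 = s ^ (5 / 3 : ℝ) := by
      rw [← Real.rpow_natCast, ← Real.rpow_mul hs.le]; norm_num
    have hp := Real.rpow_pos_of_pos hs (5 / 3)
    simp only [Function.comp, e3, e5]
    field_simp
    ring

end IsStress

end Cohesive

/-! ### The lower bound for the energy -/

namespace Cohesive

variable {f φ α β : ℝ → ℝ} {ℓ ℓ₁ : ℝ}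

theorem continuous_of_absolutelyContinuous {u : ℝ → ℝ}
    (hu : ∀ a b, AbsolutelyContinuousOnInterval u a b) : Continuous u := by
  refine continuous_iff_continuousAt.2 fun t => ?_
  refine (hu (t - 1) (t + 1)).continuousOn.continuousAt ?_
  rw [Set.uIcc_of_le (by linarith)]
  exact Icc_mem_nhds (by linarith) (by linarith)

theorem ae_differentiableAt_of_absolutelyContinuous {u : ℝ → ℝ}
    (hu : ∀ a b, AbsolutelyContinuousOnInterval u a b) : ∀ᵐ t, DifferentiableAt ℝ u t := by
  have h : ∀ᵐ t, ∀ n : ℕ, t ∈ Set.uIcc (-n : ℝ) n → DifferentiableAt ℝ u t :=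
    ae_all_iff.2 fun n => (hu (-n) n).ae_differentiableAt
  filter_upwards [h] with t ht
  obtain ⟨n, hn⟩ := exists_nat_ge |t|
  refine ht n ?_
  rw [Set.uIcc_of_le (by linarith [n.cast_nonneg (α := ℝ)])]
  exact abs_le.1 hn

theorem absolutelyContinuous_comp_of_dist_le {u g : ℝ → ℝ} {a b : ℝ}
    (hu : AbsolutelyContinuousOnInterval u a b) (hg : ∀ x y, dist (g x) (g y) ≤ dist x y) :
    AbsolutelyContinuousOnInterval (fun t => g (u t)) a b :=
  squeeze_zero (fun _ => Finset.sum_nonneg fun _ _ => dist_nonneg)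
    (fun _ => Finset.sum_le_sum fun _ _ => hg _ _) hu

/-- The variation of `u` on an interval is at least the oscillation between its endpoints. -/
theorem ofReal_abs_sub_le_lintegral {u : ℝ → ℝ} {a b : ℝ} (hab : a ≤ b)
    (hu : AbsolutelyContinuousOnInterval u a b) :
    ENNReal.ofReal |u b - u a| ≤ ∫⁻ t in Set.Ioo a b, ENNReal.ofReal |deriv u t| := by
  rw [← hu.integral_deriv_eq_sub, intervalIntegral.integral_of_le hab, ← Real.norm_eq_abs,
    ofReal_norm, ← Measure.restrict_congr_set Ioo_ae_eq_Ioc]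
  refine (enorm_integral_le_lintegral_enorm _).trans (le_of_eq ?_)
  simp [← ofReal_norm]

theorem ofReal_abs_sub_le_lintegral_Ioi {u : ℝ → ℝ} {t₀ l : ℝ}
    (hu : ∀ a b, AbsolutelyContinuousOnInterval u a b) (hl : Tendsto u atTop (𝓝 l)) :
    ENNReal.ofReal |l - u t₀| ≤ ∫⁻ t in Set.Ioi t₀, ENNReal.ofReal |deriv u t| := by
  refine le_of_tendsto ((ENNReal.continuous_ofReal.tendsto _).comp (hl.sub_const (u t₀)).abs) ?_
  filter_upwards [eventually_ge_atTop t₀] with R hR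
  exact (ofReal_abs_sub_le_lintegral hR (hu _ _)).trans
    (lintegral_mono_set Set.Ioo_subset_Ioi_self)

theorem ofReal_abs_sub_le_lintegral_Iio {u : ℝ → ℝ} {t₀ l : ℝ}
    (hu : ∀ a b, AbsolutelyContinuousOnInterval u a b) (hl : Tendsto u atBot (𝓝 l)) :
    ENNReal.ofReal |u t₀ - l| ≤ ∫⁻ t in Set.Iio t₀, ENNReal.ofReal |deriv u t| := by
  refine le_of_tendsto ((ENNReal.continuous_ofReal.tendsto _).comp (hl.const_sub (u t₀)).abs) ?_
  filter_upwards [eventually_le_atBot t₀] with R hR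
  exact (ofReal_abs_sub_le_lintegral hR (hu _ _)).trans
    (lintegral_mono_set Set.Ioo_subset_Iio_self)

theorem Admissible.continuous (h : Admissible α β) : Continuous β :=
  continuous_of_absolutelyContinuous h.h1_right.1

theorem Admissible.exists_min (h : Admissible α β) : ∃ t₀, ∀ t, β t₀ ≤ β t := by
  by_cases h1 : ∃ t, β t < 1
  · obtain ⟨t₁, ht₁⟩ := h1
    refine h.continuous.exists_forall_le' t₁ ?_
    rw [cocompact_eq_atBot_atTop]
    exact eventually_sup.2 ⟨(h.tendsto_atBot.eventually_const_lt ht₁).mono fun _ => le_of_lt,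
      (h.tendsto_atTop.eventually_const_lt ht₁).mono fun _ => le_of_lt⟩
  · push Not at h1
    exact ⟨0, fun t => (h.mem_Icc 0).2.trans (h1 t)⟩

/-- The pointwise inequality behind the lower bound: two weighted inequalities of arithmetic and
geometric means, with a weight that the peak stress `κ` determines. Here `a = |α'|`, `b = |β'|`,
`F = f(β)` and `c = 1 - β`. -/
theorem density_lower_bound {s κ a b c F : ℝ} (hκ : 0 ≤ κ) (hc : 0 < c)
    (hF : 0 ≤ F) (hκF : κ ≤ c * F) :
    s * κ * a + c * b * √(1 - (κ / (c * F)) ^ 2) ≤ s ^ 2 * F ^ 2 * a ^ 2 + (c ^ 2 / 4 + b ^ 2) := by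
  rcases hF.eq_or_lt with rfl | hF
  · have : κ = 0 := le_antisymm (by simpa using hκF) hκ
    subst this
    simp only [mul_zero, zero_mul, div_zero, ne_eq, OfNat.ofNat_ne_zero, not_false_eq_true,
      zero_pow, sub_zero, Real.sqrt_one, mul_one, zero_add]
    nlinarith [sq_nonneg (c / 2 - b)]
  · have h1 : (κ / (c * F)) ^ 2 ≤ 1 := by
      rw [sq_le_one_iff₀ (by positivity), div_le_one (by positivity)]; exact hκF
    have h2 := Real.sq_sqrt (sub_nonneg.2 h1)
    set w := √(1 - (κ / (c * F)) ^ 2)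
    have h3 : c ^ 2 * (κ / (c * F)) ^ 2 = (κ / F) ^ 2 := by field_simp
    have h4 : κ = κ / F * F := by field_simp
    set k := κ / F
    rw [h4]
    nlinarith [sq_nonneg (s * F * a - k / 2), sq_nonneg (c * w / 2 - b)]

/-- The lower bound for the energy: a profile with minimum value `β t₀` costs at least the reduced
energy with the peak stress `κ = φ((1 - β t₀)²)`. -/
theorem Admissible.le_energy (hf : Potential f ℓ ℓ₁) (s : ℝ≥0) (h : Admissible α β) {t₀ : ℝ}
    (ht₀ : ∀ t, β t₀ ≤ β t) :
    ENNReal.ofReal (s * stress f ℓ ((1 - β t₀) ^ 2)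
      + dmg (stress f ℓ) (stress f ℓ ((1 - β t₀) ^ 2))) ≤ energy f s α β := by
  have hφ := hf.isStress
  set φ := stress f ℓ with hφdef
  set X := (1 - β t₀) ^ 2 with hX
  have hX0 : 0 ≤ X := sq_nonneg _
  have hX1 : X ≤ 1 := by
    have := h.mem_Icc t₀
    nlinarith [this.1, this.2]
  set κ := φ X with hκ
  have hκ0 : 0 ≤ κ := hφ.nonneg ⟨hX0, hX1⟩
  have hκle : ∀ x ∈ Set.Icc 0 X, κ ≤ φ x := fun x hx =>
    hφ.strictAntiOn.antitoneOn ⟨hx.1, hx.2.trans hX1⟩ ⟨hX0, hX1⟩ hx.2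
  have hu : ∀ t, (1 - β t) ^ 2 ∈ Set.Icc 0 X := fun t => by
    have h1 := h.mem_Icc t
    have h2 := ht₀ t
    have h3 := (h.mem_Icc t₀).1
    exact ⟨sq_nonneg _, pow_le_pow_left₀ (by linarith [h1.2]) (by linarith) 2⟩
  set w : ℝ → ℝ := fun x => √(1 - (κ / φ x) ^ 2) with hw
  have hwc : ContinuousOn w (Set.Icc 0 X) := by
    refine Real.continuous_sqrt.comp_continuousOn (continuousOn_const.sub (ContinuousOn.pow ?_ 2))
    rcases hκ0.eq_or_lt with h0 | h0
    · rw [← h0]; simpa using continuousOn_const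
    · exact continuousOn_const.div (hφ.continuousOn.mono (Set.Icc_subset_Icc_right hX1))
        fun x hx => (h0.trans_le (hκle x hx)).ne'
  -- extend the weight continuously by constants
  set W : ℝ → ℝ := fun x => w (max 0 (min x X)) with hW
  have hWc : Continuous W := hwc.comp_continuous (by fun_prop) fun x =>
    ⟨le_max_left _ _, max_le hX0 (min_le_right _ _)⟩
  have hWeq : ∀ x ∈ Set.Icc 0 X, W x = w x := fun x hx => by
    simp only [hW, min_eq_left hx.2, max_eq_right hx.1]
  set P : ℝ → ℝ := fun x => ∫ y in (0 : ℝ)..x, W y with hP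
  have hPd : ∀ x, HasDerivAt P (W x) x := fun x =>
    intervalIntegral.integral_hasDerivAt_right (hWc.intervalIntegrable _ _)
      (hWc.stronglyMeasurableAtFilter _ _) hWc.continuousAt
  have hPlip : ∀ x y, dist (P x) (P y) ≤ dist x y := by
    have : LipschitzWith 1 P := by
      refine lipschitzWith_of_nnnorm_deriv_le (fun x => (hPd x).differentiableAt) fun x => ?_
      rw [(hPd x).deriv, ← NNReal.coe_le_coe, coe_nnnorm, Real.norm_eq_abs,
        abs_of_nonneg (Real.sqrt_nonneg _)]
      exact IsStress.sqrt_le_one _ _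
    intro x y
    simpa using this.dist_le_mul x y
  have hP0 : P 0 = 0 := by simp [hP]
  have hPX : P X = dmg φ κ := by
    rw [hφ.dmg_eq_integral_sqrt hκ0]
    have h1 : P X = ∫ x in (0 : ℝ)..X, w x := by
      refine intervalIntegral.integral_congr fun x hx => ?_
      rw [Set.uIcc_of_le hX0] at hx
      exact hWeq x hx
    have h2 : Set.EqOn w (fun _ => 0) (Set.Ioo X 1) := by
      intro x hx
      have hxm : x ∈ Set.Icc (0 : ℝ) 1 := ⟨hX0.trans hx.1.le, hx.2.le⟩
      have hp := hφ.pos ⟨hxm.1, hx.2⟩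
      have hlt : φ x < κ := hφ.strictAntiOn ⟨hX0, hX1⟩ hxm hx.1
      have : 1 ≤ κ / φ x := (one_le_div hp).2 hlt.le
      exact Real.sqrt_eq_zero_of_nonpos (by nlinarith)
    have h3 : IntervalIntegrable w volume X 1 := by
      rw [intervalIntegrable_iff_integrableOn_Ioo_of_le hX1]
      exact (integrableOn_zero (μ := volume)).congr_fun (fun x hx => (h2 hx).symm)
        measurableSet_Ioo
    have h4 : ∫ x in X..1, w x = 0 := by
      rw [intervalIntegral.integral_of_le hX1, ← Measure.restrict_congr_set Ioo_ae_eq_Ioc,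
        setIntegral_congr_fun measurableSet_Ioo h2]
      simp
    have h5 : IntervalIntegrable w volume 0 X := by
      refine ContinuousOn.intervalIntegrable ?_
      rwa [Set.uIcc_of_le hX0]
    rw [h1, ← intervalIntegral.integral_add_adjacent_intervals h5 h3, h4, add_zero]
  set G : ℝ → ℝ := fun t => P ((1 - β t) ^ 2) with hG
  have hGac : ∀ a b, AbsolutelyContinuousOnInterval G a b := by
    intro a b
    refine absolutelyContinuous_comp_of_dist_le ?_ hPlip
    have h1 : AbsolutelyContinuousOnInterval (fun t => 1 - β t) a b := by
      have h0 : AbsolutelyContinuousOnInterval (fun _ : ℝ => (1 : ℝ)) a b :=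
        LipschitzOnWith.absolutelyContinuousOnInterval (K := 0)
          (LipschitzWith.const 1).lipschitzOnWith
      exact h0.fun_sub (h.h1_right.1 a b)
    simpa [sq] using h1.fun_mul h1
  have hGt₀ : G t₀ = dmg φ κ := hPX
  have hGlim : ∀ l, Tendsto β l (𝓝 1) → Tendsto G l (𝓝 0) := by
    intro l hl
    have hPc : Continuous P := continuous_iff_continuousAt.2 fun x => (hPd x).continuousAt
    have : Continuous fun b : ℝ => P ((1 - b) ^ 2) := by fun_prop
    have h2 := (this.tendsto 1).comp hl
    simpa [hP0] using! h2
  have hGvar : ENNReal.ofReal (2 * dmg φ κ) ≤ ∫⁻ t, ENNReal.ofReal |deriv G t| := by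
    have h1 := ofReal_abs_sub_le_lintegral_Ioi (t₀ := t₀) hGac (hGlim _ h.tendsto_atTop)
    have h2 := ofReal_abs_sub_le_lintegral_Iio (t₀ := t₀) hGac (hGlim _ h.tendsto_atBot)
    have hd := hφ.dmg_nonneg κ
    rw [hGt₀, zero_sub, abs_neg, abs_of_nonneg hd] at h1
    rw [hGt₀, sub_zero, abs_of_nonneg hd] at h2
    rw [two_mul, ENNReal.ofReal_add hd hd]
    refine (add_le_add h2 h1).trans ?_
    rw [← lintegral_union measurableSet_Ioi (Set.disjoint_left.2 fun x hx hx' =>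
      lt_asymm (Set.mem_Iio.1 hx) (Set.mem_Ioi.1 hx'))]
    exact setLIntegral_le_lintegral _ _
  have hαvar : 1 ≤ ∫⁻ t, ENNReal.ofReal |deriv α t| := by
    have h1 := enorm_integral_le_lintegral_enorm (μ := volume) (deriv α)
    rw [← ofReal_norm, Real.norm_eq_abs, h.abs_integral_deriv, ENNReal.ofReal_one] at h1
    simpa [← ofReal_norm] using h1
  have hpt : ∀ᵐ t, ENNReal.ofReal (s * κ) * ENNReal.ofReal |deriv α t|
      + ENNReal.ofReal (1 / 2) * ENNReal.ofReal |deriv G t| ≤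
      ((s : ℝ≥0∞) ^ 2 * fExt f (β t) ^ 2 * ENNReal.ofReal (|deriv α t| ^ 2)
        + ENNReal.ofReal ((1 - β t) ^ 2 / 4 + |deriv β t| ^ 2)) := by
    filter_upwards [ae_differentiableAt_of_absolutelyContinuous h.h1_right.1] with t ht
    have hGd : deriv G t = W ((1 - β t) ^ 2) * (2 * (1 - β t) * (-deriv β t)) := by
      have h1 := ((ht.hasDerivAt.const_sub 1).fun_pow 2)
      have h2 := HasDerivAt.comp t (hPd ((1 - β t) ^ 2)) h1
      have h3 : HasDerivAt G _ t := h2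
      rw [h3.deriv]
      norm_num
    have hb := h.mem_Icc t
    rw [← ENNReal.ofReal_mul (by positivity), ← ENNReal.ofReal_mul (by positivity)]
    rcases hb.2.eq_or_lt with h1 | hlt
    · have hG0 : deriv G t = 0 := by rw [hGd, h1]; ring
      rw [hG0, fExt, if_neg (by rw [h1]; exact lt_irrefl _)]
      simp only [abs_zero, mul_zero, ENNReal.ofReal_zero, add_zero]
      rcases eq_or_ne s 0 with rfl | hs
      · simp
      rcases eq_or_ne (deriv α t) 0 with h0 | h0
      · simp [h0]
      · have hs' : (s : ℝ≥0∞) ≠ 0 := by simpa using hs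
        have : (s : ℝ≥0∞) ^ 2 * ∞ ^ 2 * ENNReal.ofReal (|deriv α t| ^ 2) = ∞ := by
          rw [ENNReal.top_pow two_ne_zero, ENNReal.mul_top (pow_ne_zero 2 hs'),
            ENNReal.top_mul (ENNReal.ofReal_pos.2 (by positivity)).ne']
        rw [this]; simp
    · have hc : 0 < 1 - β t := by linarith
      have hF : 0 ≤ f (β t) := hf.nonneg _ ⟨hb.1, hlt⟩
      have hφt : φ ((1 - β t) ^ 2) = (1 - β t) * f (β t) := by
        rw [hφdef, stress_sq hc, sub_sub_cancel]
      have key := density_lower_bound (s := s) (κ := κ) (a := |deriv α t|) (b := |deriv β t|) hκ0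
        hc hF (by rw [← hφt]; exact hκle _ (hu t))
      have hGabs : 1 / 2 * |deriv G t|
          = (1 - β t) * |deriv β t| * √(1 - (κ / ((1 - β t) * f (β t))) ^ 2) := by
        rw [hGd, hWeq _ (hu t), abs_mul, abs_mul, abs_neg, abs_of_pos (by linarith : 0 < 2 * (1 - β t)),
          abs_of_nonneg (Real.sqrt_nonneg _), ← hφt]
        ring
      rw [fExt, if_pos hlt, ← ENNReal.ofReal_coe_nnreal,
        ← ENNReal.ofReal_pow (by positivity), ← ENNReal.ofReal_pow hF,
        ← ENNReal.ofReal_mul (by positivity), ← ENNReal.ofReal_mul (by positivity),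
        ← ENNReal.ofReal_add (by positivity) (by positivity),
        ← ENNReal.ofReal_add (by positivity) (by positivity), hGabs]
      exact ENNReal.ofReal_le_ofReal key
  have hsum := (le_lintegral_add (μ := volume)
    (fun t => ENNReal.ofReal (s * κ) * ENNReal.ofReal |deriv α t|)
    (fun t => ENNReal.ofReal (1 / 2) * ENNReal.ofReal |deriv G t|)).trans
    (lintegral_mono_ae hpt)
  rw [lintegral_const_mul' _ _ ENNReal.ofReal_ne_top,
    lintegral_const_mul' _ _ ENNReal.ofReal_ne_top] at hsum
  refine le_trans ?_ hsum
  rw [ENNReal.ofReal_add (by positivity) (hφ.dmg_nonneg κ)]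
  refine add_le_add ?_ ?_
  · simpa using mul_le_mul_right hαvar (ENNReal.ofReal (s * κ))
  · have : dmg φ κ = 1 / 2 * (2 * dmg φ κ) := by ring
    rw [this, ENNReal.ofReal_mul (by positivity)]
    exact mul_le_mul_right hGvar _

end Cohesive

/-! ### The slope parametrization of a profile -/

namespace Cohesive

theorem h1Loc_of_hasDerivAt {u u' : ℝ → ℝ} (hu : ∀ t, HasDerivAt u (u' t) t)
    (hc : Continuous u') : H1Loc u := by
  have hd : deriv u = u' := funext fun t => (hu t).deriv
  have h1 : ContDiff ℝ 1 u := contDiff_one_iff_deriv.2 ⟨fun t => (hu t).differentiableAt, hd ▸ hc⟩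
  refine ⟨fun a b => h1.contDiffOn.absolutelyContinuousOnInterval, ?_⟩
  rw [hd]
  exact (hc.pow 2).locallyIntegrable

/-- A continuous nonnegative derivative of a function with limits at `±∞` is integrable. -/
theorem integrable_and_integral_of_hasDerivAt_of_nonneg {g g' : ℝ → ℝ} {m n : ℝ}
    (hd : ∀ t, HasDerivAt g (g' t) t) (hc : Continuous g') (h0 : ∀ t, 0 ≤ g' t)
    (hm : Tendsto g atBot (𝓝 m)) (hn : Tendsto g atTop (𝓝 n)) :
    Integrable g' ∧ ∫ t, g' t = n - m := by
  have hI : Integrable g' := by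
    refine integrable_of_intervalIntegral_norm_tendsto (l := atTop) (a := fun k : ℝ => -k)
      (b := fun k : ℝ => k) (n - m) (fun k => (hc.integrableOn_Icc).mono_set Set.Ioc_subset_Icc_self)
      tendsto_neg_atTop_atBot tendsto_id ?_
    have h1 : ∀ k : ℝ, ∫ t in (-k)..k, ‖g' t‖ = g k - g (-k) := by
      intro k
      simp only [Real.norm_eq_abs, abs_of_nonneg (h0 _)]
      exact intervalIntegral.integral_eq_sub_of_hasDerivAt (fun t _ => hd t)
        (hc.intervalIntegrable _ _)
    simp only [h1]
    exact hn.sub (hm.comp tendsto_neg_atTop_atBot)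
  exact ⟨hI, integral_of_hasDerivAt_of_tendsto hd hI hm hn⟩

/-- The inverse of a strictly monotone function from an open interval onto `ℝ`. -/
theorem exists_inverse_of_strictMonoOn {T : ℝ → ℝ} {a b : ℝ} (hab : a < b)
    (hT : StrictMonoOn T (Set.Ioo a b)) (hs : ∀ t, ∃ v ∈ Set.Ioo a b, T v = t) :
    ∃ v : ℝ → ℝ, (∀ t, v t ∈ Set.Ioo a b) ∧ (∀ t, T (v t) = t) ∧ Continuous v ∧
      Tendsto v atTop (𝓝 b) ∧ Tendsto v atBot (𝓝 a) := by
  choose v hv hTv using hs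
  have hmono : Monotone v := fun s t hst => by
    rw [← hT.le_iff_le (hv s) (hv t), hTv, hTv]; exact hst
  have hrange : Set.range v = Set.Ioo a b := by
    refine Set.Subset.antisymm (Set.range_subset_iff.2 hv) fun x hx => ⟨T x, ?_⟩
    exact hT.injOn (hv _) hx (hTv _)
  refine ⟨v, hv, hTv, continuous_iff_continuousAt.2 fun t => ?_, ?_, ?_⟩
  · refine continuousAt_of_monotoneOn_of_image_mem_nhds (hmono.monotoneOn Set.univ) univ_mem ?_
    rw [Set.image_univ, hrange]
    exact isOpen_Ioo.mem_nhds (hv t)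
  · exact tendsto_atTop_isLUB hmono (hrange ▸ isLUB_Ioo hab)
  · exact tendsto_atBot_isGLB hmono (hrange ▸ isGLB_Ioo hab)

theorem hasDerivAt_amp {v : ℝ} (hv : v ∈ Set.Ioo (-1 : ℝ) 1) :
    HasDerivAt amp (v * amp v ^ 3) v := by
  have h0 : 0 < 1 - v ^ 2 := by nlinarith [hv.1, hv.2]
  have h1 : HasDerivAt (fun v : ℝ => 1 - v ^ 2) (-(2 * v)) v := by
    simpa using ((hasDerivAt_id v).fun_pow 2).const_sub 1
  have h2 := (h1.sqrt h0.ne').fun_inv (Real.sqrt_pos.2 h0).ne'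
  refine HasDerivAt.congr_deriv (f := amp) h2 ?_
  have := Real.sqrt_pos.2 h0
  simp only [amp]
  field_simp

theorem amp_neg (v : ℝ) : amp (-v) = amp v := by simp [amp]

theorem amp_sq_mul {v : ℝ} (hv : v ∈ Set.Ioo (-1 : ℝ) 1) : amp v ^ 2 * (1 - v ^ 2) = 1 := by
  have h0 : 0 < 1 - v ^ 2 := by nlinarith [hv.1, hv.2]
  rw [amp, inv_pow, Real.sq_sqrt h0.le, inv_mul_cancel₀ h0.ne']

/-- The damage variable `x = ψ(κ Z(v))` as a function of the relative slope `v`. -/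
noncomputable def dmgOfSlope (φ : ℝ → ℝ) (κ v : ℝ) : ℝ := stressInv φ (κ * amp v)

/-- The derivative `dt/dv` of the position along the optimal profile as a function of the relative
slope. The parametrization by `v` removes the singularity that the position has as a function of
the damage variable at the centre of the profile. -/
noncomputable def slopeSpeed (φ : ℝ → ℝ) (κ v : ℝ) : ℝ :=
  κ * amp v ^ 3 * -deriv (stressInv φ) (κ * amp v) / dmgOfSlope φ κ v

namespace IsStress

variable {φ : ℝ → ℝ} {ℓ κ : ℝ}

theorem sqrt_pos (h : IsStress φ ℓ) (hκ : κ ∈ Set.Ioo 0 ℓ) : 0 < √(1 - (κ / ℓ) ^ 2) :=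
  (Real.sqrt_nonneg _).trans_lt (h.sqrt_lt_sqrt_of_lt hκ.1.le hκ.2 le_rfl)

theorem mem_Ioo_one {v : ℝ}
    (hv : v ∈ Set.Ioo (-√(1 - (κ / ℓ) ^ 2)) √(1 - (κ / ℓ) ^ 2)) : v ∈ Set.Ioo (-1 : ℝ) 1 := by
  have := sqrt_le_one κ ℓ
  exact ⟨by linarith [hv.1], by linarith [hv.2]⟩

theorem mul_amp_mem (h : IsStress φ ℓ) (hκ : κ ∈ Set.Ioo 0 ℓ) {v : ℝ}
    (hv : v ∈ Set.Ioo (-√(1 - (κ / ℓ) ^ 2)) √(1 - (κ / ℓ) ^ 2)) :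
    κ * amp v ∈ Set.Ioo 0 ℓ := by
  refine ⟨mul_pos hκ.1 (amp_pos (mem_Ioo_one hv)), ?_⟩
  have h1 : amp v = amp |v| := by
    rcases abs_choice v with h2 | h2 <;> rw [h2]
    rw [amp_neg]
  have h2 : |v| < √(1 - (κ / ℓ) ^ 2) := abs_lt.2 hv
  rw [h1, mul_amp_lt_iff hκ.1.le h.ell_pos
    ⟨abs_nonneg v, h2.trans_le (sqrt_le_one _ _)⟩]
  exact h2

theorem mul_amp_sqrt (h : IsStress φ ℓ) (hκ : κ ∈ Set.Ioo 0 ℓ) :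
    κ * amp √(1 - (κ / ℓ) ^ 2) = ℓ := by
  have hℓ := h.ell_pos
  have h1 : (κ / ℓ) ^ 2 ≤ 1 := by
    rw [sq_le_one_iff₀ (div_nonneg hκ.1.le hℓ.le), div_le_one hℓ]; exact hκ.2.le
  have hκ0 := hκ.1
  rw [amp, Real.sq_sqrt (by linarith), sub_sub_cancel, Real.sqrt_sq (by positivity)]
  field_simp

theorem sqrt_lt_one (h : IsStress φ ℓ) (hκ : κ ∈ Set.Ioo 0 ℓ) : √(1 - (κ / ℓ) ^ 2) < 1 := by
  rw [Real.sqrt_lt' one_pos]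
  have : 0 < κ / ℓ := div_pos hκ.1 h.ell_pos
  nlinarith

theorem ell_lt_mul_amp (h : IsStress φ ℓ) (hκ : κ ∈ Set.Ioo 0 ℓ) {v : ℝ}
    (hv : v ∈ Set.Ioo √(1 - (κ / ℓ) ^ 2) 1) : ℓ < κ * amp v := by
  have h0 := (h.sqrt_pos hκ).trans hv.1
  have h1 : 0 < 1 - v ^ 2 := by nlinarith [hv.2]
  rw [← h.mul_amp_sqrt hκ]
  refine mul_lt_mul_of_pos_left ?_ hκ.1
  have h2 := h.sqrt_pos hκ
  refine inv_strictAnti₀ (Real.sqrt_pos.2 h1) (Real.sqrt_lt_sqrt h1.le ?_)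
  nlinarith [hv.1]

theorem dmgOfSlope_pos (h : IsStress φ ℓ) (hκ : κ ∈ Set.Ioo 0 ℓ) {v : ℝ}
    (hv : v ∈ Set.Ioo (-√(1 - (κ / ℓ) ^ 2)) √(1 - (κ / ℓ) ^ 2)) : 0 < dmgOfSlope φ κ v :=
  h.inv_pos (h.mul_amp_mem hκ hv).2

theorem slopeSpeed_pos (h : IsStress φ ℓ) (hκ : κ ∈ Set.Ioo 0 ℓ) {v : ℝ}
    (hv : v ∈ Set.Ioo (-√(1 - (κ / ℓ) ^ 2)) √(1 - (κ / ℓ) ^ 2)) : 0 < slopeSpeed φ κ v := by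
  have h1 := h.deriv_inv_neg (h.mul_amp_mem hκ hv)
  have h2 := amp_pos (mem_Ioo_one hv)
  have h3 := h.dmgOfSlope_pos hκ hv
  have h4 := hκ.1
  have h5 : 0 < -deriv (stressInv φ) (κ * amp v) := by linarith
  unfold slopeSpeed
  positivity

theorem continuousOn_deriv_inv_amp (h : IsStress φ ℓ) (hκ : κ ∈ Set.Ioo 0 ℓ) :
    ContinuousOn (fun v => deriv (stressInv φ) (κ * amp v))
      (Set.Ioo (-√(1 - (κ / ℓ) ^ 2)) √(1 - (κ / ℓ) ^ 2)) :=
  h.continuousOn_deriv_inv.comp (continuousOn_const.mul (continuousOn_amp.mono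
    fun _ => mem_Ioo_one)) fun _ hv => h.mul_amp_mem hκ hv

theorem continuousOn_dmgOfSlope (h : IsStress φ ℓ) :
    ContinuousOn (dmgOfSlope φ κ) (Set.Ioo (-1) 1) :=
  h.continuous_inv.comp_continuousOn (continuousOn_const.mul continuousOn_amp)

theorem continuousOn_slopeSpeed (h : IsStress φ ℓ) (hκ : κ ∈ Set.Ioo 0 ℓ) :
    ContinuousOn (slopeSpeed φ κ) (Set.Ioo (-√(1 - (κ / ℓ) ^ 2)) √(1 - (κ / ℓ) ^ 2)) := by
  refine ContinuousOn.div ?_ (h.continuousOn_dmgOfSlope.mono fun _ => mem_Ioo_one)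
    fun v hv => (h.dmgOfSlope_pos hκ hv).ne'
  exact (continuousOn_const.mul ((continuousOn_amp.mono fun _ => mem_Ioo_one).pow 3)).mul
    (h.continuousOn_deriv_inv_amp hκ).neg

theorem hasDerivAt_dmgOfSlope (h : IsStress φ ℓ) (hκ : κ ∈ Set.Ioo 0 ℓ) {v : ℝ}
    (hv : v ∈ Set.Ioo (-√(1 - (κ / ℓ) ^ 2)) √(1 - (κ / ℓ) ^ 2)) :
    HasDerivAt (dmgOfSlope φ κ) (-(v * dmgOfSlope φ κ v * slopeSpeed φ κ v)) v := by
  have h1 := h.hasDerivAt_inv (h.mul_amp_mem hκ hv)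
  have h2 := HasDerivAt.comp v (h1.differentiableAt.hasDerivAt)
    ((hasDerivAt_amp (mem_Ioo_one hv)).const_mul κ)
  have h3 := h.dmgOfSlope_pos hκ hv
  refine HasDerivAt.congr_deriv h2 ?_
  unfold slopeSpeed
  field_simp

/-- A function that is continuous on an open interval around `0` is the derivative of its primitive
there. -/
theorem _root_.Cohesive.hasDerivAt_primitive {u : ℝ → ℝ} {b v : ℝ}
    (hu : ContinuousOn u (Set.Ioo (-b) b)) (hv : v ∈ Set.Ioo (-b) b) :
    HasDerivAt (fun v => ∫ w in (0 : ℝ)..v, u w) (u v) v := by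
  have hb : 0 < b := by linarith [hv.1, hv.2]
  refine intervalIntegral.integral_hasDerivAt_right (ContinuousOn.intervalIntegrable (hu.mono ?_))
    (hu.stronglyMeasurableAtFilter isOpen_Ioo v hv) (hu.continuousAt (isOpen_Ioo.mem_nhds hv))
  exact Set.ordConnected_Ioo.uIcc_subset ⟨by linarith, hb⟩ hv

/-- The position `t = T(v)` along the profile is a bijection from the slopes to `ℝ`. The profile is
infinitely long because `d(log x)/dt = -v` is bounded. -/
theorem exists_slope (h : IsStress φ ℓ) (hκ : κ ∈ Set.Ioo 0 ℓ) :
    ∃ v : ℝ → ℝ, (∀ t, v t ∈ Set.Ioo (-√(1 - (κ / ℓ) ^ 2)) √(1 - (κ / ℓ) ^ 2)) ∧ (∃ t, v t = 0) ∧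
      Continuous v ∧ (∀ t, HasDerivAt v (slopeSpeed φ κ (v t))⁻¹ t) ∧
      Tendsto v atTop (𝓝 √(1 - (κ / ℓ) ^ 2)) ∧ Tendsto v atBot (𝓝 (-√(1 - (κ / ℓ) ^ 2))) := by
  set b := √(1 - (κ / ℓ) ^ 2) with hb
  have hb0 : 0 < b := h.sqrt_pos hκ
  set T : ℝ → ℝ := fun v => ∫ w in (0 : ℝ)..v, slopeSpeed φ κ w with hT
  have hTd : ∀ v ∈ Set.Ioo (-b) b, HasDerivAt T (slopeSpeed φ κ v) v := fun v hv =>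
    hasDerivAt_primitive (h.continuousOn_slopeSpeed hκ) hv
  have hTc : ContinuousOn T (Set.Ioo (-b) b) := fun v hv =>
    (hTd v hv).continuousAt.continuousWithinAt
  have hTmono : StrictMonoOn T (Set.Ioo (-b) b) := by
    refine strictMonoOn_of_deriv_pos (convex_Ioo _ _) hTc fun v hv => ?_
    rw [interior_Ioo] at hv
    rw [(hTd v hv).deriv]
    exact h.slopeSpeed_pos hκ hv
  have hT0 : T 0 = 0 := by simp [hT]
  have hodd : ∀ v, T (-v) = -T v := by
    intro v
    have heven : ∀ w, slopeSpeed φ κ (-w) = slopeSpeed φ κ w := fun w => by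
      simp only [slopeSpeed, dmgOfSlope, amp_neg]
    have h1 := intervalIntegral.integral_comp_neg (a := 0) (b := v) (slopeSpeed φ κ)
    simp only [heven, neg_zero] at h1
    simp only [hT]
    rw [h1, intervalIntegral.integral_symm]
  have hlog : ∀ v ∈ Set.Ico 0 b,
      Real.log (dmgOfSlope φ κ 0) ≤ T v + Real.log (dmgOfSlope φ κ v) := by
    intro v hv
    have hsub : Set.Icc 0 v ⊆ Set.Ioo (-b) b := fun w hw =>
      ⟨by linarith [hw.1], hw.2.trans_lt hv.2⟩
    have hder : ∀ w ∈ Set.Icc 0 v, HasDerivAt (fun w => T w + Real.log (dmgOfSlope φ κ w))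
        ((1 - w) * slopeSpeed φ κ w) w := by
      intro w hw
      have h1 := h.dmgOfSlope_pos hκ (hsub hw)
      refine HasDerivAt.congr_deriv ((hTd w (hsub hw)).add
        ((h.hasDerivAt_dmgOfSlope hκ (hsub hw)).log h1.ne')) ?_
      field_simp
      ring
    have hm : MonotoneOn (fun w => T w + Real.log (dmgOfSlope φ κ w)) (Set.Icc 0 v) := by
      refine monotoneOn_of_deriv_nonneg (convex_Icc _ _)
        (fun w hw => (hder w hw).continuousAt.continuousWithinAt)
        (fun w hw => (hder w (interior_subset hw)).differentiableAt.differentiableWithinAt)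
        fun w hw => ?_
      have hw' := interior_subset hw
      rw [(hder w hw').deriv]
      have := (mem_Ioo_one (hsub hw')).2
      exact mul_nonneg (by linarith) (h.slopeSpeed_pos hκ (hsub hw')).le
    have := hm (Set.left_mem_Icc.2 hv.1) (Set.right_mem_Icc.2 hv.1) hv.1
    simpa [hT0] using this
  have hlarge : ∀ t : ℝ, ∃ v ∈ Set.Ico 0 b, t ≤ T v := by
    intro t
    have h1 : Tendsto (dmgOfSlope φ κ) (𝓝[<] b) (𝓝[>] 0) := by
      refine tendsto_nhdsWithin_iff.2 ⟨?_, ?_⟩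
      · have hbm : b ∈ Set.Ioo (-1 : ℝ) 1 := ⟨by linarith, h.sqrt_lt_one hκ⟩
        have h2 := (h.continuousOn_dmgOfSlope (κ := κ)).continuousAt (isOpen_Ioo.mem_nhds hbm)
        have h3 : dmgOfSlope φ κ b = 0 := by
          rw [dmgOfSlope, h.mul_amp_sqrt hκ, h.inv_ell]
        rw [ContinuousAt, h3] at h2
        exact h2.mono_left nhdsWithin_le_nhds
      · filter_upwards [Ioo_mem_nhdsLT hb0] with v hv
        exact h.dmgOfSlope_pos hκ ⟨by linarith [hv.1], hv.2⟩
    have h2 := Real.tendsto_log_nhdsGT_zero.comp h1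
    obtain ⟨v, hv1, hv2⟩ := ((h2.eventually_le_atBot (Real.log (dmgOfSlope φ κ 0) - t)).and
      (Ioo_mem_nhdsLT hb0)).exists
    refine ⟨v, ⟨hv2.1.le, hv2.2⟩, ?_⟩
    have h3 := hlog v ⟨hv2.1.le, hv2.2⟩
    simp only [Function.comp] at hv1
    linarith
  have hsurj : ∀ t, ∃ v ∈ Set.Ioo (-b) b, T v = t := by
    have hpos : ∀ t, 0 ≤ t → ∃ v ∈ Set.Ioo (-b) b, T v = t := by
      intro t ht
      obtain ⟨v₁, hv₁, hle⟩ := hlarge t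
      have hsub : Set.Icc 0 v₁ ⊆ Set.Ioo (-b) b := fun w hw =>
        ⟨by linarith [hw.1], hw.2.trans_lt hv₁.2⟩
      obtain ⟨v, hv, hvt⟩ := intermediate_value_Icc hv₁.1 (hTc.mono hsub) ⟨by rwa [hT0], hle⟩
      exact ⟨v, hsub hv, hvt⟩
    intro t
    rcases le_total 0 t with ht | ht
    · exact hpos t ht
    · obtain ⟨v, hv, hvt⟩ := hpos (-t) (by linarith)
      exact ⟨-v, ⟨by linarith [hv.2], by linarith [hv.1]⟩, by rw [hodd, hvt, neg_neg]⟩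
  obtain ⟨v, hv, hTv, hvc, htop, hbot⟩ :=
    exists_inverse_of_strictMonoOn (by linarith) hTmono hsurj
  refine ⟨v, hv, ⟨0, ?_⟩, hvc, fun t => ?_, htop, hbot⟩
  · exact hTmono.injOn (hv 0) ⟨by linarith, hb0⟩ (by rw [hTv, hT0])
  · exact HasDerivAt.of_local_left_inverse hvc.continuousAt (hTd _ (hv t))
      (h.slopeSpeed_pos hκ (hv t)).ne' (Eventually.of_forall hTv)

end IsStress

end Cohesive

/-! ### Existence of optimal profiles -/

namespace Cohesive

/-- Limits of the primitive of an even function that vanishes on `(b, 1)`. -/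
theorem tendsto_primitive_of_even {u : ℝ → ℝ} {b : ℝ} (hb : b ∈ Set.Ioo (0 : ℝ) 1)
    (heven : ∀ v, u (-v) = u v) (hu : IntervalIntegrable u volume 0 1)
    (hzero : ∀ v ∈ Set.Ioo b 1, u v = 0) :
    Tendsto (fun v => ∫ w in (0 : ℝ)..v, u w) (𝓝 b) (𝓝 (∫ w in (0 : ℝ)..1, u w)) ∧
    Tendsto (fun v => ∫ w in (0 : ℝ)..v, u w) (𝓝 (-b)) (𝓝 (-∫ w in (0 : ℝ)..1, u w)) := by
  have hb1 : ∫ w in (0 : ℝ)..b, u w = ∫ w in (0 : ℝ)..1, u w := by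
    have h1 : ∫ w in b..1, u w = 0 := by
      rw [intervalIntegral.integral_of_le hb.2.le, ← Measure.restrict_congr_set Ioo_ae_eq_Ioc,
        setIntegral_congr_fun measurableSet_Ioo hzero]
      simp
    have h2 : b ∈ Set.uIcc (0 : ℝ) 1 := by
      rw [Set.uIcc_of_le zero_le_one]; exact ⟨hb.1.le, hb.2.le⟩
    rw [← intervalIntegral.integral_add_adjacent_intervals
      (hu.mono_set (Set.uIcc_subset_uIcc_left h2)) (hu.mono_set (Set.uIcc_subset_uIcc_right h2)),
      h1, add_zero]
  have hneg : ∀ v, ∫ w in (0 : ℝ)..(-v), u w = -∫ w in (0 : ℝ)..v, u w := by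
    intro v
    have h1 := intervalIntegral.integral_comp_neg (a := 0) (b := v) u
    simp only [heven, neg_zero] at h1
    rw [h1, intervalIntegral.integral_symm]
  have hT : Tendsto (fun v => ∫ w in (0 : ℝ)..v, u w) (𝓝 b) (𝓝 (∫ w in (0 : ℝ)..1, u w)) := by
    have h1 := intervalIntegral.continuousOn_primitive_interval' hu (a := 0) (by simp)
    have h2 := h1.continuousAt (x := b)
      (by rw [Set.uIcc_of_le zero_le_one]; exact Icc_mem_nhds hb.1 hb.2)
    rw [ContinuousAt, hb1] at h2
    exact h2
  refine ⟨hT, ?_⟩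
  have h3 : Tendsto (fun v : ℝ => -v) (𝓝 (-b)) (𝓝 b) := by
    simpa using (continuous_neg.tendsto (-b))
  refine (hT.comp h3).neg.congr fun v => ?_
  simp [hneg]

variable {f : ℝ → ℝ} {ℓ ℓ₁ : ℝ}

/-- An optimal profile for an opening `s > 0` at which the fracture is incomplete. With the relative
slope `v(t)` of `IsStress.exists_slope` and `x = ψ(κ Z(v))` it is `β = 1 - √x` with
`α' = x (1 - v²) / (2 s κ)`. Its energy density is `x / 2`, with an explicit primitive. -/
theorem Potential.exists_optimal_profile (hf : Potential f ℓ ℓ₁) {s : ℝ≥0} (hs : 0 < s)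
    (hp : 0 < peak (stress f ℓ) ℓ s) :
    ∃ α β, Admissible α β ∧ energy f s α β = ENNReal.ofReal (minEnergy (stress f ℓ) ℓ s) ∧
      IsLeast (Set.range β) (1 - √(stressInv (stress f ℓ) (peak (stress f ℓ) ℓ s))) := by
  have h := hf.isStress
  set φ := stress f ℓ with hφ
  set κ := peak φ ℓ s with hκdef
  have hs0 : (0 : ℝ) < s := hs
  have hκ : κ ∈ Set.Ioo 0 ℓ := ⟨hp, h.peak_lt_ell hs0⟩
  have hκ0 : 0 < κ := hκ.1
  have hκℓ := h.ell_pos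
  set b := √(1 - (κ / ℓ) ^ 2) with hb
  have hb01 : b ∈ Set.Ioo (0 : ℝ) 1 := ⟨h.sqrt_pos hκ, h.sqrt_lt_one hκ⟩
  obtain ⟨v, hv, ⟨t₀, hvt₀⟩, hvc, hvd, hvtop, hvbot⟩ := h.exists_slope hκ
  have hv1 : ∀ t, v t ∈ Set.Ioo (-1 : ℝ) 1 := fun t => IsStress.mem_Ioo_one (hv t)
  set x : ℝ → ℝ := fun t => dmgOfSlope φ κ (v t) with hx
  have hx0 : ∀ t, 0 < x t := fun t => h.dmgOfSlope_pos hκ (hv t)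
  have hxc : Continuous x := (h.continuousOn_dmgOfSlope (κ := κ)).comp_continuous hvc hv1
  have hxd : ∀ t, HasDerivAt x (-(v t * x t)) t := by
    intro t
    have h1 := HasDerivAt.comp t (h.hasDerivAt_dmgOfSlope hκ (hv t)) (hvd t)
    have h2 := h.slopeSpeed_pos hκ (hv t)
    refine h1.congr_deriv ?_
    rw [neg_mul, mul_assoc (v t * _), mul_inv_cancel₀ h2.ne', mul_one]
  -- the density of the opening, as a function of the relative slope
  set ρ : ℝ → ℝ := fun w => -(deriv (stressInv φ) (κ * amp w) * amp w) with hρ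
  have hρint : IntervalIntegrable ρ volume 0 1 := (h.hasDerivAt_dmg hκ0).1.neg
  have hρtot : ∫ w in (0 : ℝ)..1, ρ w = s := by
    simp only [hρ]
    rw [intervalIntegral.integral_neg, h.integral_deriv_eq_neg hs0 hp, neg_neg]
  have hρc : ContinuousOn ρ (Set.Ioo (-b) b) :=
    ((h.continuousOn_deriv_inv_amp hκ).mul
      (continuousOn_amp.mono fun _ => IsStress.mem_Ioo_one)).neg
  have hρlim := tendsto_primitive_of_even hb01 (fun w => by simp only [hρ, amp_neg]) hρint
    fun w hw => by simp [hρ, h.deriv_inv_of_gt (h.ell_lt_mul_amp hκ hw)]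
  rw [hρtot] at hρlim
  set α : ℝ → ℝ := fun t => (∫ w in (0 : ℝ)..(v t), ρ w) / (2 * s) with hα
  set α' : ℝ → ℝ := fun t => x t * (1 - v t ^ 2) / (2 * s * κ) with hα'
  have hα'0 : ∀ t, 0 ≤ α' t := fun t => by
    have := hv1 t
    have h1 : 0 ≤ 1 - v t ^ 2 := by nlinarith [this.1, this.2]
    have := (hx0 t).le
    simp only [hα']
    positivity
  have hα'c : Continuous α' := by simp only [hα']; fun_prop
  have hαd : ∀ t, HasDerivAt α (α' t) t := by
    intro t
    have h1 := (HasDerivAt.comp t (hasDerivAt_primitive hρc (hv t)) (hvd t)).div_const (2 * (s : ℝ))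
    refine HasDerivAt.congr_deriv h1 ?_
    have h2 := amp_pos (hv1 t)
    have h3 := amp_sq_mul (hv1 t)
    have h4 := h.deriv_inv_neg (h.mul_amp_mem hκ (hv t))
    have h5 := hx0 t
    have h6 : 1 - v t ^ 2 = (amp (v t) ^ 2)⁻¹ := by field_simp; linarith
    simp only [hρ, hα', slopeSpeed, h6]
    change 0 < dmgOfSlope φ κ (v t) at h5
    change _ = dmgOfSlope φ κ (v t) * _ / _
    field_simp
    exact div_self h4.ne
  have hαtop : Tendsto α atTop (𝓝 (1 / 2)) := by
    have h1 := (hρlim.1.comp hvtop).div_const (2 * (s : ℝ))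
    have e : (s : ℝ) / (2 * s) = 1 / 2 := by field_simp
    rw [e] at h1
    exact h1
  have hαbot : Tendsto α atBot (𝓝 (-(1 / 2))) := by
    have h1 := (hρlim.2.comp hvbot).div_const (2 * (s : ℝ))
    have e : -(s : ℝ) / (2 * s) = -(1 / 2) := by field_simp
    rw [e] at h1
    exact h1
  obtain ⟨hα'int, hα'tot⟩ := integrable_and_integral_of_hasDerivAt_of_nonneg hαd hα'c hα'0
    hαbot hαtop
  have hαderiv : deriv α = α' := funext fun t => (hαd t).deriv
  -- the damage variable
  set γ : ℝ → ℝ := fun t => √(x t) with hγ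
  have hγ0 : ∀ t, 0 < γ t := fun t => Real.sqrt_pos.2 (hx0 t)
  have hγsq : ∀ t, γ t ^ 2 = x t := fun t => Real.sq_sqrt (hx0 t).le
  have hγd : ∀ t, HasDerivAt γ (-(v t * γ t / 2)) t := by
    intro t
    refine ((hxd t).sqrt (hx0 t).ne').congr_deriv ?_
    have h1 := hγ0 t
    change _ / (2 * γ t) = _
    rw [← hγsq t]
    field_simp
  set β : ℝ → ℝ := fun t => 1 - γ t with hβ
  have hβd : ∀ t, HasDerivAt β (v t * γ t / 2) t := fun t => by
    simpa using (hγd t).const_sub 1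
  have hβderiv : ∀ t, deriv β t = v t * γ t / 2 := fun t => (hβd t).deriv
  have hx1 : ∀ t, x t ≤ stressInv φ κ := by
    intro t
    refine h.antitone_inv ?_
    have := one_le_amp (hv1 t)
    nlinarith
  have hγ1 : ∀ t, γ t ≤ 1 := fun t =>
    Real.sqrt_le_one.2 ((hx1 t).trans (h.inv_mem κ).2)
  have hqlim : Tendsto (dmgOfSlope φ κ) (𝓝 b) (𝓝 0) ∧
      Tendsto (dmgOfSlope φ κ) (𝓝 (-b)) (𝓝 0) := by
    have hc := h.continuousOn_dmgOfSlope (κ := κ)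
    have e : dmgOfSlope φ κ b = 0 := by rw [dmgOfSlope, h.mul_amp_sqrt hκ, h.inv_ell]
    have e' : dmgOfSlope φ κ (-b) = 0 := by rw [dmgOfSlope, amp_neg]; exact e
    have h1 := hc.continuousAt (isOpen_Ioo.mem_nhds ⟨by linarith [hb01.1], hb01.2⟩ : _ ∈ 𝓝 b)
    have h2 := hc.continuousAt
      (isOpen_Ioo.mem_nhds ⟨by linarith [hb01.2], by linarith [hb01.1]⟩ : _ ∈ 𝓝 (-b))
    rw [ContinuousAt, e] at h1
    rw [ContinuousAt, e'] at h2
    exact ⟨h1, h2⟩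
  have hxtop : Tendsto x atTop (𝓝 0) := hqlim.1.comp hvtop
  have hxbot : Tendsto x atBot (𝓝 0) := hqlim.2.comp hvbot
  have hβlim : ∀ l, Tendsto x l (𝓝 0) → Tendsto β l (𝓝 1) := by
    intro l hl
    have h1 := (((Real.continuous_sqrt.tendsto 0).comp hl).const_sub 1)
    simpa using! h1
  have hvγc : Continuous fun t => v t * γ t / 2 :=
    (hvc.mul (Real.continuous_sqrt.comp hxc)).div_const 2
  refine ⟨α, β, ⟨h1Loc_of_hasDerivAt hαd hα'c, h1Loc_of_hasDerivAt hβd hvγc, hαderiv ▸ hα'int, ?_,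
    fun t => ⟨by linarith [hγ1 t], by linarith [hγ0 t]⟩, hβlim _ hxtop, hβlim _ hxbot⟩, ?_, ?_⟩
  · rw [hαderiv, hα'tot]; norm_num
  · -- the energy density is `x / 2`
    have hdens : ∀ t, ((s : ℝ≥0∞) ^ 2 * fExt f (β t) ^ 2 * ENNReal.ofReal (|deriv α t| ^ 2)
        + ENNReal.ofReal ((1 - β t) ^ 2 / 4 + |deriv β t| ^ 2)) = ENNReal.ofReal (x t / 2) := by
      intro t
      have hlt : β t < 1 := by linarith [hγ0 t]
      have hF : 0 ≤ f (β t) := hf.nonneg _ ⟨by linarith [hγ1 t], hlt⟩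
      have h1 : γ t * f (β t) = κ * amp (v t) := by
        have h2 := stress_sq (f := f) (ℓ := ℓ) (hγ0 t)
        rw [hγsq, ← hφ] at h2
        rw [← h2]
        exact h.stress_inv ⟨(h.mul_amp_mem hκ (hv t)).1.le, (h.mul_amp_mem hκ (hv t)).2.le⟩
      have h3 := hγ0 t
      have h4 : f (β t) = κ * amp (v t) / γ t := by rw [← h1]; field_simp
      rw [fExt, if_pos hlt, ← ENNReal.ofReal_coe_nnreal,
        ← ENNReal.ofReal_pow (by positivity), ← ENNReal.ofReal_pow hF,
        ← ENNReal.ofReal_mul (by positivity), ← ENNReal.ofReal_mul (by positivity),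
        ← ENNReal.ofReal_add (by positivity) (by positivity), hαderiv, hβderiv, sq_abs, sq_abs, h4]
      congr 1
      have h5 := amp_sq_mul (hv1 t)
      have h6 := amp_pos (hv1 t)
      have h7 : 1 - v t ^ 2 = (amp (v t) ^ 2)⁻¹ := by field_simp; linarith
      simp only [hα', hβ, ← hγsq t, sub_sub_cancel]
      have e1 : (s : ℝ) ^ 2 * (κ * amp (v t) / γ t) ^ 2
          * (γ t ^ 2 * (1 - v t ^ 2) / (2 * s * κ)) ^ 2
          = γ t ^ 2 * (amp (v t) ^ 2 * (1 - v t ^ 2)) * (1 - v t ^ 2) / 4 := by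
        field_simp
        ring
      rw [e1, h5]
      ring
    rw [energy, lintegral_congr hdens]
    -- a primitive of the energy density
    have hQlim := tendsto_primitive_of_even (u := dmgOfSlope φ κ) hb01
      (fun w => by simp only [dmgOfSlope, amp_neg]) (h.intervalIntegrable_inv_amp κ 0 1)
      fun w hw => h.inv_of_ge (h.ell_lt_mul_amp hκ hw).le
    have hQtot : ∫ w in (0 : ℝ)..1, dmgOfSlope φ κ w = dmg φ κ := rfl
    rw [hQtot] at hQlim
    set Q : ℝ → ℝ := fun w => ∫ w' in (0 : ℝ)..w, dmgOfSlope φ κ w' with hQ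
    have hPd : ∀ t, HasDerivAt (fun t => s * κ * α t + (Q (v t) - v t * x t) / 2) (x t / 2) t := by
      intro t
      have h1 := HasDerivAt.comp t (hasDerivAt_primitive (h.continuousOn_dmgOfSlope (κ := κ))
        (hv1 t)) (hvd t)
      have h2 := ((hαd t).const_mul (s * κ)).add ((h1.sub ((hvd t).mul (hxd t))).div_const 2)
      refine HasDerivAt.congr_deriv h2 ?_
      simp only [hα', hx]
      field_simp
      ring
    have hm : Tendsto (fun t => s * κ * α t + (Q (v t) - v t * x t) / 2) atBot
        (𝓝 (s * κ * (-(1 / 2)) + (-dmg φ κ - -b * 0) / 2)) :=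
      (hαbot.const_mul _).add (((hQlim.2.comp hvbot).sub (hvbot.mul hxbot)).div_const 2)
    have hn : Tendsto (fun t => s * κ * α t + (Q (v t) - v t * x t) / 2) atTop
        (𝓝 (s * κ * (1 / 2) + (dmg φ κ - b * 0) / 2)) :=
      (hαtop.const_mul _).add (((hQlim.1.comp hvtop).sub (hvtop.mul hxtop)).div_const 2)
    obtain ⟨hI, htot⟩ := integrable_and_integral_of_hasDerivAt_of_nonneg hPd (hxc.div_const 2)
      (fun t => by linarith [hx0 t]) hm hn
    rw [← ofReal_integral_eq_lintegral_ofReal hI (Eventually.of_forall fun t =>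
      (by linarith [hx0 t] : (0 : ℝ) ≤ x t / 2)), htot, minEnergy]
    congr 1
    ring
  · refine ⟨⟨t₀, ?_⟩, ?_⟩
    · have : amp 0 = 1 := by simp [amp]
      simp only [hβ, hγ, hx, hvt₀, dmgOfSlope, this, mul_one]
    · rintro _ ⟨t, rfl⟩
      have := Real.sqrt_le_sqrt (hx1 t)
      simp only [hβ, hγ]
      linarith

end Cohesive

/-! ### Insertion of an interval into a function -/

namespace Cohesive

/-- The time change that stops at `p` for a time `L`. -/
noncomputable def pause (p L t : ℝ) : ℝ := t - max 0 (min (t - p) L)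

section pause

variable {p L t : ℝ}

theorem pause_of_le (h : t ≤ p) : pause p L t = t := by
  rw [pause, max_eq_left ((min_le_left _ _).trans (by linarith)), sub_zero]

theorem pause_of_mem (h : t ∈ Set.Icc p (p + L)) : pause p L t = p := by
  rw [pause, min_eq_left (by linarith [h.2]), max_eq_right (by linarith [h.1])]; ring

theorem pause_of_ge (hL : 0 ≤ L) (h : p + L ≤ t) : pause p L t = t - L := by
  rw [pause, min_eq_right (by linarith), max_eq_right hL]

theorem monotone_pause (hL : 0 ≤ L) : Monotone (pause p L) := by
  intro s t hst
  unfold pause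
  rcases le_total (s - p) L with h1 | h1 <;> rcases le_total (t - p) L with h2 | h2 <;>
  rcases le_total 0 (s - p) with h3 | h3 <;> rcases le_total 0 (t - p) with h4 | h4 <;>
  simp only [min_eq_left, min_eq_right, max_eq_left, max_eq_right, *] <;> linarith

theorem dist_pause_le (hL : 0 ≤ L) (s t : ℝ) : dist (pause p L s) (pause p L t) ≤ dist s t := by
  wlog hst : s ≤ t generalizing s t
  · rw [dist_comm, dist_comm s]; exact this t s (le_of_not_ge hst)
  have h1 := monotone_pause (p := p) hL hst
  have h2 : max 0 (min (s - p) L) ≤ max 0 (min (t - p) L) :=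
    max_le_max le_rfl (min_le_min (by linarith) le_rfl)
  rw [Real.dist_eq, Real.dist_eq, abs_of_nonpos (by linarith), abs_of_nonpos (by linarith)]
  unfold pause at *
  linarith

theorem absolutelyContinuous_comp_pause {u : ℝ → ℝ} (hL : 0 ≤ L)
    (hu : ∀ a b, AbsolutelyContinuousOnInterval u a b) (a b : ℝ) :
    AbsolutelyContinuousOnInterval (fun t => u (pause p L t)) a b := by
  rw [absolutelyContinuousOnInterval_iff]
  intro ε hε
  obtain ⟨δ, hδ, H⟩ := (absolutelyContinuousOnInterval_iff u (pause p L a) (pause p L b)).1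
    (hu _ _) ε hε
  refine ⟨δ, hδ, fun E hE hEδ => H (E.1, fun i => (pause p L (E.2 i).1, pause p L (E.2 i).2)) ?_
    ((Finset.sum_le_sum fun i _ => dist_pause_le hL _ _).trans_lt hEδ)⟩
  have hm := monotone_pause (p := p) hL
  refine ⟨fun i hi => ⟨hm.mapsTo_uIcc (hE.1 i hi).1, hm.mapsTo_uIcc (hE.1 i hi).2⟩, ?_⟩
  intro i hi j hj hij
  have h1 := hE.2 hi hj hij
  simp only [Function.onFun, Set.uIoc, Set.Ioc_disjoint_Ioc, ← hm.map_min, ← hm.map_max] at h1 ⊢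
  exact hm h1

end pause

section insertion

/-- The function `u`, stopped at `p` for a time `L`, scaled by `k` and corrected by `q`. -/
noncomputable def insertAt (p L k : ℝ) (u q : ℝ → ℝ) (t : ℝ) : ℝ := k * u (pause p L t) + q t

variable {p L k : ℝ} {u q : ℝ → ℝ} {K : ℝ≥0}

theorem deriv_insertAt_of_lt {q₀ : ℝ} (hq : ∀ t ≤ p, q t = q₀) {t : ℝ} (ht : t < p) :
    deriv (insertAt p L k u q) t = k * deriv u t := by
  have : insertAt p L k u q =ᶠ[𝓝 t] fun t => k * u t + q₀ := by
    filter_upwards [Iio_mem_nhds ht] with x hx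
    rw [insertAt, pause_of_le (le_of_lt hx), hq x (le_of_lt hx)]
  rw [this.deriv_eq, deriv_add_const, deriv_const_mul_field]

theorem deriv_insertAt_of_gt {q₁ : ℝ} (hL : 0 ≤ L) (hq : ∀ t, p + L ≤ t → q t = q₁) {t : ℝ}
    (ht : p + L < t) : deriv (insertAt p L k u q) t = k * deriv u (t - L) := by
  have : insertAt p L k u q =ᶠ[𝓝 t] fun t => k * u (t - L) + q₁ := by
    filter_upwards [Ioi_mem_nhds ht] with x hx
    rw [insertAt, pause_of_ge hL (le_of_lt hx), hq x (le_of_lt hx)]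
  rw [this.deriv_eq, deriv_add_const, deriv_const_mul_field, deriv_comp_sub_const]

theorem deriv_insertAt_of_mem {t : ℝ} (ht : t ∈ Set.Ioo p (p + L)) :
    deriv (insertAt p L k u q) t = deriv q t := by
  have : insertAt p L k u q =ᶠ[𝓝 t] fun t => k * u p + q t := by
    filter_upwards [Ioo_mem_nhds ht.1 ht.2] with x hx
    rw [insertAt, pause_of_mem ⟨hx.1.le, hx.2.le⟩]
  rw [this.deriv_eq, deriv_const_add]

theorem ae_ne (a : ℝ) : ∀ᵐ t : ℝ, t ≠ a := by
  filter_upwards [(Set.countable_singleton a).ae_notMem volume] with t ht using ht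

theorem deriv_insertAt_ae {q₀ q₁ : ℝ} (hL : 0 ≤ L) (hq₀ : ∀ t ≤ p, q t = q₀)
    (hq₁ : ∀ t, p + L ≤ t → q t = q₁) (F : ℝ → ℝ) :
    (fun t => F (deriv (insertAt p L k u q) t)) =ᵐ[volume] fun t =>
      (Set.Iio p).indicator (fun t => F (k * deriv u t)) t
        + ((Set.Ioi (p + L)).indicator (fun t => F (k * deriv u (t - L))) t
        + (Set.Ioo p (p + L)).indicator (fun t => F (deriv q t)) t) := by
  filter_upwards [ae_ne p, ae_ne (p + L)] with t h1 h2
  rcases lt_or_gt_of_ne h1 with h | h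
  · rw [Set.indicator_of_mem (show t ∈ Set.Iio p from h), Set.indicator_of_notMem (by
      simp only [Set.mem_Ioi, not_lt]; linarith), Set.indicator_of_notMem (by
      simp only [Set.mem_Ioo, not_and]; intro h3; linarith), deriv_insertAt_of_lt hq₀ h]
    simp
  rcases lt_or_gt_of_ne h2 with h' | h'
  · rw [Set.indicator_of_notMem (by simp only [Set.mem_Iio, not_lt]; linarith),
      Set.indicator_of_notMem (by simp only [Set.mem_Ioi, not_lt]; linarith),
      Set.indicator_of_mem (show t ∈ Set.Ioo p (p + L) from ⟨h, h'⟩),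
      deriv_insertAt_of_mem ⟨h, h'⟩]
    simp
  · rw [Set.indicator_of_notMem (by simp only [Set.mem_Iio, not_lt]; linarith),
      Set.indicator_of_mem (show t ∈ Set.Ioi (p + L) from h'), Set.indicator_of_notMem (by
      simp only [Set.mem_Ioo, not_and, not_lt]; intro _; linarith), deriv_insertAt_of_gt hL hq₁ h']
    simp

theorem _root_.LipschitzWith.abs_deriv_le (hq : LipschitzWith K q) (t : ℝ) : |deriv q t| ≤ K := by
  simpa using norm_deriv_le_of_lipschitz hq (x₀ := t)

theorem integrableOn_of_abs_le_of_measurable {w : ℝ → ℝ} {C a b : ℝ} (hw : Measurable w)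
    (hC : ∀ t, |w t| ≤ C) : IntegrableOn w (Set.Ioo a b) :=
  Measure.integrableOn_of_bounded (M := C) (by simp) hw.aestronglyMeasurable
    (Eventually.of_forall hC)

theorem h1Loc_of_lipschitz (hq : LipschitzWith K q) : H1Loc q := by
  refine ⟨fun a b => hq.lipschitzOnWith.absolutelyContinuousOnInterval, fun x => ?_⟩
  refine ⟨Set.Ioo (x - 1) (x + 1), Ioo_mem_nhds (by linarith) (by linarith), ?_⟩
  refine integrableOn_of_abs_le_of_measurable (C := K ^ 2) ((measurable_deriv q).pow_const 2)
    fun t => ?_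
  rw [abs_pow]
  exact pow_le_pow_left₀ (abs_nonneg _) (hq.abs_deriv_le t) 2

theorem h1Loc_insertAt {q₀ q₁ : ℝ} (hL : 0 ≤ L) (hu : H1Loc u) (hq : LipschitzWith K q)
    (hq₀ : ∀ t ≤ p, q t = q₀) (hq₁ : ∀ t, p + L ≤ t → q t = q₁) :
    H1Loc (insertAt p L k u q) := by
  refine ⟨fun a b => ?_, ?_⟩
  · exact ((absolutelyContinuous_comp_pause hL hu.1 a b).const_mul k).fun_add
      hq.lipschitzOnWith.absolutelyContinuousOnInterval
  · have h1 := hu.2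
    have h2 : LocallyIntegrable (fun t => deriv u (t - L) ^ 2) := by
      have := (locallyIntegrable_map_homeomorph (Homeomorph.subRight L)
        (f := fun t => deriv u t ^ 2) (μ := volume)).1
      rw [Homeomorph.coe_subRight, (measurePreserving_sub_right volume L).map_eq] at this
      exact this h1
    have e := deriv_insertAt_ae (k := k) (u := u) hL hq₀ hq₁ fun x => x ^ 2
    refine LocallyIntegrable.congr ?_ e.symm
    simp only [mul_pow]
    refine ((h1.smul (k ^ 2)).indicator measurableSet_Iio).add
      (((h2.smul (k ^ 2)).indicator measurableSet_Ioi).add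
        (((h1Loc_of_lipschitz hq).2).indicator measurableSet_Ioo))

theorem integrable_and_integral_deriv_insertAt {q₀ q₁ : ℝ} (hL : 0 ≤ L)
    (hu : Integrable (deriv u)) (hq : LipschitzWith K q)
    (hq₀ : ∀ t ≤ p, q t = q₀) (hq₁ : ∀ t, p + L ≤ t → q t = q₁) :
    Integrable (deriv (insertAt p L k u q)) ∧
      ∫ t, deriv (insertAt p L k u q) t = k * (∫ t, deriv u t) + (q₁ - q₀) := by
  have e := deriv_insertAt_ae (k := k) (u := u) hL hq₀ hq₁ fun x => x
  have hu2 : Integrable fun t => deriv u (t - L) := hu.comp_sub_right L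
  have h1 : Integrable ((Set.Iio p).indicator fun t => k * deriv u t) :=
    (hu.const_mul k).indicator measurableSet_Iio
  have h2 : Integrable ((Set.Ioi (p + L)).indicator fun t => k * deriv u (t - L)) :=
    (hu2.const_mul k).indicator measurableSet_Ioi
  have h3 : Integrable ((Set.Ioo p (p + L)).indicator fun t => deriv q t) := by
    rw [integrable_indicator_iff measurableSet_Ioo]
    exact integrableOn_of_abs_le_of_measurable (measurable_deriv q) hq.abs_deriv_le
  refine ⟨(h1.add (h2.add h3)).congr e.symm, ?_⟩
  have h4 : ∫ t in Set.Ioo p (p + L), deriv q t = q₁ - q₀ := by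
    have := (hq.lipschitzOnWith (s := Set.uIcc p (p + L))).absolutelyContinuousOnInterval
    have h5 := this.integral_deriv_eq_sub
    rw [intervalIntegral.integral_of_le (by linarith),
      ← Measure.restrict_congr_set Ioo_ae_eq_Ioc, hq₀ p le_rfl, hq₁ _ le_rfl] at h5
    exact h5
  have h6 : ∫ t in Set.Ioi (p + L), deriv u (t - L) = ∫ t in Set.Ioi p, deriv u t := by
    have := (measurePreserving_sub_right volume L).setIntegral_preimage_emb
      (Homeomorph.subRight L).measurableEmbedding (deriv u) (Set.Ioi p)
    rw [← this]
    congr 2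
    ext t
    simp
  have h7 : (∫ t in Set.Iio p, deriv u t) + (∫ t in Set.Ioi p, deriv u t) = ∫ t, deriv u t := by
    rw [← integral_Iic_eq_integral_Iio]
    exact intervalIntegral.integral_Iic_add_Ioi hu.integrableOn hu.integrableOn
  rw [integral_congr_ae e, integral_add (g := fun t => _ + _) h1 (h2.add h3), integral_add h2 h3,
    integral_indicator measurableSet_Iio, integral_indicator measurableSet_Ioi,
    integral_indicator measurableSet_Ioo, integral_const_mul, integral_const_mul, h4, h6, ← h7]
  ring

/-- An integral over `ℝ`, split at the ends of an interval. -/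
theorem lintegral_split (e : ℝ → ℝ≥0∞) {a b : ℝ} (hab : a ≤ b) :
    ∫⁻ t, e t =
      (∫⁻ t in Set.Iio a, e t) + (∫⁻ t in Set.Ioo a b, e t) + ∫⁻ t in Set.Ioi b, e t := by
  have hd : Disjoint (Set.Iio a) (Set.Icc a b) :=
    Set.disjoint_left.2 fun x hx hx' => not_lt.2 hx'.1 hx
  rw [← lintegral_add_compl e (measurableSet_Iic (a := b)), Set.compl_Iic]
  congr 1
  rw [← Set.Iio_union_Icc_eq_Iic hab, lintegral_union measurableSet_Icc hd,
    Measure.restrict_congr_set Ioo_ae_eq_Icc]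

theorem setLIntegral_Ioo_le {e : ℝ → ℝ≥0∞} {a b C : ℝ} (hC : 0 ≤ C)
    (he : ∀ t ∈ Set.Ioo a b, e t ≤ ENNReal.ofReal C) :
    ∫⁻ t in Set.Ioo a b, e t ≤ ENNReal.ofReal (C * (b - a)) := by
  refine (setLIntegral_mono' measurableSet_Ioo he).trans (le_of_eq ?_)
  rw [setLIntegral_const, Real.volume_Ioo, ENNReal.ofReal_mul hC]

end insertion

end Cohesive

/-! ### Insertion of a plateau into a profile -/

namespace Cohesive

variable {f α β : ℝ → ℝ} {ℓ ℓ₁ : ℝ}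

/-- The integrand of `energy`. -/
noncomputable def density (f : ℝ → ℝ) (s : ℝ≥0) (α β : ℝ → ℝ) (t : ℝ) : ℝ≥0∞ :=
  (s : ℝ≥0∞) ^ 2 * fExt f (β t) ^ 2 * ENNReal.ofReal (|deriv α t| ^ 2)
    + ENNReal.ofReal ((1 - β t) ^ 2 / 4 + |deriv β t| ^ 2)

theorem energy_eq_lintegral_density (s : ℝ≥0) : energy f s α β = ∫⁻ t, density f s α β t := rfl

theorem density_eq_of_deriv_eq_mul {s s' k : ℝ≥0} (hs : s' * k = s) {α' β' : ℝ → ℝ} {t t' : ℝ}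
    (hα : deriv α' t' = k * deriv α t) (hβ : β' t' = β t) (hβ' : deriv β' t' = deriv β t) :
    density f s' α' β' t' = density f s α β t := by
  rw [density, density, hα, hβ, hβ', abs_mul, mul_pow, ENNReal.ofReal_mul (by positivity),
    NNReal.abs_eq, ← hs, ENNReal.ofReal_pow k.coe_nonneg, ENNReal.ofReal_coe_nnreal]
  push_cast
  ring

theorem density_of_deriv_eq_zero {s : ℝ≥0} {t : ℝ} (hα : deriv α t = 0) :
    density f s α β t = ENNReal.ofReal ((1 - β t) ^ 2 / 4 + |deriv β t| ^ 2) := by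
  simp [density, hα]

theorem density_of_lt {s : ℝ≥0} {t : ℝ} (hβ : β t < 1) (hF : 0 ≤ f (β t)) :
    density f s α β t = ENNReal.ofReal (s ^ 2 * f (β t) ^ 2 * deriv α t ^ 2
      + ((1 - β t) ^ 2 / 4 + deriv β t ^ 2)) := by
  rw [density, fExt, if_pos hβ, ← ENNReal.ofReal_coe_nnreal, ← ENNReal.ofReal_pow (by positivity),
    ← ENNReal.ofReal_pow hF, ← ENNReal.ofReal_mul (by positivity),
    ← ENNReal.ofReal_mul (by positivity), ← ENNReal.ofReal_add (by positivity) (by positivity),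
    sq_abs, sq_abs]

/-- The ramp that rises from `0` to `r` on `[p, p + r]`, stays there for a time `L` and returns. -/
noncomputable def ramp (p r L t : ℝ) : ℝ := max 0 (min (min (t - p) (p + (2 * r + L) - t)) r)

theorem lipschitz_ramp (p r L : ℝ) : LipschitzWith 1 (ramp p r L) := by
  have h1 : LipschitzWith 1 fun t : ℝ => t - p := by
    refine LipschitzWith.of_dist_le_mul fun x y => ?_
    simp [Real.dist_eq]
  have h2 : LipschitzWith 1 fun t : ℝ => p + (2 * r + L) - t := by
    refine LipschitzWith.of_dist_le_mul fun x y => ?_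
    rw [Real.dist_eq, Real.dist_eq, abs_sub_comm]
    simp
  have h3 := ((h1.min h2).min (LipschitzWith.const r (α := ℝ))).max_const 0
  simp only [max_self, zero_le, max_eq_left, max_comm] at h3
  exact h3

/-- The function that rises linearly from `0` to `1` on `[p, p + L]`. -/
noncomputable def step (p L t : ℝ) : ℝ := L⁻¹ * max 0 (min (t - p) L)

theorem lipschitz_step {p L : ℝ} (hL : 0 < L) : LipschitzWith L⁻¹.toNNReal (step p L) := by
  refine LipschitzWith.of_dist_le_mul fun x y => ?_
  have h1 : LipschitzWith 1 fun t : ℝ => t - p := by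
    refine LipschitzWith.of_dist_le_mul fun x y => ?_
    simp [Real.dist_eq]
  have h3 := ((h1.min (LipschitzWith.const L (α := ℝ))).max_const 0).dist_le_mul x y
  have e : ∀ t, step p L t = L⁻¹ * max (min (t - p) L) 0 := fun t => by rw [step, max_comm]
  rw [Real.dist_eq, e, e, ← mul_sub, abs_mul, abs_of_pos (inv_pos.2 hL),
    Real.coe_toNNReal _ (inv_pos.2 hL).le]
  refine mul_le_mul_of_nonneg_left ?_ (by positivity)
  simpa [Real.dist_eq] using h3

theorem step_of_le {p L t : ℝ} (h : t ≤ p) : step p L t = 0 := by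
  rw [step, max_eq_left ((min_le_left _ _).trans (by linarith)), mul_zero]

theorem step_of_ge {p L t : ℝ} (hL : 0 < L) (h : p + L ≤ t) : step p L t = 1 := by
  rw [step, min_eq_right (by linarith), max_eq_right hL.le, inv_mul_cancel₀ hL.ne']

theorem deriv_step_of_notMem {p L t : ℝ} (hL : 0 < L) (h : t ∉ Set.Icc p (p + L)) :
    deriv (step p L) t = 0 := by
  by_cases h1 : t < p
  · have : step p L =ᶠ[𝓝 t] fun _ => 0 := by
      filter_upwards [Iio_mem_nhds h1] with x hx using step_of_le (le_of_lt hx)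
    rw [this.deriv_eq, deriv_const]
  · have h2 : p + L < t := by
      by_contra! hc
      exact h ⟨not_lt.1 h1, hc⟩
    have : step p L =ᶠ[𝓝 t] fun _ => 1 := by
      filter_upwards [Ioi_mem_nhds h2] with x hx using step_of_ge hL (le_of_lt hx)
    rw [this.deriv_eq, deriv_const]

theorem deriv_step_of_mem {p L t : ℝ} (h : t ∈ Set.Ioo p (p + L)) :
    deriv (step p L) t = L⁻¹ := by
  have : step p L =ᶠ[𝓝 t] fun x => L⁻¹ * (x - p) := by
    filter_upwards [Ioo_mem_nhds h.1 h.2] with x hx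
    rw [step, min_eq_left (by linarith [hx.2]), max_eq_right (by linarith [hx.1])]
  rw [this.deriv_eq, deriv_const_mul_field]
  simp

theorem ramp_of_le {p r L t : ℝ} (h : t ≤ p) : ramp p r L t = 0 :=
  max_eq_left ((min_le_left _ _).trans ((min_le_left _ _).trans (by linarith)))

theorem ramp_of_ge {p r L t : ℝ} (h : p + (2 * r + L) ≤ t) : ramp p r L t = 0 :=
  max_eq_left ((min_le_left _ _).trans ((min_le_right _ _).trans (by linarith)))

theorem ramp_mem {p r L : ℝ} (hr : 0 ≤ r) (t : ℝ) : ramp p r L t ∈ Set.Icc 0 r :=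
  ⟨le_max_left _ _, max_le hr (min_le_right _ _)⟩

theorem ramp_of_mem {p r L t : ℝ} (hr : 0 ≤ r) (h : t ∈ Set.Icc (p + r) (p + r + L)) :
    ramp p r L t = r := by
  rw [ramp, min_eq_right (le_min (by linarith [h.1]) (by linarith [h.2])), max_eq_right hr]

theorem deriv_ramp_of_mem {p r L t : ℝ} (hr : 0 ≤ r) (h : t ∈ Set.Ioo (p + r) (p + r + L)) :
    deriv (ramp p r L) t = 0 := by
  have : ramp p r L =ᶠ[𝓝 t] fun _ => r := by
    filter_upwards [Ioo_mem_nhds h.1 h.2] with x hx using ramp_of_mem hr ⟨hx.1.le, hx.2.le⟩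
  rw [this.deriv_eq, deriv_const]

/-- The cost of a plateau of length `L = 2 a + 4 ε`, where `a` is close to the optimal choice. -/
theorem plateau_cost_le {a M L ε : ℝ} (ha : 0 ≤ a) (hM : 0 < M) (hM1 : M ≤ 1) (hε : 0 < ε)
    (hL : L = 2 * a + 4 * ε) : ((a * M / L) ^ 2 + M ^ 2 / 4) * L ≤ M ^ 2 * a + ε := by
  have hL0 : 0 < L := by rw [hL]; positivity
  have e1 : ((a * M / L) ^ 2 + M ^ 2 / 4) * L = M ^ 2 * (a ^ 2 / L + L / 4) := by
    field_simp
  have e2 : a ^ 2 / L ≤ a / 2 := by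
    rw [div_le_div_iff₀ hL0 two_pos]; nlinarith
  have e3 : M ^ 2 * (a ^ 2 / L + L / 4) ≤ M ^ 2 * (a + ε) :=
    mul_le_mul_of_nonneg_left (by rw [hL] at e2 ⊢; linarith) (sq_nonneg M)
  have e4 : M ^ 2 * ε ≤ 1 * ε := mul_le_mul_of_nonneg_right (by nlinarith) hε.le
  rw [e1]
  linarith

/-- The cost of an inserted interval with two ramps of length `r` and a plateau of length `L`. -/
theorem setLIntegral_ramps_le {e : ℝ → ℝ≥0∞} {p r L C : ℝ} (hr : 0 ≤ r) (hL : 0 < L)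
    (hC : 0 ≤ C) (h1 : ∀ t ∈ Set.Ioo p (p + (2 * r + L)), t ∉ Set.Icc (p + r) (p + r + L) →
      e t ≤ ENNReal.ofReal (5 / 4))
    (h2 : ∀ t ∈ Set.Ioo (p + r) (p + r + L), e t ≤ ENNReal.ofReal C) :
    ∫⁻ t in Set.Ioo p (p + (2 * r + L)), e t ≤ ENNReal.ofReal (5 / 2 * r + C * L) := by
  have hsub : Set.Ioo p (p + (2 * r + L)) =ᵐ[volume]
      (Set.Ioo p (p + r) ∪ (Set.Ioo (p + r) (p + r + L) ∪
        Set.Ioo (p + r + L) (p + (2 * r + L))) : Set ℝ) := by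
    filter_upwards [ae_ne (p + r), ae_ne (p + r + L)] with t h1 h2
    refine propext ⟨fun ht => ?_, ?_⟩
    · rcases lt_or_gt_of_ne h1 with h3 | h3
      · exact Or.inl ⟨ht.1, h3⟩
      rcases lt_or_gt_of_ne h2 with h4 | h4
      · exact Or.inr (Or.inl ⟨h3, h4⟩)
      · exact Or.inr (Or.inr ⟨h4, ht.2⟩)
    · rintro (ht | ht | ht)
      · exact ⟨ht.1, by linarith [ht.2]⟩
      · exact ⟨by linarith [ht.1], by linarith [ht.2]⟩
      · exact ⟨by linarith [ht.1], ht.2⟩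
  rw [Measure.restrict_congr_set hsub]
  refine (lintegral_union_le _ _ _).trans ?_
  have i1 := setLIntegral_Ioo_le (a := p) (b := p + r) (C := 5 / 4) (by norm_num) fun t ht =>
    h1 t ⟨ht.1, by linarith [ht.2]⟩ fun hc => by linarith [ht.2, hc.1]
  have i2 := setLIntegral_Ioo_le hC h2
  have i3 := setLIntegral_Ioo_le (a := p + r + L) (b := p + (2 * r + L)) (C := 5 / 4)
    (by norm_num) fun t ht => h1 t ⟨by linarith [ht.1], ht.2⟩ fun hc => by linarith [ht.1, hc.2]
  rw [show p + r - p = r by ring] at i1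
  rw [show p + r + L - (p + r) = L by ring] at i2
  rw [show p + (2 * r + L) - (p + r + L) = r by ring] at i3
  refine (add_le_add i1 ((lintegral_union_le _ _ _).trans (add_le_add i2 i3))).trans ?_
  rw [← ENNReal.ofReal_add (by positivity) (by positivity),
    ← ENNReal.ofReal_add (by positivity) (by positivity)]
  exact ENNReal.ofReal_le_ofReal (le_of_eq (by ring))

/-- Insertion of a plateau into a profile. At the position `t₀` the damage is increased by `r`, and
then an additional opening `s₁` is realized at constant damage. The ramps cost at most `5 / 2 * r`,
and the plateau of the optimal length `2 s₁ f / (1 - β)` costs `s₁` times the stress there; `ε`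
keeps this length positive. -/
theorem Admissible.exists_insert (hf : Potential f ℓ ℓ₁) (h : Admissible α β) {t₀ r ε : ℝ}
    (hr : 0 ≤ r) (hrβ : r ≤ β t₀) (hpos : 0 < 1 - β t₀ + r) (s₁ s₂ : ℝ≥0) (hε : 0 < ε) :
    ∃ α' β', Admissible α' β' ∧ (∃ t, β' t = β t₀ - r) ∧ energy f (s₁ + s₂) α' β' ≤
      energy f s₂ α β
        + ENNReal.ofReal (5 / 2 * r + s₁ * stress f ℓ ((1 - β t₀ + r) ^ 2) + ε) := by
  set b := β t₀ - r with hb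
  set M := 1 - β t₀ + r with hM
  have hbM : 1 - b = M := by rw [hb, hM]; ring
  have hb0 : 0 ≤ b := by linarith
  have hb1 : b < 1 := by linarith
  have hM1 : M ≤ 1 := by linarith
  have hF : 0 ≤ f b := hf.nonneg b ⟨hb0, hb1⟩
  have hφ : stress f ℓ (M ^ 2) = M * f b := by rw [stress_sq hpos, ← hbM, sub_sub_cancel]
  -- the length of the plateau and the share of the opening that it takes
  set a : ℝ := s₁ * f b / M with ha
  have ha0 : 0 ≤ a := by positivity
  set L : ℝ := 2 * a + 4 * ε with hL
  have hL0 : 0 < L := by positivity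
  set θ : ℝ≥0 := s₁ / (s₁ + s₂) with hθ
  set k : ℝ≥0 := 1 - θ with hk
  have hθ1 : θ ≤ 1 := div_le_one_of_le₀ (by simp) (by simp)
  have hkθ : (k : ℝ) = 1 - θ := by rw [hk, NNReal.coe_sub hθ1]; simp
  have hθs : (s₁ + s₂) * θ = s₁ := by
    rcases eq_or_ne (s₁ + s₂) 0 with h0 | h0
    · rw [h0, (add_eq_zero.1 h0).1, zero_mul]
    · rw [hθ, mul_div_cancel₀ _ h0]
  have hks : (s₁ + s₂) * k = s₂ := by
    rw [hk, mul_tsub, mul_one, hθs, add_tsub_cancel_left]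
  set σ : ℝ := ∫ t, deriv α t with hσ
  have hσ1 : |σ| = 1 := h.abs_integral_deriv
  set T : ℝ := 2 * r + L with hT
  have hT0 : 0 ≤ T := by positivity
  set qα : ℝ → ℝ := fun t => θ * σ * step (t₀ + r) L t with hqα
  set qβ : ℝ → ℝ := fun t => -ramp t₀ r L t with hqβ
  have hqα_lip : LipschitzWith (Real.nnabs (θ * σ) * L⁻¹.toNNReal) qα := by
    refine LipschitzWith.of_dist_le_mul fun x y => ?_
    have := (lipschitz_step (p := t₀ + r) hL0).dist_le_mul x y
    simp only [hqα, Real.dist_eq, ← mul_sub, abs_mul (θ * σ : ℝ)] at this ⊢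
    rw [NNReal.coe_mul, Real.coe_nnabs, mul_assoc]
    exact mul_le_mul_of_nonneg_left this (abs_nonneg _)
  have hqβ_lip : LipschitzWith 1 qβ := (lipschitz_ramp t₀ r L).neg
  have hqα0 : ∀ t ≤ t₀, qα t = 0 := fun t ht => by
    simp only [hqα, step_of_le (show t ≤ t₀ + r by linarith), mul_zero]
  have hqα1 : ∀ t, t₀ + T ≤ t → qα t = θ * σ := fun t ht => by
    simp only [hqα, step_of_ge hL0 (show t₀ + r + L ≤ t by linarith), mul_one]
  have hqβ0 : ∀ t ≤ t₀, qβ t = 0 := fun t ht => by simp only [hqβ, ramp_of_le ht, neg_zero]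
  have hqβ1 : ∀ t, t₀ + T ≤ t → qβ t = 0 := fun t ht => by
    simp only [hqβ, ramp_of_ge ht, neg_zero]
  have hqβ_mem : ∀ t, qβ t ∈ Set.Icc (-r) 0 := fun t =>
    ⟨neg_le_neg (ramp_mem hr t).2, neg_nonpos.2 (ramp_mem hr t).1⟩
  set α' := insertAt t₀ T k α qα with hα'
  set β' := insertAt t₀ T 1 β qβ with hβ'
  have hβ'lt : ∀ t ≤ t₀, β' t = β t := fun t ht => by
    rw [hβ', insertAt, pause_of_le ht, hqβ0 t ht]; ring
  have hβ'gt : ∀ t, t₀ + T ≤ t → β' t = β (t - T) := fun t ht => by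
    rw [hβ', insertAt, pause_of_ge hT0 ht, hqβ1 t ht]; ring
  have hβ'mid : ∀ t ∈ Set.Icc t₀ (t₀ + T), β' t = β t₀ + qβ t := fun t ht => by
    rw [hβ', insertAt, pause_of_mem ht]; ring
  have hβ'mem : ∀ t, β' t ∈ Set.Icc (0 : ℝ) 1 := by
    intro t
    rcases le_total t t₀ with h1 | h1
    · rw [hβ'lt t h1]; exact h.mem_Icc t
    rcases le_total (t₀ + T) t with h2 | h2
    · rw [hβ'gt t h2]; exact h.mem_Icc _
    · rw [hβ'mid t ⟨h1, h2⟩]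
      exact ⟨by linarith [(hqβ_mem t).1], by linarith [(hqβ_mem t).2, (h.mem_Icc t₀).2]⟩
  obtain ⟨hint, htot⟩ := integrable_and_integral_deriv_insertAt (k := (k : ℝ)) hT0
    h.integrable_deriv hqα_lip hqα0 hqα1
  have hadm : Admissible α' β' := by
    refine ⟨h1Loc_insertAt hT0 h.h1_left hqα_lip hqα0 hqα1,
      h1Loc_insertAt hT0 h.h1_right hqβ_lip hqβ0 hqβ1, hint, ?_, hβ'mem, ?_, ?_⟩
    · rw [htot, ← hσ, hkθ]
      have : (1 - (θ : ℝ)) * σ + (θ * σ - 0) = σ := by ring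
      rw [this, hσ1]
    · have h1 : Tendsto (fun t : ℝ => t - T) atTop atTop :=
        tendsto_atTop_add_const_right _ (-T) tendsto_id
      refine (h.tendsto_atTop.comp h1).congr' ?_
      filter_upwards [eventually_ge_atTop (t₀ + T)] with t ht using (hβ'gt t ht).symm
    · refine h.tendsto_atBot.congr' ?_
      filter_upwards [eventually_le_atBot t₀] with t ht using (hβ'lt t ht).symm
  have hqα_deriv : ∀ t, deriv qα t = θ * σ * deriv (step (t₀ + r) L) t := fun t => by
    simp only [hqα, deriv_const_mul_field]
  have hqβ_plateau : ∀ t ∈ Set.Icc (t₀ + r) (t₀ + r + L), qβ t = -r := fun t ht => by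
    simp only [hqβ, ramp_of_mem hr ht]
  have hmem_t : t₀ + r ∈ Set.Icc t₀ (t₀ + T) := ⟨by linarith, by linarith⟩
  refine ⟨α', β', hadm, ⟨t₀ + r, ?_⟩, ?_⟩
  · rw [hβ'mid _ hmem_t, hqβ_plateau _ ⟨le_rfl, by linarith⟩]; ring
  -- outside the inserted interval the density is that of the given profile
  have hleft : ∫⁻ t in Set.Iio t₀, density f (s₁ + s₂) α' β' t
      = ∫⁻ t in Set.Iio t₀, density f s₂ α β t := by
    refine setLIntegral_congr_fun measurableSet_Iio fun t ht => ?_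
    refine density_eq_of_deriv_eq_mul hks (deriv_insertAt_of_lt hqα0 ht)
      (hβ'lt t (le_of_lt ht)) ?_
    rw [hβ', deriv_insertAt_of_lt hqβ0 ht, one_mul]
  have hright : ∫⁻ t in Set.Ioi (t₀ + T), density f (s₁ + s₂) α' β' t
      = ∫⁻ t in Set.Ioi t₀, density f s₂ α β t := by
    have h1 := (measurePreserving_sub_right volume T).setLIntegral_comp_preimage_emb
      (Homeomorph.subRight T).measurableEmbedding (fun t => density f s₂ α β t) (Set.Ioi t₀)
    have h2 : (fun x => x - T) ⁻¹' Set.Ioi t₀ = Set.Ioi (t₀ + T) := by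
      ext t; simp
    rw [h2] at h1
    rw [← h1]
    refine setLIntegral_congr_fun measurableSet_Ioi fun t ht => ?_
    refine density_eq_of_deriv_eq_mul hks (deriv_insertAt_of_gt hT0 hqα1 ht)
      (hβ'gt t (le_of_lt ht)) ?_
    rw [hβ', deriv_insertAt_of_gt hT0 hqβ1 ht, one_mul]
  have hramp : ∀ t ∈ Set.Ioo t₀ (t₀ + T), t ∉ Set.Icc (t₀ + r) (t₀ + r + L) →
      density f (s₁ + s₂) α' β' t ≤ ENNReal.ofReal (5 / 4) := by
    intro t ht htn
    rw [density_of_deriv_eq_zero (by rw [hα', deriv_insertAt_of_mem ht, hqα_deriv,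
      deriv_step_of_notMem hL0 htn, mul_zero])]
    refine ENNReal.ofReal_le_ofReal ?_
    have h1 := hβ'mem t
    have h2 : |deriv β' t| ≤ 1 := by
      rw [hβ', deriv_insertAt_of_mem ht]
      simpa using hqβ_lip.abs_deriv_le t
    nlinarith [abs_nonneg (deriv β' t), h1.1, h1.2]
  have hplateau : ∀ t ∈ Set.Ioo (t₀ + r) (t₀ + r + L),
      density f (s₁ + s₂) α' β' t ≤ ENNReal.ofReal ((a * M / L) ^ 2 + M ^ 2 / 4) := by
    intro t ht
    have htm : t ∈ Set.Ioo t₀ (t₀ + T) := ⟨by linarith [ht.1], by linarith [ht.2]⟩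
    have h1 : β' t = b := by
      rw [hβ'mid t ⟨htm.1.le, htm.2.le⟩, hqβ_plateau t ⟨ht.1.le, ht.2.le⟩]; ring
    rw [density_of_lt (by rw [h1]; exact hb1) (by rw [h1]; exact hF), h1]
    refine ENNReal.ofReal_le_ofReal (le_of_eq ?_)
    rw [hα', hβ', deriv_insertAt_of_mem htm, deriv_insertAt_of_mem htm, hqα_deriv,
      deriv_step_of_mem ht, show deriv qβ t = 0 by
        rw [hqβ, deriv.fun_neg, deriv_ramp_of_mem hr ht, neg_zero], hbM]
    have h2 : ((s₁ + s₂ : ℝ≥0) : ℝ) * θ = s₁ := by exact_mod_cast hθs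
    have h4 : s₁ * f b = a * M := by rw [ha]; field_simp
    have h3 : σ ^ 2 = 1 := by rw [← sq_abs, hσ1]; norm_num
    have e : ((s₁ + s₂ : ℝ≥0) : ℝ) ^ 2 * f b ^ 2 * (θ * σ * L⁻¹) ^ 2
        = (((s₁ + s₂ : ℝ≥0) : ℝ) * θ * f b / L) ^ 2 * σ ^ 2 := by
      field_simp
    rw [e, h2, h3, h4]
    ring
  have hmid : ∫⁻ t in Set.Ioo t₀ (t₀ + T), density f (s₁ + s₂) α' β' t
      ≤ ENNReal.ofReal (5 / 2 * r + s₁ * stress f ℓ (M ^ 2) + ε) := by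
    refine (setLIntegral_ramps_le hr hL0 (by positivity) hramp hplateau).trans
      (ENNReal.ofReal_le_ofReal ?_)
    have e1 := plateau_cost_le ha0 hpos hM1 hε hL
    have e2 : s₁ * stress f ℓ (M ^ 2) = M ^ 2 * a := by rw [hφ, ha]; field_simp
    rw [e2]
    linarith
  rw [energy_eq_lintegral_density, energy_eq_lintegral_density,
    lintegral_split _ (show t₀ ≤ t₀ + T by linarith), lintegral_split _ (le_refl t₀), hleft, hright]
  simp only [Set.Ioo_self, Measure.restrict_empty, lintegral_zero_measure, add_zero]
  rw [add_right_comm]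
  exact add_le_add le_rfl hmid

end Cohesive

/-! ### Complete fracture and the undamaged profile -/

namespace Cohesive

theorem Admissible.of_lipschitz {β : ℝ → ℝ} {K : ℝ≥0} (hβ : LipschitzWith K β)
    (hm : ∀ t, β t ∈ Set.Icc (0 : ℝ) 1) (h1 : Tendsto β atTop (𝓝 1))
    (h2 : Tendsto β atBot (𝓝 1)) : Admissible (step 0 1) β := by
  have hl : LipschitzWith _ (step 0 1) := lipschitz_step one_pos
  have hI := integrable_and_integral_deriv_insertAt (p := 0) (k := 0) (u := fun _ => (0 : ℝ))
    zero_le_one (by simp) hl (q₀ := 0) (q₁ := 1) (fun t ht => step_of_le ht)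
    fun t ht => step_of_ge one_pos ht
  have e : insertAt 0 1 0 (fun _ => (0 : ℝ)) (step 0 1) = step 0 1 := by
    ext t; simp [insertAt]
  rw [e] at hI
  exact ⟨h1Loc_of_lipschitz hl, h1Loc_of_lipschitz hβ, hI.1, by rw [hI.2]; simp, hm, h1, h2⟩

/-- The profile `1 - exp(-|t| / 2)` of complete fracture. -/
noncomputable def fractureProfile (t : ℝ) : ℝ := 1 - Real.exp (-|t| / 2)

theorem isLeast_range_fractureProfile : IsLeast (Set.range fractureProfile) 0 := by
  refine ⟨⟨0, by simp [fractureProfile]⟩, ?_⟩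
  rintro _ ⟨t, rfl⟩
  have : Real.exp (-|t| / 2) ≤ 1 := Real.exp_le_one_iff.2 (by linarith [abs_nonneg t])
  simpa [fractureProfile] using this

theorem fractureProfile_zero : fractureProfile 0 = 0 := by simp [fractureProfile]

theorem lipschitz_fractureProfile : LipschitzWith 1 fractureProfile := by
  refine LipschitzWith.of_dist_le_mul fun x y => ?_
  rw [NNReal.coe_one, one_mul, Real.dist_eq, Real.dist_eq]
  have key : ∀ a b : ℝ, fractureProfile b - fractureProfile a ≤ |b - a| := fun a b => by
    rcases le_total |b| |a| with h | h
    · have : Real.exp (-|a| / 2) ≤ Real.exp (-|b| / 2) := Real.exp_le_exp.2 (by linarith)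
      have := abs_nonneg (b - a)
      unfold fractureProfile; linarith
    · have h1 := Real.add_one_le_exp ((|a| - |b|) / 2)
      have h2 : Real.exp (-|a| / 2) ≤ 1 := Real.exp_le_one_iff.2 (by linarith [abs_nonneg a])
      have h3 : Real.exp (-|b| / 2) = Real.exp (-|a| / 2) * Real.exp ((|a| - |b|) / 2) := by
        rw [← Real.exp_add]; congr 1; ring
      have h4 := abs_sub_abs_le_abs_sub b a
      have h5 := Real.exp_pos (-|a| / 2)
      unfold fractureProfile
      nlinarith
  rw [abs_sub_le_iff]
  exact ⟨key y x, by rw [abs_sub_comm]; exact key x y⟩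

theorem admissible_fractureProfile : Admissible (step 0 1) fractureProfile := by
  refine .of_lipschitz lipschitz_fractureProfile (fun t => ⟨isLeast_range_fractureProfile.2 ⟨t, rfl⟩,
    by simpa [fractureProfile] using (Real.exp_pos _).le⟩) ?_ ?_
  all_goals
    have h0 : Tendsto (fun x : ℝ => 1 - Real.exp (-x / 2)) atTop (𝓝 (1 - 0)) := by
      refine tendsto_const_nhds.sub (Real.tendsto_exp_atBot.comp ?_)
      exact tendsto_neg_atTop_atBot.atBot_div_const two_pos
    rw [sub_zero] at h0
  · exact h0.comp tendsto_abs_atTop_atTop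
  · exact h0.comp tendsto_abs_atBot_atTop

theorem hasDerivAt_fractureProfile {t : ℝ} (ht : t ≠ 0) :
    HasDerivAt fractureProfile (Real.exp (-|t| / 2) * (SignType.sign t / 2)) t := by
  have h := (((hasDerivAt_abs ht).fun_neg.div_const 2).exp).const_sub 1
  refine HasDerivAt.congr_deriv (f := fractureProfile) h ?_
  ring

/-- The damage energy of complete fracture is at most `1`: the integrand is `exp(-|t|) / 2`. -/
theorem energy_fractureProfile_le (f : ℝ → ℝ) :
    energy f 0 (step 0 1) fractureProfile ≤ 1 := by
  have hI : ∫ t : ℝ, Real.exp (-|t|) = 2 := by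
    rw [integral_comp_abs (f := fun x => Real.exp (-x)), integral_exp_neg_Ioi_zero, mul_one]
  have hint : Integrable fun t : ℝ => Real.exp (-|t|) := by
    by_contra hc
    rw [integral_undef hc] at hI
    norm_num at hI
  have e : energy f 0 (step 0 1) fractureProfile
      = ∫⁻ t : ℝ, ENNReal.ofReal (Real.exp (-|t|) / 2) := by
    refine lintegral_congr_ae ?_
    filter_upwards [ae_ne 0] with t ht
    have h1 : Real.exp (-|t|) = Real.exp (-|t| / 2) ^ 2 := by
      rw [← Real.exp_nat_mul]; congr 1; push_cast; ring
    have h2 : ((SignType.sign t : SignType) : ℝ) ^ 2 = 1 := by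
      rcases lt_or_gt_of_ne ht with h | h
      · simp [sign_neg h]
      · simp [sign_pos h]
    rw [(hasDerivAt_fractureProfile ht).deriv]
    simp only [ENNReal.coe_zero, ne_eq, OfNat.ofNat_ne_zero, not_false_eq_true, zero_pow, zero_mul,
      zero_add]
    congr 1
    rw [sq_abs, mul_pow, div_pow, h2, h1, fractureProfile]
    ring
  rw [e, ← ofReal_integral_eq_lintegral_ofReal (hint.div_const 2)
    (Eventually.of_forall fun t => by positivity), integral_div, hI]
  simp

/-- The undamaged profile is admissible and costs nothing at the opening `0`. -/
theorem admissible_one : Admissible (step 0 1) fun _ => 1 :=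
  .of_lipschitz (LipschitzWith.const 1) (fun _ => by simp) tendsto_const_nhds tendsto_const_nhds

theorem energy_zero_one (f : ℝ → ℝ) : energy f 0 (step 0 1) (fun _ => 1) = 0 := by
  simp [energy]

end Cohesive

/-! ### The cohesive energy -/

namespace Cohesive

variable {f α β : ℝ → ℝ} {ℓ ℓ₁ : ℝ}

theorem IsStress.minEnergy_add_le {φ : ℝ → ℝ} (h : IsStress φ ℓ) {s t : ℝ} (hs : 0 ≤ s)
    (ht : 0 ≤ t) : minEnergy φ ℓ (s + t) ≤ minEnergy φ ℓ s + minEnergy φ ℓ t := by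
  rcases hs.eq_or_lt with rfl | hs
  · rw [zero_add, h.minEnergy_zero, zero_add]
  rcases ht.eq_or_lt with rfl | ht
  · rw [add_zero, h.minEnergy_zero, add_zero]
  exact (h.minEnergy_add_lt hs ht).le

/-- The minimum value `1 - √ψ(κ_s)` of the optimal profiles at the opening `s`. -/
noncomputable def minValue (f : ℝ → ℝ) (ℓ s : ℝ) : ℝ :=
  1 - √(stressInv (stress f ℓ) (peak (stress f ℓ) ℓ s))

section minValue

variable (hf : Potential f ℓ ℓ₁)
include hf

theorem Potential.antitone_minValue : Antitone (minValue f ℓ) := fun _ _ hst =>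
  sub_le_sub_left (Real.sqrt_le_sqrt
    (hf.isStress.antitone_inv (hf.isStress.antitone_peak hst))) _

theorem Potential.continuous_minValue : Continuous (minValue f ℓ) :=
  continuous_const.sub (hf.isStress.continuous_inv.comp hf.isStress.continuous_peak).sqrt

theorem Potential.minValue_mem (s : ℝ) : minValue f ℓ s ∈ Set.Icc (0 : ℝ) 1 := by
  have := hf.isStress.inv_mem (peak (stress f ℓ) ℓ s)
  exact ⟨sub_nonneg.2 (Real.sqrt_le_one.2 this.2), by
    simp [minValue]⟩

theorem Potential.minValue_zero : minValue f ℓ 0 = 1 := by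
  rw [minValue, hf.isStress.peak_zero, hf.isStress.inv_ell, Real.sqrt_zero, sub_zero]

theorem Potential.minValue_lt_one {s : ℝ} (hs : 0 < s) : minValue f ℓ s < 1 := by
  have := Real.sqrt_pos.2 (hf.isStress.inv_pos (hf.isStress.peak_lt_ell hs))
  rw [minValue]; linarith

theorem Potential.stress_minValue (s : ℝ) :
    stress f ℓ ((1 - minValue f ℓ s) ^ 2) = peak (stress f ℓ) ℓ s := by
  rw [minValue, sub_sub_cancel, Real.sq_sqrt (hf.isStress.inv_mem _).1,
    hf.isStress.stress_inv (hf.isStress.isPeak s).1]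

theorem Potential.eq_minValue {s m : ℝ} (hm : m ∈ Set.Icc (0 : ℝ) 1)
    (h : stress f ℓ ((1 - m) ^ 2) = peak (stress f ℓ) ℓ s) : m = minValue f ℓ s := by
  rw [minValue, ← h, hf.isStress.inv_stress ⟨sq_nonneg _, by nlinarith [hm.1, hm.2]⟩,
    Real.sqrt_sq (by linarith [hm.2]), sub_sub_cancel]

theorem Potential.stress_mem {m : ℝ} (hm : m ∈ Set.Icc (0 : ℝ) 1) :
    stress f ℓ ((1 - m) ^ 2) ∈ Set.Icc 0 ℓ := by
  have : (1 - m) ^ 2 ∈ Set.Icc (0 : ℝ) 1 := ⟨sq_nonneg _, by nlinarith [hm.1, hm.2]⟩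
  exact ⟨hf.isStress.nonneg this, hf.isStress.le_ell this⟩

/-- The stress decreases along with the minimum value of the profile. -/
theorem Potential.stress_le_stress {m m' : ℝ} (hm : 0 ≤ m) (hmm' : m ≤ m') (hm' : m' ≤ 1) :
    stress f ℓ ((1 - m) ^ 2) ≤ stress f ℓ ((1 - m') ^ 2) :=
  hf.isStress.strictAntiOn.antitoneOn ⟨sq_nonneg _, by nlinarith⟩ ⟨sq_nonneg _, by nlinarith⟩
    (by nlinarith)

end minValue

theorem Admissible.minEnergy_le_energy (hf : Potential f ℓ ℓ₁) (s : ℝ≥0) (h : Admissible α β) :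
    ENNReal.ofReal (minEnergy (stress f ℓ) ℓ s) ≤ energy f s α β := by
  obtain ⟨t₀, ht₀⟩ := h.exists_min
  exact (ENNReal.ofReal_le_ofReal (hf.isStress.minEnergy_le s (hf.stress_mem (h.mem_Icc t₀)))).trans
    (h.le_energy hf s ht₀)

/-- An admissible pair with the minimal energy, including the trivial one for `s = 0`. -/
theorem Potential.exists_minimizer (hf : Potential f ℓ ℓ₁) {s : ℝ≥0}
    (hp : 0 < peak (stress f ℓ) ℓ s) :
    ∃ α β, Admissible α β ∧ energy f s α β = ENNReal.ofReal (minEnergy (stress f ℓ) ℓ s) ∧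
      IsLeast (Set.range β) (minValue f ℓ s) := by
  rcases eq_or_ne s 0 with rfl | hs
  · refine ⟨_, _, admissible_one, ?_, ?_⟩
    · rw [energy_zero_one, NNReal.coe_zero, hf.isStress.minEnergy_zero, ENNReal.ofReal_zero]
    · rw [NNReal.coe_zero, hf.minValue_zero]
      simp
  · exact hf.exists_optimal_profile (pos_iff_ne_zero.2 hs) hp

/-- Complete fracture costs at most `1` at every opening. -/
theorem Potential.exists_fracture (hf : Potential f ℓ ℓ₁) (s : ℝ≥0) {ε : ℝ} (hε : 0 < ε) :
    ∃ α β, Admissible α β ∧ (∃ t, β t = 0) ∧ energy f s α β ≤ 1 + ENNReal.ofReal ε := by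
  obtain ⟨α, β, h, ⟨t, ht⟩, hle⟩ := admissible_fractureProfile.exists_insert hf (t₀ := 0) (r := 0)
    (ε := ε) le_rfl (by rw [fractureProfile_zero]) (by rw [fractureProfile_zero]; norm_num)
    s 0 hε
  refine ⟨α, β, h, ⟨t, by rw [ht, fractureProfile_zero, sub_zero]⟩, ?_⟩
  rw [add_zero] at hle
  refine hle.trans (add_le_add (energy_fractureProfile_le f) (ENNReal.ofReal_le_ofReal ?_))
  rw [fractureProfile_zero]
  norm_num [hf.isStress.one]

theorem Potential.g₀_eq (hf : Potential f ℓ ℓ₁) (s : ℝ≥0) :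
    g₀ f s = ENNReal.ofReal (minEnergy (stress f ℓ) ℓ s) := by
  refine le_antisymm ?_ (le_iInf fun α => le_iInf fun β => le_iInf fun h =>
    h.minEnergy_le_energy hf s)
  by_cases hp : 0 < peak (stress f ℓ) ℓ s
  · obtain ⟨α, β, h, he, -⟩ := hf.exists_minimizer hp
    exact he ▸ iInf_le_of_le α (iInf_le_of_le β (iInf_le _ h))
  · have h1 := not_lt.1 (mt (hf.isStress.minEnergy_lt_one_iff s).1 hp)
    rw [(hf.isStress.minEnergy_le_one s).antisymm h1, ENNReal.ofReal_one]
    refine ENNReal.le_of_forall_pos_le_add fun ε hε _ => ?_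
    obtain ⟨α, β, h, -, hle⟩ := hf.exists_fracture s (NNReal.coe_pos.2 hε)
    rw [ENNReal.ofReal_coe_nnreal] at hle
    exact iInf_le_of_le α (iInf_le_of_le β (iInf_le_of_le h hle))

theorem Potential.g₀_lt_one_iff (hf : Potential f ℓ ℓ₁) (s : ℝ≥0) :
    g₀ f s < 1 ↔ 0 < peak (stress f ℓ) ℓ s := by
  rw [hf.g₀_eq, ENNReal.ofReal_lt_one, hf.isStress.minEnergy_lt_one_iff]

theorem Potential.isProfileMin_iff (hf : Potential f ℓ ℓ₁) (s : ℝ≥0) (m : ℝ) :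
    IsProfileMin f s m ↔ m = minValue f ℓ s := by
  by_cases hp : 0 < peak (stress f ℓ) ℓ s
  · have hlt := (hf.g₀_lt_one_iff s).2 hp
    constructor
    · rintro ⟨β, ⟨-, α, h, he⟩ | ⟨hge, -⟩, hm⟩
      · obtain ⟨⟨t₀, rfl⟩, hmin⟩ := hm
        have h1 := h.le_energy hf s fun t => hmin ⟨t, rfl⟩
        have hmem := hf.stress_mem (h.mem_Icc t₀)
        rw [he, hf.g₀_eq, ENNReal.ofReal_le_ofReal_iff
          (hf.isStress.minEnergy_nonneg s.coe_nonneg)] at h1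
        exact hf.eq_minValue (h.mem_Icc t₀) (hf.isStress.peak_unique hmem h1)
      · exact absurd hlt hge.not_gt
    · rintro rfl
      obtain ⟨α, β, h, he, hm⟩ := hf.exists_minimizer hp
      exact ⟨β, Or.inl ⟨hlt, α, h, he.trans (hf.g₀_eq s).symm⟩, hm⟩
  · have hge := not_lt.1 (mt (hf.g₀_lt_one_iff s).1 hp)
    have h0 : minValue f ℓ s = 0 := by
      rw [minValue, hf.isStress.inv_of_nonpos (not_lt.1 hp), Real.sqrt_one, sub_self]
    rw [h0]
    constructor
    · rintro ⟨β, ⟨hlt, -⟩ | ⟨-, rfl⟩, hm⟩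
      · exact absurd hlt hge.not_gt
      · exact hm.unique isLeast_range_fractureProfile
    · rintro rfl
      exact ⟨fractureProfile, Or.inr ⟨hge, rfl⟩, isLeast_range_fractureProfile⟩

theorem Potential.profileMin_eq (hf : Potential f ℓ ℓ₁) (s : ℝ≥0) :
    profileMin f s = minValue f ℓ s := by
  simp [profileMin, hf.isProfileMin_iff]

theorem Admissible.gInf_le (h : Admissible α β) {t : ℝ} {s s' : ℝ≥0}
    (ht : β t ≤ profileMin f s') : gInf f s s' ≤ energy f s α β := by
  have hb : BddBelow (Set.range β) := ⟨0, by rintro _ ⟨t, rfl⟩; exact (h.mem_Icc t).1⟩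
  exact iInf_le_of_le α (iInf_le_of_le β (iInf_le_of_le h (iInf_le _ ((ciInf_le hb t).trans ht))))

theorem le_gInf {c : ℝ≥0∞} {s s' : ℝ≥0} (H : ∀ α β, Admissible α β → ∀ t₀, (∀ t, β t₀ ≤ β t) →
    β t₀ ≤ profileMin f s' → c ≤ energy f s α β) : c ≤ gInf f s s' := by
  refine le_iInf fun α => le_iInf fun β => le_iInf fun h => le_iInf fun hm => ?_
  obtain ⟨t₀, ht₀⟩ := h.exists_min
  exact H α β h t₀ ht₀ ((le_ciInf ht₀).trans hm)

theorem Potential.minEnergy_le_gInf (hf : Potential f ℓ ℓ₁) (s s' : ℝ≥0) :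
    ENNReal.ofReal (minEnergy (stress f ℓ) ℓ s) ≤ gInf f s s' :=
  le_gInf fun _ _ h _ _ _ => h.minEnergy_le_energy hf s

/-- Pre-existing damage has a positive cost, even at the opening `0`. -/
theorem Potential.dmg_le_gInf (hf : Potential f ℓ ℓ₁) (s s' : ℝ≥0) :
    ENNReal.ofReal (dmg (stress f ℓ) (peak (stress f ℓ) ℓ s')) ≤ gInf f s s' := by
  refine le_gInf fun α β h t₀ ht₀ hm => ?_
  rw [hf.profileMin_eq] at hm
  have h1 := hf.stress_le_stress (h.mem_Icc t₀).1 hm (hf.minValue_mem s').2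
  rw [hf.stress_minValue] at h1
  refine (ENNReal.ofReal_le_ofReal ?_).trans (h.le_energy hf s ht₀)
  have h2 := hf.isStress.antitone_dmg h1
  have h3 := mul_nonneg s.coe_nonneg (hf.stress_mem (h.mem_Icc t₀)).1
  linarith

theorem Potential.gInf_le_one (hf : Potential f ℓ ℓ₁) (s s' : ℝ≥0) : gInf f s s' ≤ 1 := by
  refine ENNReal.le_of_forall_pos_le_add fun ε hε _ => ?_
  obtain ⟨α, β, h, ⟨t, ht⟩, hle⟩ := hf.exists_fracture s (NNReal.coe_pos.2 hε)
  rw [ENNReal.ofReal_coe_nnreal] at hle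
  refine (h.gInf_le (t := t) ?_).trans hle
  rw [ht, hf.profileMin_eq]
  exact (hf.minValue_mem s').1

theorem Potential.gInf_lt_top (hf : Potential f ℓ ℓ₁) (s s' : ℝ≥0) : gInf f s s' < ∞ :=
  (hf.gInf_le_one s s').trans_lt ENNReal.one_lt_top

theorem Potential.gInf_eq_of_le (hf : Potential f ℓ ℓ₁) {s s' : ℝ≥0} (hs : s' ≤ s) :
    gInf f s s' = ENNReal.ofReal (minEnergy (stress f ℓ) ℓ s) := by
  refine le_antisymm ?_ (hf.minEnergy_le_gInf s s')
  by_cases hp : 0 < peak (stress f ℓ) ℓ s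
  · obtain ⟨α, β, h, he, ⟨t, ht⟩, -⟩ := hf.exists_minimizer hp
    rw [← he]
    refine h.gInf_le (t := t) ?_
    rw [ht, hf.profileMin_eq]
    exact hf.antitone_minValue (NNReal.coe_le_coe.2 hs)
  · have h1 := not_lt.1 (mt (hf.isStress.minEnergy_lt_one_iff s).1 hp)
    rw [(hf.isStress.minEnergy_le_one s).antisymm h1, ENNReal.ofReal_one]
    exact hf.gInf_le_one s s'

theorem energy_mono {s t : ℝ≥0} (h : s ≤ t) : energy f s α β ≤ energy f t α β := by
  refine lintegral_mono fun x => ?_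
  dsimp only
  gcongr

theorem gInf_mono_left (s' : ℝ≥0) : Monotone fun s => gInf f s s' := fun _ _ hst =>
  iInf_mono fun _ => iInf_mono fun _ => iInf_mono fun _ => iInf_mono fun _ => energy_mono hst

theorem Potential.gInf_mono_right (hf : Potential f ℓ ℓ₁) (s : ℝ≥0) :
    Monotone fun s' => gInf f s s' := fun σ σ' hσ =>
  le_gInf fun _ _ h _ _ hm => h.gInf_le (hm.trans (by
    rw [hf.profileMin_eq, hf.profileMin_eq]
    exact hf.antitone_minValue (NNReal.coe_le_coe.2 hσ)))

/-- The effect of an insertion on the cohesive energy: an increase of the damage costs a multiple of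
the increment, an additional opening at most the peak stress times the opening. -/
theorem Potential.gInf_add_le (hf : Potential f ℓ ℓ₁) (s₁ s₂ : ℝ≥0) {σ σ' : ℝ≥0} (hσ : σ ≤ σ') :
    gInf f (s₁ + s₂) σ' ≤ gInf f s₂ σ + ENNReal.ofReal
      (5 / 2 * (minValue f ℓ σ - minValue f ℓ σ') + s₁ * peak (stress f ℓ) ℓ σ') := by
  have hm := hf.antitone_minValue (NNReal.coe_le_coe.2 hσ)
  rcases eq_or_ne σ' 0 with rfl | hne
  · have h0 : σ = 0 := le_antisymm hσ zero_le
    have h1 := hf.isStress.minEnergy_add_le s₁.coe_nonneg s₂.coe_nonneg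
    have h2 := hf.isStress.minEnergy_le_ell_mul s₁
    rw [h0, hf.gInf_eq_of_le zero_le, hf.gInf_eq_of_le zero_le, NNReal.coe_zero,
      hf.isStress.peak_zero, sub_self, mul_zero, zero_add, NNReal.coe_add,
      ← ENNReal.ofReal_add (hf.isStress.minEnergy_nonneg s₂.coe_nonneg)
        (mul_nonneg s₁.coe_nonneg hf.ell_pos.le)]
    exact ENNReal.ofReal_le_ofReal (by linarith)
  have hlt := hf.minValue_lt_one (NNReal.coe_pos.2 (pos_iff_ne_zero.2 hne))
  have hm0 := (hf.minValue_mem σ').1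
  have hm1 := (hf.minValue_mem σ).2
  have hpk := (hf.isStress.isPeak σ').1.1
  rw [← tsub_le_iff_right]
  refine le_gInf fun α β h t₀ ht₀ hβ => ?_
  rw [tsub_le_iff_right]
  rw [hf.profileMin_eq] at hβ
  refine ENNReal.le_of_forall_pos_le_add fun ε hε _ => ?_
  set r := max 0 (β t₀ - minValue f ℓ σ') with hr
  have hr0 : 0 ≤ r := le_max_left _ _
  have hr1 : r ≤ minValue f ℓ σ - minValue f ℓ σ' := max_le (by linarith) (by linarith)
  have hr2 : β t₀ - minValue f ℓ σ' ≤ r := le_max_right _ _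
  have hr3 : r ≤ β t₀ := max_le (h.mem_Icc t₀).1 (by linarith)
  obtain ⟨α', β', h', ⟨t, ht⟩, hle⟩ := h.exists_insert hf hr0 hr3 (by linarith) s₁ s₂
    (NNReal.coe_pos.2 hε)
  have hs := hf.stress_le_stress (m := β t₀ - r) (m' := minValue f ℓ σ') (by linarith)
    (by linarith) hlt.le
  rw [hf.stress_minValue, show 1 - (β t₀ - r) = 1 - β t₀ + r by ring] at hs
  refine (h'.gInf_le (t := t) (by rw [ht, hf.profileMin_eq]; linarith)).trans (hle.trans ?_)
  rw [add_assoc (energy f s₂ α β), ← ENNReal.ofReal_coe_nnreal (p := ε),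
    ← ENNReal.ofReal_add (add_nonneg (by linarith) (mul_nonneg s₁.coe_nonneg hpk)) ε.coe_nonneg]
  refine add_le_add le_rfl (ENNReal.ofReal_le_ofReal ?_)
  have := mul_le_mul_of_nonneg_left hs s₁.coe_nonneg
  linarith

theorem Potential.coe_g (hf : Potential f ℓ ℓ₁) (s s' : ℝ≥0) : (g f s s' : ℝ≥0∞) = gInf f s s' :=
  ENNReal.coe_toNNReal (hf.gInf_lt_top s s').ne

theorem Potential.coe_g_eq_of_le (hf : Potential f ℓ ℓ₁) {s s' : ℝ≥0} (hs : s' ≤ s) :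
    (g f s s' : ℝ) = minEnergy (stress f ℓ) ℓ s := by
  rw [g, hf.gInf_eq_of_le hs, ENNReal.coe_toNNReal_eq_toReal,
    ENNReal.toReal_ofReal (hf.isStress.minEnergy_nonneg s.coe_nonneg)]

theorem Potential.minEnergy_le_g (hf : Potential f ℓ ℓ₁) (s s' : ℝ≥0) :
    minEnergy (stress f ℓ) ℓ s ≤ g f s s' := by
  have := hf.minEnergy_le_gInf s s'
  rwa [← hf.coe_g, ← ENNReal.ofReal_coe_nnreal,
    ENNReal.ofReal_le_ofReal_iff NNReal.zero_le_coe] at this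

theorem Potential.dmg_le_g (hf : Potential f ℓ ℓ₁) (s s' : ℝ≥0) :
    dmg (stress f ℓ) (peak (stress f ℓ) ℓ s') ≤ g f s s' := by
  have := hf.dmg_le_gInf s s'
  rwa [← hf.coe_g, ← ENNReal.ofReal_coe_nnreal,
    ENNReal.ofReal_le_ofReal_iff NNReal.zero_le_coe] at this

theorem Potential.g_le_one (hf : Potential f ℓ ℓ₁) (s s' : ℝ≥0) : g f s s' ≤ 1 := by
  have := hf.gInf_le_one s s'
  rw [← hf.coe_g] at this
  exact_mod_cast this

theorem Potential.g_mono (hf : Potential f ℓ ℓ₁) {s t s' t' : ℝ≥0} (h : s ≤ t) (h' : s' ≤ t') :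
    g f s s' ≤ g f t t' :=
  ENNReal.toNNReal_mono (hf.gInf_lt_top t t').ne
    ((gInf_mono_left s' h).trans (hf.gInf_mono_right t h'))

theorem Potential.g_add_le (hf : Potential f ℓ ℓ₁) (s₁ s₂ : ℝ≥0) {σ σ' : ℝ≥0} (hσ : σ ≤ σ') :
    (g f (s₁ + s₂) σ' : ℝ) ≤ g f s₂ σ
      + (5 / 2 * (minValue f ℓ σ - minValue f ℓ σ') + s₁ * peak (stress f ℓ) ℓ σ') := by
  have hm := hf.antitone_minValue (NNReal.coe_le_coe.2 hσ)
  have h0 : 0 ≤ 5 / 2 * (minValue f ℓ σ - minValue f ℓ σ') + s₁ * peak (stress f ℓ) ℓ σ' :=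
    add_nonneg (by linarith) (mul_nonneg s₁.coe_nonneg (hf.isStress.isPeak σ').1.1)
  have := hf.gInf_add_le s₁ s₂ hσ
  rwa [← hf.coe_g, ← hf.coe_g, ← ENNReal.ofReal_coe_nnreal, ← ENNReal.ofReal_coe_nnreal,
    ← ENNReal.ofReal_add NNReal.zero_le_coe h0,
    ENNReal.ofReal_le_ofReal_iff (add_nonneg NNReal.zero_le_coe h0)] at this

theorem Potential.continuous_g (hf : Potential f ℓ ℓ₁) :
    Continuous fun x : ℝ≥0 × ℝ≥0 => g f x.1 x.2 := by
  have key : ∀ x y : ℝ≥0 × ℝ≥0, (g f x.1 x.2 : ℝ) ≤ g f y.1 y.2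
      + (5 / 2 * (minValue f ℓ y.2 - minValue f ℓ ((max y.2 x.2 : ℝ≥0) : ℝ))
        + (max (y.1 : ℝ) x.1 - y.1) * ℓ) := fun x y => by
    have h1 := hf.g_add_le (max y.1 x.1 - y.1) y.1 (le_max_left y.2 x.2)
    rw [tsub_add_cancel_of_le (le_max_left _ _), NNReal.coe_sub (le_max_left _ _)] at h1
    have h2 : (g f x.1 x.2 : ℝ) ≤ g f (max y.1 x.1) (max y.2 x.2) :=
      hf.g_mono (le_max_right _ _) (le_max_right _ _)
    have h3 : (((max y.1 x.1 : ℝ≥0) : ℝ) - y.1) * peak (stress f ℓ) ℓ ((max y.2 x.2 : ℝ≥0) : ℝ)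
        ≤ (((max y.1 x.1 : ℝ≥0) : ℝ) - y.1) * ℓ :=
      mul_le_mul_of_nonneg_left (hf.isStress.isPeak _).1.2
        (sub_nonneg.2 (NNReal.coe_le_coe.2 (le_max_left _ _)))
    rw [NNReal.coe_max (x := y.1)] at h1 h3
    linarith
  have hc := hf.continuous_minValue
  rw [NNReal.isEmbedding_coe.continuous_iff]
  refine continuous_iff_continuousAt.2 fun x₀ => ?_
  have hU : Continuous fun x : ℝ≥0 × ℝ≥0 =>
      5 / 2 * (minValue f ℓ x₀.2 - minValue f ℓ ((max x₀.2 x.2 : ℝ≥0) : ℝ))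
        + (max (x₀.1 : ℝ) x.1 - x₀.1) * ℓ := by fun_prop
  have hL : Continuous fun x : ℝ≥0 × ℝ≥0 =>
      5 / 2 * (minValue f ℓ x.2 - minValue f ℓ ((max x.2 x₀.2 : ℝ≥0) : ℝ))
        + (max (x.1 : ℝ) x₀.1 - x.1) * ℓ := by fun_prop
  have hU' := (hU.tendsto x₀).const_add (g f x₀.1 x₀.2 : ℝ)
  have hL' := (hL.tendsto x₀).const_sub (g f x₀.1 x₀.2 : ℝ)
  simp only [max_self, sub_self, mul_zero, zero_mul, add_zero, sub_zero] at hU' hL'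
  exact tendsto_of_tendsto_of_tendsto_of_le_of_le hL' hU'
    (fun x => by have := key x₀ x; simp only [Function.comp_apply]; linarith)
    (fun x => key x x₀)

theorem Potential.strict_subadd (hf : Potential f ℓ ℓ₁) {s₁ s₂ s' : ℝ≥0} (hs₁ : 0 < s₁)
    (hpos : 0 < max s₂ s') : g f (s₁ + s₂) s' < g f s₁ 0 + g f s₂ s' := by
  have h1 : (0 : ℝ) < s₁ := NNReal.coe_pos.2 hs₁
  rw [← NNReal.coe_lt_coe, NNReal.coe_add, hf.coe_g_eq_of_le (s := s₁) zero_le]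
  rcases le_or_gt s' (s₁ + s₂) with hle | hlt
  · rw [hf.coe_g_eq_of_le hle, NNReal.coe_add]
    rcases eq_or_ne s₂ 0 with rfl | hs₂
    · have hs' : (0 : ℝ) < s' := by simpa using hpos
      have h2 := hf.isStress.dmg_pos (hf.isStress.isPeak s').1.1 (hf.isStress.peak_lt_ell hs')
      have h3 := hf.dmg_le_g 0 s'
      rw [NNReal.coe_zero, add_zero]
      linarith
    · have h2 := hf.isStress.minEnergy_add_lt h1 (NNReal.coe_pos.2 (pos_iff_ne_zero.2 hs₂))
      have h3 := hf.minEnergy_le_g s₂ s'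
      linarith
  -- beyond the previous damage the additional opening is realized at the peak stress of `s'`
  · have h2 := hf.g_add_le s₁ s₂ (le_refl s')
    have h3 : (s₁ : ℝ) ≤ s' := NNReal.coe_le_coe.2 (le_self_add.trans hlt.le)
    have h4 := mul_le_mul_of_nonneg_left (hf.isStress.antitone_peak h3) h1.le
    have h5 := hf.isStress.mul_peak_lt_minEnergy h1
    rw [sub_self, mul_zero, zero_add] at h2
    linarith

theorem Potential.subadd (hf : Potential f ℓ ℓ₁) (s₁ s₂ s' : ℝ≥0) :
    g f (s₁ + s₂) s' ≤ g f s₁ 0 + g f s₂ s' := by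
  rcases eq_or_ne s₁ 0 with rfl | hs₁
  · rw [zero_add]
    exact le_add_self
  rcases eq_or_ne (max s₂ s') 0 with h0 | hpos
  · have h2 : s₂ = 0 := le_antisymm ((le_max_left _ _).trans h0.le) zero_le
    have h3 : s' = 0 := le_antisymm ((le_max_right _ _).trans h0.le) zero_le
    rw [h2, h3, add_zero]
    exact le_self_add
  · exact (hf.strict_subadd (pos_iff_ne_zero.2 hs₁) (pos_iff_ne_zero.2 hpos)).le

theorem Potential.tendsto_g (hf : Potential f ℓ ℓ₁) (s' : ℝ≥0) :
    Tendsto (fun s => g f s s') atTop (𝓝 1) := by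
  rw [← NNReal.tendsto_coe]
  exact tendsto_of_tendsto_of_tendsto_of_le_of_le
    (hf.isStress.tendsto_minEnergy.comp (NNReal.tendsto_coe_atTop.2 tendsto_id))
    tendsto_const_nhds (fun s => hf.minEnergy_le_g s s')
    (fun s => NNReal.coe_le_coe.2 (hf.g_le_one s s'))

theorem Potential.exists_isCohesiveDensity (hf : Potential f ℓ ℓ₁) :
    ∃ ℓ' : ℝ, IsCohesiveDensity (g f) ℓ ℓ' (5 / 3) := by
  obtain ⟨K, hK, hexp⟩ := hf.isStress.exists_isLittleO_minEnergy hf.ell₁_pos hf.stress_expansion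
  refine ⟨K, hf.continuous_g, fun s' _ _ hst => hf.g_mono hst le_rfl,
    fun s _ _ hst => hf.g_mono le_rfl hst, fun s s' hs => ?_, hf.g_le_one, hf.tendsto_g,
    hf.ell_pos, hK, by norm_num, by norm_num, ?_, hf.subadd,
    fun _ _ _ h1 h2 => hf.strict_subadd h1 h2⟩
  · rw [g, g, hf.gInf_eq_of_le hs, hf.gInf_eq_of_le zero_le]
  · have hT : Tendsto ((↑) : ℝ≥0 → ℝ) (𝓝[>] 0) (𝓝[>] 0) := by
      refine tendsto_nhdsWithin_iff.2 ⟨?_, ?_⟩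
      · exact (NNReal.continuous_coe.tendsto' 0 0 NNReal.coe_zero).mono_left nhdsWithin_le_nhds
      · filter_upwards [self_mem_nhdsWithin] with s hs using NNReal.coe_pos.2 hs
    refine (hexp.comp_tendsto hT).congr_left fun s => ?_
    rw [hf.coe_g_eq_of_le zero_le, Function.comp_apply]

end Cohesive

theorem theorem7p1 (f : ℝ → ℝ) (ℓ ℓ₁ : ℝ) (hf : Cohesive.Potential f ℓ ℓ₁) :
    (∀ s : ℝ≥0, ∃! m : ℝ, Cohesive.IsProfileMin f s m) ∧
    (∀ s s' : ℝ≥0, Cohesive.gInf f s s' < ∞) ∧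
    ∃ ℓ' : ℝ, Cohesive.IsCohesiveDensity (Cohesive.g f) ℓ ℓ' (5 / 3) := by
  refine ⟨fun s => ?_, hf.gInf_lt_top, hf.exists_isCohesiveDensity⟩
  simp only [hf.isProfileMin_iff]
  exact existsUnique_eq
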